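/- Let $X=X_0\xrightarrow{f_0}X_1\xrightarrow{f_1}\cdots\xrightarrow{f_{N-1}}X_N=Y$ be a sequence of morphisms of smooth proper integral complex varieties of dimension $n$, where each $f_i:X_i\to X_{i+1}$ is the blow-up of $X_{i+1}$ along a smooth closed subscheme $Z_{i+1}\subset X_{i+1}$ (the center). Let $D_Y=D_N$ be an effective divisor on $Y$, and define recursively $D_i=(f_i)_*^{-1}D_{i+1}+E_i$, where $(f_i)_*^{-1}D_{i+1}$ is the strict transform (the closure of the inverse image of $D_{i+1}$ on the complement of $Z_{i+1}$) and $E_i=f_i^{-1}(Z_{i+1})$ is the exceptional divisor; put $D_X=D_0$. Suppose that $\mathrm{mult}_{W}D_i\ge\mathrm{codim}(W,X_i)$ for each irreducible component $W$ of each center $Z_i\subset X_i$, $1\le i\le N$, and that $K_X+D_X$ and $K_Y+D_Y$ are ample (so that $X$ and $Y$ are projective). For an ample divisor $A$ on a smooth projective complex variety $V$, an effective divisor $D$ on $V$ and a real number $\epsilon>0$, say that $(V,D)$ is algebraically hyperbolic with respect to $A$ with constant $\epsilon$ if every integral curve $C\subset V$ not contained in the support of $D$ satisfies \[2g(C)-2+i(C,D)\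 \ge\ \epsilon\cdot\deg_A C,\] where $g(C)$ is the geometric genus of $C$ and $i(C,D)=|\nu^{-1}(D)|$ for the normalization map $\nu:\widehat C\to V$ of $C$. Then for every $\epsilon>0$: if $(Y,D_Y)$ is algebraically hyperbolic with respect to $K_Y+D_Y$ with constant $\epsilon$, then $(X,D_X)$ is algebraically hyperbolic with respect to $K_X+D_X$ with the same constant $\epsilon$. -/

import Mathlib

open CategoryTheory AlgebraicGeometry Order

namespace LogHyperbolic

noncomputable section

/-! ### Varieties over the complex numbers -/

/-- A smooth proper complex variety of dimension `n`: an integral scheme, proper and smooth of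
relative dimension `n` over `Spec ℂ`. (A proper variety that carries an ample divisor is
projective.) -/
structure SmoothVariety (n : ℕ) where
  /-- the underlying scheme -/
  carrier : Scheme.{0}
  /-- the structure morphism -/
  str : carrier ⟶ Spec (.of ℂ)
  integral : IsIntegral carrier
  proper : IsProper str
  smooth : SmoothOfRelativeDimension n str

attribute [instance] SmoothVariety.integral SmoothVariety.proper SmoothVariety.smooth

theorem isLocallyNoetherian_of_locallyOfFiniteType {X : Scheme.{0}} (s : X ⟶ Spec (.of ℂ))
    [LocallyOfFiniteType s] : IsLocallyNoetherian X :=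
  haveI : IsNoetherianRing (CommRingCat.of ℂ) := inferInstanceAs (IsNoetherianRing ℂ)
  LocallyOfFiniteType.isLocallyNoetherian s

instance SmoothVariety.isLocallyNoetherian {n : ℕ} (X : SmoothVariety n) :
    IsLocallyNoetherian X.carrier :=
  isLocallyNoetherian_of_locallyOfFiniteType X.str

/-! ### Differential forms -/

section Differentials

variable (X : Scheme.{0}) [IsIntegral X] (s : X ⟶ Spec (.of ℂ))

/-- The function field of an integral scheme over `Spec ℂ` as a `ℂ`-algebra. -/
@[reducible] def functionFieldAlgebra : Algebra ℂ X.functionField :=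
  ((Scheme.ΓSpecIso (.of ℂ)).inv ≫ s.appTop ≫
    X.presheaf.germ ⊤ (genericPoint X) trivial).hom.toAlgebra

/-- The local ring at `x`, as a subring of the function field. -/
def localRing (x : X) : Subring X.functionField :=
  (algebraMap (X.presheaf.stalk x) X.functionField).range

/-- The space `⋀ᵏ Ω_{K(X)/ℂ}` of rational `k`-forms. -/
abbrev RationalForms (k : ℕ) : Type :=
  letI := functionFieldAlgebra X s
  ⋀[X.functionField]^k (Ω[X.functionField⁄ℂ])

/-- The image of `⋀ᵏ Ω_{𝒪_x/ℂ}` in the rational `k`-forms: the `𝒪_x`-span of all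
`da₁ ∧ ⋯ ∧ daₖ` with `aᵢ ∈ 𝒪_x`. -/
def regularFormsAt (k : ℕ) (x : X) : Submodule (localRing X x) (RationalForms X s k) :=
  letI := functionFieldAlgebra X s
  Submodule.span (localRing X x) (Set.range fun a : Fin k → localRing X x =>
    exteriorPower.ιMulti X.functionField k
      fun i => KaehlerDifferential.D ℂ X.functionField (a i : X.functionField))

/-- The global regular `1`-forms: rational `1`-forms that are regular at every point
(for a smooth curve this is `H⁰(X, Ω¹)`). -/
def globalOneForms :
    letI := functionFieldAlgebra X s
    Submodule ℂ (RationalForms X s 1) :=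
  letI := functionFieldAlgebra X s
  { carrier := {ω | ∀ x : X, ω ∈ regularFormsAt X s 1 x}
    add_mem' := fun ha hb x => add_mem (ha x) (hb x)
    zero_mem' := fun x => zero_mem _
    smul_mem' := by
      intro c ω h x
      have hc : algebraMap ℂ X.functionField c ∈ localRing X x := by
        refine ⟨X.presheaf.germ ⊤ x trivial
          (((Scheme.ΓSpecIso (.of ℂ)).inv ≫ s.appTop).hom c), ?_⟩
        have : Nonempty (⊤ : X.Opens) := ⟨⟨genericPoint X, trivial⟩⟩
        exact X.algebraMap_germ_eq_germToFunctionField (U := ⊤) (x := x) trivial _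
      have := (regularFormsAt X s 1 x).smul_mem ⟨_, hc⟩ (h x)
      rwa [Subring.smul_def, algebraMap_smul] at this }

/-- The genus `dim_ℂ H⁰(X, Ω¹)` of a smooth proper curve. -/
def genus : ℕ :=
  letI := functionFieldAlgebra X s
  Module.finrank ℂ (globalOneForms X s)

end Differentials

/-! ### Divisors -/

section Divisors

variable {X : Scheme.{0}} [IsIntegral X] [IsLocallyNoetherian X]

/-- `h` is a local equation at `x` of the divisor `D`. Prime divisors are given by their generic
points, the points of codimension one. -/
def IsLocalEquation (D : AlgebraicCycle X ℤ) (x : X) (h : X.functionField) : Prop :=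
  h ≠ 0 ∧ ∀ w : X, coheight w = 1 → w ⤳ x → Scheme.ord h w = D w

/-- A (Cartier) divisor, as a cycle of codimension one that is locally principal. On a smooth
variety every cycle of codimension one is locally principal. -/
def IsDivisor (D : AlgebraicCycle X ℤ) : Prop :=
  (∀ z : X, D z ≠ 0 → coheight z = 1) ∧ ∀ x : X, ∃ h, IsLocalEquation D x h

/-- The support of a divisor: the union of the prime divisors of nonzero coefficient. -/
def divisorSupport (D : X → ℤ) : Set X := {x | ∃ z : X, D z ≠ 0 ∧ z ⤳ x}

/-- The multiplicity of `D` at a point `z`, that is, along the subvariety with generic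
point `z`: the largest `k` such that a local equation at `z` lies in `𝔪_z ^ k`. -/
def multiplicity (D : AlgebraicCycle X ℤ) (z : X) : ℕ∞ :=
  sSup {k : ℕ∞ | ∃ (m : ℕ) (a : X.presheaf.stalk z), k = m ∧
    a ∈ IsLocalRing.maximalIdeal (X.presheaf.stalk z) ^ m ∧
    IsLocalEquation D z (algebraMap (X.presheaf.stalk z) X.functionField a)}

/-- `A` is ample: every point lies in an affine open of the form `X_s`, where `s` is a section of
`𝒪(mA)` for some `m ≥ 1`. Sections of `𝒪(mA)` are the rational functions `g` with
`div g + mA ≥ 0`, and `X_s` is the complement of the support of `div g + mA`. -/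
def IsAmple (A : AlgebraicCycle X ℤ) : Prop :=
  IsDivisor A ∧ ∀ x : X, ∃ m : ℕ, 1 ≤ m ∧ ∃ g : X.functionField, g ≠ 0 ∧
    (∀ z : X, 0 ≤ Scheme.ord g z + m * A z) ∧
    ∃ U : X.Opens, IsAffineOpen U ∧ x ∈ U ∧
      (U : Set X) = (divisorSupport fun z => Scheme.ord g z + m * A z)ᶜ

/-- `K` is a canonical divisor of the `n`-dimensional smooth variety `X`: the divisor of some
nonzero rational `n`-form `ω`. The order of `ω = g • ω₀` at `z` is that of `g`, where `ω₀`
generates the regular `n`-forms at `z`. -/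
def IsCanonicalDivisor (n : ℕ) (s : X ⟶ Spec (.of ℂ)) (K : AlgebraicCycle X ℤ) : Prop :=
  letI := functionFieldAlgebra X s
  ∃ ω : RationalForms X s n, ω ≠ 0 ∧
    (∀ z : X, coheight z ≠ 1 → K z = 0) ∧
    ∀ z : X, coheight z = 1 → ∃ (g : X.functionField) (ω₀ : RationalForms X s n),
      regularFormsAt X s n z = Submodule.span (localRing X z) {ω₀} ∧
      ω = g • ω₀ ∧ K z = Scheme.ord g z

end Divisors

/-! ### Blow-ups -/

section BlowUp

/-- An ideal sheaf is invertible (defines an effective Cartier divisor) if it is locally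
generated by one nonzerodivisor. -/
def IsInvertibleIdeal {T : Scheme.{0}} (J : T.IdealSheafData) : Prop :=
  ∀ x : T, ∃ U : T.affineOpens, x ∈ U.1 ∧ ∃ a ∈ nonZeroDivisors Γ(T, U.1),
    J.ideal U = Ideal.span {a}

/-- `f : X ⟶ Y` is the blow-up of `Y` along the closed subscheme of the ideal sheaf `I`: the
universal morphism to `Y` for which the inverse image ideal sheaf of `I` is invertible. -/
def IsBlowUp {X Y : Scheme.{0}} (I : Y.IdealSheafData) (f : X ⟶ Y) : Prop :=
  IsInvertibleIdeal (I.comap f) ∧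
    ∀ (T : Scheme.{0}) (g : T ⟶ Y), IsInvertibleIdeal (I.comap g) → ∃! h : T ⟶ X, h ≫ f = g

/-- `z` is the generic point of an irreducible component of the closed set `Z`. -/
def IsComponentGenericPoint {X : Scheme.{0}} (Z : Set X) (z : X) : Prop :=
  z ∈ Z ∧ ∀ w ∈ Z, w ⤳ z → w = z

open Classical in
/-- Coefficients of the strict transform of the divisor `D` under the blow-up `f` with
center `Z`: the closure of the inverse image of `D` away from `Z`. -/
def strictTransform {X Y : Scheme.{0}} (f : X ⟶ Y) (Z : Set Y) (D : Y → ℤ) (z : X) : ℤ :=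
  if f z ∈ Z then 0 else D (f z)

open Classical in
/-- Coefficients of the exceptional divisor `f⁻¹(Z)` of the blow-up `f` with smooth
center `Z`. -/
def exceptionalDivisor {X Y : Scheme.{0}} (f : X ⟶ Y) (Z : Set Y) (z : X) : ℤ :=
  if coheight z = 1 ∧ f z ∈ Z then 1 else 0

end BlowUp

/-! ### Curves and algebraic hyperbolicity -/

section Curves

/-- An integral curve in `X` (a one-dimensional integral closed subscheme `ι : C ⟶ X`) with its
normalization `ν : Cn ⟶ C` (a finite birational morphism from a normal integral scheme). -/
structure NormalizedCurve (X : Scheme.{0}) where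
  /-- the curve -/
  C : Scheme.{0}
  /-- the inclusion of the curve -/
  ι : C ⟶ X
  closedImmersion : IsClosedImmersion ι
  integral : IsIntegral C
  dim_one : topologicalKrullDim C = 1
  /-- the normalization of the curve -/
  Cn : Scheme.{0}
  /-- the normalization morphism -/
  ν : Cn ⟶ C
  integral_normalization : IsIntegral Cn
  normal : ∀ p : Cn, IsIntegrallyClosed (Cn.presheaf.stalk p)
  finite : IsFinite ν
  birational : IsIso (ν.stalkMap (genericPoint Cn))

attribute [instance] NormalizedCurve.closedImmersion NormalizedCurve.integral
  NormalizedCurve.integral_normalization NormalizedCurve.finite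

variable {n : ℕ} {X : SmoothVariety n}

/-- The morphism from the normalization of the curve to `X`. -/
def NormalizedCurve.toVariety (c : NormalizedCurve X.carrier) : c.Cn ⟶ X.carrier := c.ν ≫ c.ι

/-- The structure morphism of the normalization. -/
def NormalizedCurve.str (c : NormalizedCurve X.carrier) : c.Cn ⟶ Spec (.of ℂ) :=
  c.toVariety ≫ X.str

instance NormalizedCurve.isLocallyNoetherian (c : NormalizedCurve X.carrier) :
    IsLocallyNoetherian c.Cn :=
  haveI : LocallyOfFiniteType c.str := by
    unfold NormalizedCurve.str NormalizedCurve.toVariety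
    infer_instance
  isLocallyNoetherian_of_locallyOfFiniteType c.str

/-- `d` is the degree of the divisor `A` on the curve, that is, the degree of the pullback
of `𝒪(A)` to the normalization, computed as the degree of the divisor of a rational section:
`g` is a local equation of `A` at the generic point `ξ` of the curve, `g * u p` is one at the image
of `p` for some unit `u p` of the local ring at `ξ`, and the section has order at `p` equal
to the order of the restriction of `u p` to the normalization. -/
def IsDegree (A : AlgebraicCycle X.carrier ℤ) (c : NormalizedCurve X.carrier) (d : ℤ) : Prop :=
  ∃ (g : X.carrier.functionField)
    (u : c.Cn → (X.carrier.presheaf.stalk (c.toVariety (genericPoint c.Cn)))ˣ),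
    IsLocalEquation A (c.toVariety (genericPoint c.Cn)) g ∧
    (∀ p : c.Cn, IsLocalEquation A (c.toVariety p) (g * algebraMap _ _ (u p).val)) ∧
    (Function.support fun p : c.Cn => Scheme.ord
      ((c.toVariety.stalkMap (genericPoint c.Cn)).hom (u p).val) p).Finite ∧
    d = ∑ᶠ p : c.Cn, Scheme.ord
      ((c.toVariety.stalkMap (genericPoint c.Cn)).hom (u p).val) p

/-- The geometric genus of the curve. -/
def NormalizedCurve.geometricGenus (c : NormalizedCurve X.carrier) : ℕ := genus c.Cn c.str

/-- The number `i(C, D)` of points of the normalization lying over the support of `D`. -/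
def NormalizedCurve.boundaryCount (c : NormalizedCurve X.carrier)
    (D : AlgebraicCycle X.carrier ℤ) : ℕ :=
  (c.toVariety ⁻¹' divisorSupport D : Set c.Cn).ncard

/-- The pair `(X, D)` is algebraically hyperbolic with respect to the polarization `A`, with
constant `ε`: `2g(C) - 2 + i(C, D) ≥ ε · deg_A C` for all integral curves `C` in `X` not
contained in `D`. -/
def IsAlgHyperbolic (X : SmoothVariety n) (D A : AlgebraicCycle X.carrier ℤ) (ε : ℝ) : Prop :=
  0 < ε ∧ IsAmple A ∧
    ∀ c : NormalizedCurve X.carrier, ¬ Set.range c.ι ⊆ divisorSupport D →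
      ∃ d : ℤ, IsDegree A c d ∧
        2 * (c.geometricGenus : ℝ) - 2 + (c.boundaryCount D : ℝ) ≥ ε * (d : ℝ)

end Curves

end

end LogHyperbolic

/-! The composite F of the blow-ups is an isomorphism off D_X, the inverse image of Supp D_Y is Supp
D_X, and, for compatible canonical divisors, F^*(K_Y + D_Y) - (K_X + D_X) is effective with support
in D_X. It suffices to see this for one blow-up f. Let the center have codimension c and let D_Y
have multiplicity m along it. Then K_X = f^*K_Y + (c-1)E, while f^*D_Y is the strict transform plus
mE. Since D_X is the strict transform plus E, the difference is (m-c)E, and m ≥ c. As c ≥ 1, the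
center also lies in D_Y.

A curve C not contained in D_X therefore maps birationally onto its image C', which is not contained
in D_Y. Both have the same normalization, so the geometric genus is the same, and the points over
the boundary are the same. The degree of K_X + D_X on C is at most that of K_Y + D_Y on C', so the
inequality for C' gives the one for C.

Divisors are never pulled back. `LogPullback` says instead that a function divisible by a local
equation of div(db₁ ∧ ⋯ ∧ dbₙ) + D_Y at F x pulls back to one divisible by a local equation of
div(dφ(b₁) ∧ ⋯ ∧ dφ(bₙ)) + D_X at x, with equality of orders off D_X. This form composes at once.

For one blow-up the work lies at the generic point w of an exceptional divisor
(`IsBlowUp.exceptional_coordinates`). Smoothness of the center gives coordinates at f(w) of which a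
subset generates its ideal (`exists_adapted_coordinates`). The universal property identifies the
local ring at w with fractions in the blow-up algebra (`IsBlowUp.exists_fractions`). The quotients v
i / v i₀ then give coordinates at w, with Jacobian a power of v i₀. Normality of smooth varieties
and Hartogs' principle turn inequalities of orders into regularity of functions.
`IsBlowUp.logOrd_le_ord_of_exceptional` combines these, and `LogPullback.exists_isDegreeAlong_le`
passes to degrees. -/

namespace LogHyperbolic

noncomputable section

/-! ### Dual derivations bound the dimension of a local ring from below -/

section Derivations
variable {k A : Type*} [Field k] [CharZero k] [CommRing A] [Algebra k A]
  [IsLocalRing A] [IsNoetherianRing A]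

/-- The x-power torsion T is stable under δ. Differentiating x^(j+1) b = 0 and dividing by j + 1,
which needs characteristic zero, gives T ⊆ 𝔪T, so T = 0 by Nakayama. -/
theorem mem_nonZeroDivisors_of_derivation_eq_one (δ : Derivation k A A) {x : A}
    (hx : x ∈ IsLocalRing.maximalIdeal A) (hδ : δ x = 1) : x ∈ nonZeroDivisors A := by
  let T : Ideal A :=
    { carrier := {b | ∃ N : ℕ, x ^ N * b = 0}
      add_mem' := by
        rintro a b ⟨N, hN⟩ ⟨M, hM⟩
        exact ⟨N + M, by rw [mul_add, pow_add]; linear_combination x ^ M * hN + x ^ N * hM⟩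
      zero_mem' := ⟨0, by simp⟩
      smul_mem' := by
        rintro c b ⟨N, hN⟩
        exact ⟨N, by rw [smul_eq_mul]; linear_combination c * hN⟩ }
  have hδT {b : A} (hb : b ∈ T) : δ b ∈ T := by
    obtain ⟨N, hN⟩ := hb
    refine ⟨N + 1, ?_⟩
    have h : δ (x ^ N * b) = 0 := by rw [hN, map_zero]
    rw [Derivation.leibniz, Derivation.leibniz_pow, hδ] at h
    simp only [smul_eq_mul, nsmul_eq_mul, mul_one] at h
    cases N with
    | zero => simp_all
    | succ N =>
      simp only [Nat.add_sub_cancel] at h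
      linear_combination x * h - (N + 1 : ℕ) * hN
  -- The derivative of x^(j+1) b = 0 reads x^j ((j+1) b + x δb) = 0, so the inductive hypothesis
  -- applies to the bracket, and x δb is already in 𝔪T.
  have key : ∀ j : ℕ, ∀ b : A, x ^ j * b = 0 → b ∈ IsLocalRing.maximalIdeal A • T := by
    intro j
    induction j with
    | zero => intro b hb; simp_all
    | succ j ih =>
      intro b hb
      have hbT : b ∈ T := ⟨_, hb⟩
      have h : δ (x ^ (j + 1) * b) = 0 := by rw [hb, map_zero]
      rw [Derivation.leibniz, Derivation.leibniz_pow, hδ] at h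
      simp only [smul_eq_mul, nsmul_eq_mul, mul_one, Nat.add_sub_cancel] at h
      have h1 := ih (((j + 1 : ℕ) : A) * b + x * δ b) (by linear_combination h)
      have h2 : x * δ b ∈ IsLocalRing.maximalIdeal A • T := Submodule.smul_mem_smul hx (hδT hbT)
      have h3 : ((j + 1 : ℕ) : A) * b ∈ IsLocalRing.maximalIdeal A • T := by
        simpa using sub_mem h1 h2
      have h4 := Ideal.mul_mem_left _ (algebraMap k A ((j + 1 : ℕ) : k)⁻¹) h3
      rwa [← mul_assoc, ← map_natCast (algebraMap k A), ← map_mul,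
        inv_mul_cancel₀ (by exact_mod_cast j.succ_ne_zero), map_one, one_mul] at h4
  have hT : T = ⊥ := Submodule.eq_bot_of_le_smul_of_le_jacobson_bot _ T
    (IsNoetherian.noetherian T) (fun b ⟨j, hj⟩ => key j b hj)
    (IsLocalRing.maximalIdeal_le_jacobson _)
  rw [mem_nonZeroDivisors_iff_left]
  intro b hb
  have : b ∈ T := ⟨1, by simpa using hb⟩
  rwa [hT] at this

end Derivations

/-- Each x i is a nonzerodivisor modulo the preceding ones: the derivations dual to the other
elements kill x 0, hence descend to A/(x 0), and the dimension drops by at least one. It yields the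
bound on the number of generators of the center without regularity of the local ring. -/
theorem natCast_le_ringKrullDim_of_derivation {k : Type*} [Field k] [CharZero k] (c : ℕ) :
    ∀ {A : Type*} [CommRing A] [Algebra k A] [IsLocalRing A] [IsNoetherianRing A]
    (x : Fin c → A) (_ : ∀ i, x i ∈ IsLocalRing.maximalIdeal A) (δ : Fin c → Derivation k A A)
    (_ : ∀ i j, δ i (x j) = if i = j then 1 else 0), (c : WithBot ℕ∞) ≤ ringKrullDim A := by
  induction c with
  | zero =>
    intro A _ _ _ _ x hx δ hδ
    simpa using ringKrullDim_nonneg_of_nontrivial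
  | succ c ih =>
    intro A _ _ _ _ x hx δ hδ
    let I : Ideal A := Ideal.span {x 0}
    have hI : I ≤ IsLocalRing.maximalIdeal A := by
      rw [Ideal.span_le]; simpa using hx 0
    have : Nontrivial (A ⧸ I) := Ideal.Quotient.nontrivial_iff.mpr
      (ne_top_of_le_ne_top Ideal.IsPrime.ne_top' hI)
    have : IsLocalRing (A ⧸ I) := .of_surjective' (Ideal.Quotient.mk I) Ideal.Quotient.mk_surjective
    have hd (i : Fin c) (a : A) (ha : Ideal.Quotient.mkₐ k I a = 0) :
        Ideal.Quotient.mkₐ k I (δ i.succ a) = 0 := by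
      rw [Ideal.Quotient.mkₐ_eq_mk, Ideal.Quotient.eq_zero_iff_mem,
        Ideal.mem_span_singleton'] at ha ⊢
      obtain ⟨b, rfl⟩ := ha
      refine ⟨δ i.succ b, ?_⟩
      rw [Derivation.leibniz, hδ, if_neg (Fin.succ_ne_zero i)]
      simp [mul_comm]
    have := ih (A := A ⧸ I) (fun i => Ideal.Quotient.mkₐ k I (x i.succ))
      (fun i => by
        rw [IsLocalRing.mem_maximalIdeal, mem_nonunits_iff]
        intro hu
        obtain ⟨b, hb⟩ := hu.exists_right_inv
        obtain ⟨b, rfl⟩ := Ideal.Quotient.mkₐ_surjective k I b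
        rw [← map_mul, ← map_one (Ideal.Quotient.mkₐ k I), Ideal.Quotient.mkₐ_eq_mk,
          Ideal.Quotient.eq] at hb
        have h1 := sub_mem (Ideal.mul_mem_right b _ (hx i.succ)) (hI hb)
        rw [sub_sub_cancel] at h1
        exact (Ideal.ne_top_iff_one _).mp Ideal.IsPrime.ne_top' h1)
      (fun i => Derivation.liftOfSurjective (Ideal.Quotient.mkₐ_surjective k I) (hd i))
      (fun i j => by
        rw [Derivation.liftOfSurjective_apply, hδ]
        simp [Fin.succ_inj, apply_ite])
    calc ((c + 1 : ℕ) : WithBot ℕ∞) = (c : WithBot ℕ∞) + 1 := by push_cast; rfl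
      _ ≤ ringKrullDim (A ⧸ I) + 1 := by gcongr
      _ ≤ _ := ringKrullDim_quotient_succ_le_of_nonZeroDivisor
        (mem_nonZeroDivisors_of_derivation_eq_one (δ 0) (hx 0) (by simp [hδ]))

/-! ### Functions regular in codimension one -/

section Hartogs

/-- An element of the fraction field of a Noetherian integrally closed local domain that is
regular in codimension one belongs to the ring. -/
theorem mem_range_algebraMap_of_height_one {A K : Type*} [CommRing A] [IsDomain A]
    [IsNoetherianRing A] [IsIntegrallyClosed A] [Field K] [Algebra A K] [IsFractionRing A K]
    (h : K) (hh : ∀ P : Ideal A, P.IsPrime → P.height = 1 →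
      ∃ d ∉ P, ∃ a, algebraMap A K d * h = algebraMap A K a) :
    h ∈ (algebraMap A K).range := by
  by_contra hA
  let M := K ⧸ (LinearMap.range (Algebra.linearMap A K))
  let m : M := Submodule.Quotient.mk h
  have hmk (k : K) : (Submodule.Quotient.mk k : M) = 0 ↔ k ∈ (algebraMap A K).range := by
    rw [Submodule.Quotient.mk_eq_zero]; rfl
  let m' : Submodule.span A {m} := ⟨m, Submodule.mem_span_singleton_self m⟩
  have hm' : m' ≠ 0 := fun h0 => hA ((hmk h).mp (congrArg Subtype.val h0))
  obtain ⟨P, hP, -⟩ := exists_le_isAssociatedPrime_of_isNoetherianRing A m' hm'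
  obtain ⟨hPp, ⟨y, hy⟩, hPy⟩ := (isAssociatedPrime_iff).mp hP
  obtain ⟨s, rfl⟩ := Submodule.mem_span_singleton.mp hy
  have hmem (a : A) : a ∈ P ↔ algebraMap A K a * (algebraMap A K s * h) ∈ (algebraMap A K).range := by
    rw [hPy, Submodule.mem_colon_singleton, Submodule.mem_bot, ← hmk, Subtype.ext_iff]
    simp only [SetLike.mk_smul_mk, ZeroMemClass.coe_zero, m, ← Algebra.smul_def]
    rfl
  set h' := algebraMap A K s * h with hh'
  have hh'A : h' ∉ (algebraMap A K).range := fun hc =>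
    (Ideal.ne_top_iff_one P).mp hPp.ne_top ((hmem 1).mpr (by simpa using hc))
  have hne : P ≠ ⊥ := by
    rintro rfl
    obtain ⟨a, b, hb, hab⟩ := IsFractionRing.div_surjective (A := A) h'
    have hb0 := nonZeroDivisors.ne_zero hb
    refine hb0 ((hmem b).mpr ⟨a, ?_⟩)
    rw [← hab, mul_div_cancel₀]
    exact (map_ne_zero_iff _ (IsFractionRing.injective A K)).mpr hb0
  have h1 : P.height = 1 := by
    refine le_antisymm ?_ (Order.one_le_iff_ne_zero.mpr ?_)
    -- P is the annihilator of h' modulo A. If p h' = u with u ∉ P, then each q ∈ P satisfies q u ∈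
    -- (p), so P is minimal over (p) and Krull's theorem bounds its height. Otherwise P h' ⊆ P, and
    -- h' is integral by the determinant trick.
    · by_cases hc : ∃ p ∈ P, ∃ u ∉ P, algebraMap A K p * h' = algebraMap A K u
      · obtain ⟨p, hp, u, hu, hpu⟩ := hc
        have : P ∈ (Ideal.span {p}).minimalPrimes := by
          refine ⟨⟨hPp, by simpa [Ideal.span_le] using hp⟩, ?_⟩
          rintro Q ⟨hQ, hpQ⟩ hQP q hq
          obtain ⟨r, hr⟩ := (hmem q).mp hq
          have : q * u = r * p := by
            apply IsFractionRing.injective A K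
            rw [map_mul, map_mul, ← hpu, hr]; ring
          have : q * u ∈ Q := this ▸ Ideal.mul_mem_left _ _ (hpQ (Ideal.mem_span_singleton_self p))
          exact (hQ.mem_or_mem this).resolve_right (fun h => hu (hQP h))
        exact Ideal.height_le_one_of_isPrincipal_of_mem_minimalPrimes _ _ this
      · exfalso
        push Not at hc
        apply hh'A
        have hint : IsIntegral A h' := by
          refine isIntegral_of_smul_mem_submodule
            (Submodule.map (Algebra.linearMap A K) (P : Submodule A A)) ?_ ?_ h' ?_
          · intro h0
            refine hne (Submodule.map_injective_of_injective
              (f := Algebra.linearMap A K) (IsFractionRing.injective A K) ?_)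
            rw [h0, Submodule.map_bot]
          · exact (IsNoetherian.noetherian P).map _
          · rintro _ ⟨p, hp, rfl⟩
            obtain ⟨r, hr⟩ := (hmem p).mp hp
            refine ⟨r, by_contra fun hr' => hc p hp r hr' hr.symm, ?_⟩
            rw [Algebra.linearMap_apply, Algebra.linearMap_apply, hr, smul_eq_mul, mul_comm]
        exact IsIntegrallyClosed.isIntegral_iff.mp hint
    · rwa [Ne, Ideal.height_eq_zero_iff_eq_bot]
  obtain ⟨d, hd, a, had⟩ := hh P hPp h1
  exact hd ((hmem d).mpr ⟨s * a, by rw [hh', map_mul, ← had]; ring⟩)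

end Hartogs

/-! ### Smooth algebras over a field are normal -/

section Normal
open scoped TensorProduct

/-- S is étale over a polynomial ring R, and integral closure commutes with smooth base change. As R
is integrally closed in its fraction field K, S is integrally closed in S ⊗ K. An integral element
of Frac S already lies in S ⊗ K, because S is algebraic over R. -/
theorem isIntegrallyClosed_of_isStandardSmooth (n : ℕ) {k S : Type*} [Field k] [CommRing S]
    [IsDomain S] [Algebra k S] [Algebra.IsStandardSmoothOfRelativeDimension n k S] :
    IsIntegrallyClosed S := by
  obtain ⟨g, hg⟩ :=
    Algebra.IsStandardSmoothOfRelativeDimension.exists_etale_mvPolynomial (n := n) k S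
  let R := MvPolynomial (Fin n) k
  let := g.toRingHom.toAlgebra
  have : Algebra.Etale R S := hg
  let K := FractionRing R
  have : Algebra.Smooth R S := inferInstance
  have : Module.Flat R S := inferInstance
  have : FaithfulSMul R S := inferInstance
  let F := FractionRing S
  have : Module.Finite K (K ⊗[R] S) := Algebra.FormallyUnramified.finite_of_free K _
  have hinj := Algebra.TensorProduct.includeRight_injective (R := R) (A := K) (B := S)
    (IsFractionRing.injective R K)
  have halg : Algebra.IsAlgebraic R S := by
    refine ⟨fun b => ?_⟩
    have h1 : IsAlgebraic K (Algebra.TensorProduct.includeRight (R := R) (A := K) b) :=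
      Algebra.IsAlgebraic.isAlgebraic _
    have h2 := (IsFractionRing.isAlgebraic_iff R K (K ⊗[R] S)).mpr h1
    exact (isAlgebraic_algHom_iff _ hinj).mp h2
  have : FaithfulSMul R F := FaithfulSMul.trans R S F
  let : Algebra K F := FractionRing.liftAlgebra R F
  let lam : S ⊗[R] K →ₐ[S] F := Algebra.TensorProduct.lift (Algebra.ofId S F)
    (IsScalarTower.toAlgHom R K F) (fun _ _ => Commute.all _ _)
  have hlam : Function.Injective lam := by
    have : IsLocalization (Algebra.algebraMapSubmonoid S (nonZeroDivisors R)) (S ⊗[R] K) :=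
      inferInstance
    rw [injective_iff_map_eq_zero]
    intro z hz
    obtain ⟨⟨s, m⟩, hs⟩ :=
      IsLocalization.surj (Algebra.algebraMapSubmonoid S (nonZeroDivisors R)) z
    have h0 : lam (algebraMap S _ s) = 0 := by rw [← hs, map_mul, hz, zero_mul]
    rw [AlgHom.commutes, map_eq_zero_iff _ (IsFractionRing.injective S F)] at h0
    have hu := IsLocalization.map_units (S ⊗[R] K) m
    rw [h0, map_zero] at hs
    exact hu.mul_left_eq_zero.mp hs
  refine (isIntegrallyClosed_iff F).mpr fun {x} hx => ?_
  obtain ⟨a, b, hb, rfl⟩ := IsFractionRing.div_surjective (A := S) x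
  obtain ⟨r, hr, c, hc⟩ := (halg.isAlgebraic b).exists_nonzero_dvd hb
  -- Since b divides the nonzero element r = b c of R, the fraction a / b equals a c / r and so
  -- comes from S ⊗ K.
  have hl : lam ((a * c) ⊗ₜ (algebraMap R K r)⁻¹) = algebraMap S F a / algebraMap S F b := by
    have hr0 : algebraMap R F r ≠ 0 := by
      rwa [Ne, map_eq_zero_iff _ (FaithfulSMul.algebraMap_injective R F)]
    have hb0 : algebraMap S F b ≠ 0 :=
      (map_ne_zero_iff _ (IsFractionRing.injective S F)).mpr (nonZeroDivisors.ne_zero hb)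
    have hbc : algebraMap R F r = algebraMap S F b * algebraMap S F c := by
      rw [IsScalarTower.algebraMap_apply R S F, hc, map_mul]
    have h1 : lam ((a * c) ⊗ₜ (algebraMap R K r)⁻¹) =
        algebraMap S F (a * c) * algebraMap K F (algebraMap R K r)⁻¹ :=
      Algebra.TensorProduct.lift_tmul _ _ _ _ _
    rw [h1, map_inv₀, ← IsScalarTower.algebraMap_apply R K F, map_mul, eq_div_iff hb0]
    calc _ = algebraMap S F a * ((algebraMap S F b * algebraMap S F c) *
          (algebraMap R F r)⁻¹) := by ring
      _ = _ := by rw [← hbc, mul_inv_cancel₀ hr0, mul_one]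
  have hint : IsIntegral S ((a * c) ⊗ₜ[R] (algebraMap R K r)⁻¹) :=
    (isIntegral_algHom_iff lam hlam).mp (hl ▸ hx)
  obtain ⟨y, hy⟩ := (TensorProduct.toIntegralClosure_bijective_of_smooth (R := R) (S := S)
    (B := K)).2 ⟨_, hint⟩
  have hR : ∀ z : S ⊗[R] integralClosure R K, ∃ s : S, TensorProduct.toIntegralClosure R S K z =
    algebraMap S _ s := by
    intro z
    induction z with
    | zero => exact ⟨0, by simp⟩
    | add x y hx hy =>
      obtain ⟨s, hs⟩ := hx
      obtain ⟨t, ht⟩ := hy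
      exact ⟨s + t, by rw [map_add, hs, ht, map_add]⟩
    | tmul s k =>
      obtain ⟨r, hr⟩ := IsIntegrallyClosed.isIntegral_iff.mp k.2
      refine ⟨s * algebraMap R S r, Subtype.ext ?_⟩
      change s ⊗ₜ[R] (k : K) = (s * algebraMap R S r) ⊗ₜ[R] (1 : K)
      rw [← hr, mul_comm, ← Algebra.smul_def, TensorProduct.smul_tmul, Algebra.smul_def, mul_one]
  obtain ⟨s, hs⟩ := hR y
  refine ⟨s, ?_⟩
  rw [← hl, ← AlgHom.commutes lam]
  congr 1
  rw [hs] at hy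
  exact congrArg Subtype.val hy

end Normal

/-! ### Coordinates adapted to a smooth center -/

section AdaptedCoordinates
open scoped TensorProduct
open IsLocalRing

variable {k A : Type} [Field k] [CommRing A] [Algebra k A] [IsLocalRing A]

/-- Formal smoothness of A/J splits the conormal map J/J² → A/J ⊗ Ω, so J/𝔪J injects into Ω/𝔪Ω. This
is that injectivity for explicit sums. -/
theorem sum_mul_mem_of_sum_smul_D_mem [Algebra.FormallySmooth k A] (J : Ideal A)
    (hJ : J ≤ maximalIdeal A) [Algebra.FormallySmooth k (A ⧸ J)] {ι : Type*} (s : Finset ι)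
    (a x : ι → A) (hx : ∀ i ∈ s, x i ∈ J)
    (h : ∑ i ∈ s, a i • KaehlerDifferential.D k A (x i) ∈
      maximalIdeal A • (⊤ : Submodule A Ω[A⁄k])) :
    ∑ i ∈ s, a i * x i ∈ maximalIdeal A * J := by
  obtain ⟨l, hl⟩ := (Algebra.FormallySmooth.iff_split_injection (R := k) (P := A) (A := A ⧸ J)
    Ideal.Quotient.mk_surjective).mp inferInstance
  have hker : RingHom.ker (algebraMap A (A ⧸ J)) = J := Ideal.mk_ker
  let lam : Ω[A⁄k] →ₗ[A] (RingHom.ker (algebraMap A (A ⧸ J))).Cotangent :=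
    l ∘ₗ (TensorProduct.mk A (A ⧸ J) Ω[A⁄k] 1)
  have hlam (y) : lam (KaehlerDifferential.D k A y.1) =
      (RingHom.ker (algebraMap A (A ⧸ J))).toCotangent y := by
    have := LinearMap.congr_fun hl ((RingHom.ker (algebraMap A (A ⧸ J))).toCotangent y)
    exact this
  have hx' : ∀ i ∈ s, x i ∈ RingHom.ker (algebraMap A (A ⧸ J)) := fun i hi => hker.symm ▸ hx i hi
  have h1 : lam (∑ i ∈ s, a i • KaehlerDifferential.D k A (x i)) =
      (RingHom.ker (algebraMap A (A ⧸ J))).toCotangent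
        ⟨∑ i ∈ s, a i * x i, sum_mem fun i hi => Ideal.mul_mem_left _ _ (hx' i hi)⟩ := by
    rw [map_sum]
    have : (⟨∑ i ∈ s, a i * x i, sum_mem fun i hi => Ideal.mul_mem_left _ _ (hx' i hi)⟩ :
      RingHom.ker (algebraMap A (A ⧸ J))) = ∑ i ∈ s.attach, a i • ⟨x i, hx' i i.2⟩ := by
      ext
      simp [Finset.sum_attach s (fun i => a i * x i)]
    rw [this, map_sum, ← Finset.sum_attach]
    exact Finset.sum_congr rfl fun i _ => by rw [map_smul, map_smul, ← hlam ⟨x i, hx' i i.2⟩]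
  have h2 : lam (∑ i ∈ s, a i • KaehlerDifferential.D k A (x i)) ∈
      maximalIdeal A • (⊤ : Submodule A (RingHom.ker (algebraMap A (A ⧸ J))).Cotangent) := by
    have := Submodule.mem_map_of_mem (f := lam) h
    rw [Submodule.map_smul''] at this
    exact Submodule.smul_mono le_rfl le_top this
  rw [h1, ← LinearMap.range_eq_top.mpr (Ideal.toCotangent_surjective _), ← Submodule.map_top,
    ← Submodule.map_smul''] at h2
  obtain ⟨⟨y, hy⟩, hy', hyx⟩ := h2
  rw [Ideal.toCotangent_eq] at hyx
  have h3 : y ∈ maximalIdeal A * J := by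
    have := Submodule.mem_map_of_mem (f := Submodule.subtype _) hy'
    rw [Submodule.map_smul'', Submodule.map_top, Submodule.range_subtype] at this
    change y ∈ maximalIdeal A * _ at this
    rwa [hker] at this
  have h4 : y - ∑ i ∈ s, a i * x i ∈ maximalIdeal A * J := by
    change y - ∑ i ∈ s, a i * x i ∈ _ at hyx
    rw [hker, pow_two] at hyx
    exact Ideal.mul_mono_left hJ hyx
  simpa using sub_mem h3 h4

/-- Elements of I whose differentials form a basis of the span of dI in κ ⊗ Ω generate I, and can be
extended to a basis of κ ⊗ Ω consisting of differentials. The last alternative supplies one more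
vanishing coordinate when I ≠ 𝔪; it is what later forces an exceptional divisor to dominate a
component of the center. -/
theorem exists_adapted_coordinates [IsNoetherianRing A] (n : ℕ) [Algebra.FormallySmooth k A]
    [Module.Free A Ω[A⁄k]] [Module.Finite A Ω[A⁄k]] (hn : Module.finrank A Ω[A⁄k] = n)
    [Algebra.FormallySmooth k (A ⧸ maximalIdeal A)]
    (I : Ideal A) (hI : I ≤ maximalIdeal A) [Algebra.FormallySmooth k (A ⧸ I)] :
    ∃ (v : Fin n → A) (b : Module.Basis (Fin n) A Ω[A⁄k]) (S : Finset (Fin n)),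
      (∀ i, b i = KaehlerDifferential.D k A (v i)) ∧ I = Ideal.span (v '' S) ∧
      (I = maximalIdeal A ∨ ∃ j ∉ S, v j ∈ maximalIdeal A) := by
  classical
  let e : A → ResidueField A ⊗[A] Ω[A⁄k] := fun a => 1 ⊗ₜ KaehlerDifferential.D k A a
  have hlift (T : Set A) (h : A) (hh : e h ∈ Submodule.span (ResidueField A) (e '' T)) :
    ∃ (s : Finset A) (c : A → A), ↑s ⊆ T ∧ KaehlerDifferential.D k A h -
      ∑ i ∈ s, c i • KaehlerDifferential.D k A i ∈ maximalIdeal A • (⊤ : Submodule A Ω[A⁄k]) := by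
    obtain ⟨s, hs, α, hα⟩ := (Submodule.mem_span_image_iff_exists_fun _).mp hh
    choose c hc using fun i => IsLocalRing.residue_surjective (α i)
    refine ⟨s, fun i => if hi : i ∈ s then c ⟨i, hi⟩ else 0, hs, ?_⟩
    rw [← LinearMap.ker_tensorProductMk (R := A) (Q := Ω[A⁄k]) (I := maximalIdeal A),
      LinearMap.mem_ker]
    change (1 : ResidueField A) ⊗ₜ[A] (KaehlerDifferential.D k A h - _) = 0
    rw [TensorProduct.tmul_sub, sub_eq_zero, TensorProduct.tmul_sum, ← Finset.sum_coe_sort]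
    refine hα.symm.trans (Finset.sum_congr rfl fun i _ => ?_)
    rw [TensorProduct.tmul_smul]
    beta_reduce
    rw [dif_pos i.2, ← hc]
    exact algebraMap_smul (ResidueField A) (c i) (e i)
  -- If differentials of T span those of J modulo 𝔪, then J = (T) + 𝔪J by the preceding lemma, and
  -- Nakayama gives J = (T).
  have hgen (J : Ideal A) (hJ : J ≤ maximalIdeal A) (hsm : Algebra.FormallySmooth k (A ⧸ J))
      (T : Set A) (hT : T ⊆ J)
      (hspan : e '' J ⊆ Submodule.span (ResidueField A) (e '' T)) : J = Ideal.span T := by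
    refine le_antisymm ?_ (Ideal.span_le.mpr hT)
    refine Submodule.le_of_le_smul_of_le_jacobson_bot (I := maximalIdeal A)
      (IsNoetherian.noetherian J) (maximalIdeal_le_jacobson _) ?_
    intro h hh
    obtain ⟨s, c, hs, hc⟩ := hlift T h (hspan ⟨h, hh, rfl⟩)
    -- The index `none` carries h itself with coefficient 1, so the sum is h - ∑ c i * i.
    have h1 := sum_mul_mem_of_sum_smul_D_mem (k := k) J hJ s.insertNone
      (fun o => o.elim 1 fun i => - c i) (fun o => o.elim h id)
      (by
        rintro (_ | i) hi
        · exact hh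
        · exact hT (hs (by simpa using hi)))
      (by simpa [Finset.sum_insertNone, ← sub_eq_add_neg] using hc)
    simp only [Finset.sum_insertNone, Option.elim, one_mul, neg_mul, Finset.sum_neg_distrib,
      ← sub_eq_add_neg, id] at h1
    rw [← sub_add_cancel h (∑ i ∈ s, c i * i), add_comm]
    exact Submodule.add_mem_sup (sum_mem fun i hi => Ideal.mul_mem_left _ _
      (Ideal.subset_span (hs hi))) h1
  obtain ⟨T, hTI, -, hTspan, hTind⟩ := exists_linearIndepOn_extension
    (K := ResidueField A) (v := e) (s := ∅) (t := I) (linearIndepOn_empty _ _) (Set.empty_subset _)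
  have hIT := hgen I hI inferInstance T hTI hTspan
  obtain ⟨T', hTT', hT'ind, hT'⟩ : ∃ T' : Set A, T ⊆ T' ∧ LinearIndepOn (ResidueField A) e T' ∧
      (I = maximalIdeal A ∨ ∃ h ∈ T', h ∉ T ∧ h ∈ maximalIdeal A) := by
    by_cases hm : I = maximalIdeal A
    · exact ⟨T, subset_rfl, hTind, Or.inl hm⟩
    -- Otherwise T would generate 𝔪 as well as I.
    · have : ∃ h ∈ maximalIdeal A, e h ∉ Submodule.span (ResidueField A) (e '' T) := by
        by_contra! hc
        apply hm
        rw [hIT, ← hgen (maximalIdeal A) le_rfl inferInstance T (hTI.trans hI)]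
        rintro _ ⟨h, hh, rfl⟩
        exact hc h hh
      obtain ⟨h, hhm, hhs⟩ := this
      have hhT : h ∉ T := fun hc => hhs (Submodule.subset_span ⟨h, hc, rfl⟩)
      exact ⟨insert h T, Set.subset_insert _ _, hTind.insert hhs,
        Or.inr ⟨h, Set.mem_insert _ _, hhT, hhm⟩⟩
  obtain ⟨B, -, hT'B, hBspan, hBind⟩ := exists_linearIndepOn_extension
    (K := ResidueField A) (v := e) (s := T') (t := Set.univ) hT'ind (Set.subset_univ _)
  have htop : ⊤ ≤ Submodule.span (ResidueField A) (Set.range fun x : B => e x) := by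
    have h1 : Set.range (fun x : B => e x) = e '' B := by
      ext; simp
    rw [h1]
    rintro t -
    induction t with
    | zero => exact zero_mem _
    | add x y hx hy => exact add_mem hx hy
    | tmul a ω =>
      rw [← mul_one a, ← smul_eq_mul, ← TensorProduct.smul_tmul']
      refine Submodule.smul_mem _ _ ?_
      have hω : ω ∈ Submodule.span A (Set.range (KaehlerDifferential.D k A)) := by
        rw [KaehlerDifferential.span_range_derivation]; trivial
      induction hω using Submodule.span_induction with
      | zero => rw [TensorProduct.tmul_zero]; exact zero_mem _
      | add x y _ _ hx hy => rw [TensorProduct.tmul_add]; exact add_mem hx hy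
      | mem x hx =>
        obtain ⟨x, rfl⟩ := hx
        exact hBspan ⟨x, trivial, rfl⟩
      | smul a x _ hx =>
        rw [TensorProduct.tmul_smul, ← algebraMap_smul (ResidueField A) a]
        exact Submodule.smul_mem _ _ hx
  let bk : Module.Basis B (ResidueField A) (ResidueField A ⊗[A] Ω[A⁄k]) :=
    Module.Basis.mk hBind htop
  -- A basis of κ ⊗ Ω lifts to Ω: flatness gives independence and Nakayama gives generation.
  let bA : Module.Basis B A Ω[A⁄k] := Module.Basis.mk
    (v := fun x : B => KaehlerDifferential.D k A x) (Module.IsLocalRing.linearIndependent_of_flat _ hBind)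
    (span_eq_top_of_tmul_eq_basis (fun x : B => KaehlerDifferential.D k A x) bk
      (fun i => (Module.Basis.mk_apply hBind htop i).symm)).ge
  have : Finite B := Module.Finite.finite_basis bA
  have hcard : Nat.card B = n := by rw [← hn, Module.finrank_eq_nat_card_basis bA]
  let eq : B ≃ Fin n := Finite.equivFinOfCardEq hcard
  refine ⟨fun i => eq.symm i, bA.reindex eq, Finset.univ.filter fun i => (eq.symm i : A) ∈ T,
    fun i => by simp [bA], ?_, ?_⟩
  · rw [hIT]
    congr 1
    ext x
    simp only [Finset.coe_filter, Finset.mem_univ, true_and, Set.mem_image, Set.mem_ofPred_eq]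
    exact ⟨fun hx => ⟨eq ⟨x, hT'B (hTT' hx)⟩, by simpa using hx, by simp⟩,
      by rintro ⟨i, hi, rfl⟩; exact hi⟩
  · refine hT'.imp id ?_
    rintro ⟨h, hh, hhT, hhm⟩
    exact ⟨eq ⟨h, hT'B hh⟩, by simpa using hhT, by simpa using hhm⟩

end AdaptedCoordinates

/-! ### Jacobians and coordinate systems in a function field -/

section Jacobian

open scoped Matrix

variable {K : Type} [Field K] {M N : Type*} [AddCommGroup M] [Module K M] [AddCommGroup N]
  [Module K N] {n : ℕ}

theorem alternatingMap_eq_det_smul (e : Module.Basis (Fin n) K M) (f : M [⋀^Fin n]→ₗ[K] N)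
    (w : Fin n → M) : f w = e.det w • f e := by
  have : f = (LinearMap.toSpanSingleton K N (f e)).compAlternatingMap e.det := by
    refine Module.Basis.ext_alternating e fun i hi => ?_
    let σ : Equiv.Perm (Fin n) := Equiv.ofBijective i (Finite.injective_iff_bijective.1 hi)
    change f (e ∘ σ) = e.det (e ∘ σ) • f e
    rw [AlternatingMap.map_perm, AlternatingMap.map_perm, e.det_self, smul_assoc, one_smul]
  conv_lhs => rw [this]
  rfl

theorem ιMulti_basis_ne_zero (e : Module.Basis (Fin n) K M) :
    exteriorPower.ιMulti K n e ≠ 0 := by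
  intro h
  have := exteriorPower.alternatingMapLinearEquiv_apply_ιMulti e.det e
  rw [h, map_zero, e.det_self] at this
  exact zero_ne_one this

variable {k : Type} [Field k] [Algebra k K]

/-- The differentials of the functions `v i` form a basis of `Ω_{K/k}`. -/
def IsDiffBasis (k : Type) [Field k] [Algebra k K] (v : Fin n → K) : Prop :=
  ∃ e : Module.Basis (Fin n) K Ω[K⁄k], ∀ i, e i = KaehlerDifferential.D k K (v i)

/-- The top form `db₁ ∧ ⋯ ∧ dbₙ` equals `g dv₁ ∧ ⋯ ∧ dvₙ`. -/
def IsJacobian (k : Type) [Field k] [Algebra k K] (b v : Fin n → K) (g : K) : Prop :=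
  exteriorPower.ιMulti K n (fun i => KaehlerDifferential.D k K (b i)) =
    g • exteriorPower.ιMulti K n (fun i => KaehlerDifferential.D k K (v i))

/-- `v` is a system of coordinates for the subring `R` of `K`: the functions `v i` belong to `R`,
their differentials form a basis of `Ω_{K/k}` and span the differentials of `R` over `R`. -/
def IsCoordinates (k : Type) [Field k] [Algebra k K] (R : Subring K) (v : Fin n → K) : Prop :=
  (∀ i, v i ∈ R) ∧ IsDiffBasis k v ∧ ∀ a ∈ R, ∃ c : Fin n → K, (∀ i, c i ∈ R) ∧
    KaehlerDifferential.D k K a = ∑ i, c i • KaehlerDifferential.D k K (v i)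

theorem IsDiffBasis.ιMulti_ne_zero {v : Fin n → K} (hv : IsDiffBasis k v) :
    exteriorPower.ιMulti K n (fun i => KaehlerDifferential.D k K (v i)) ≠ 0 := by
  obtain ⟨e, he⟩ := hv
  simp only [← he]
  exact ιMulti_basis_ne_zero e

theorem IsDiffBasis.exists_smul_eq {v : Fin n → K} (hv : IsDiffBasis k v)
    (ω : ⋀[K]^n Ω[K⁄k]) :
    ∃ g : K, ω = g • exteriorPower.ιMulti K n (fun i => KaehlerDifferential.D k K (v i)) := by
  obtain ⟨e, he⟩ := hv
  have hω : ω ∈ Submodule.span K (Set.range (exteriorPower.ιMulti K n (M := Ω[K⁄k]))) := by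
    rw [exteriorPower.ιMulti_span]; trivial
  simp only [← he]
  induction hω using Submodule.span_induction with
  | zero => exact ⟨0, by simp⟩
  | add x y _ _ hx hy =>
    obtain ⟨a, rfl⟩ := hx
    obtain ⟨b, rfl⟩ := hy
    exact ⟨a + b, by rw [add_smul]⟩
  | mem x hx =>
    obtain ⟨w, rfl⟩ := hx
    exact ⟨_, alternatingMap_eq_det_smul e _ w⟩
  | smul a x _ hx =>
    obtain ⟨b, rfl⟩ := hx
    exact ⟨a * b, by rw [mul_smul]⟩

theorem IsDiffBasis.exists_isJacobian {v : Fin n → K} (hv : IsDiffBasis k v) (b : Fin n → K) :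
    ∃ g : K, IsJacobian k b v g :=
  hv.exists_smul_eq _

theorem IsJacobian.trans {b v w : Fin n → K} {g h : K} (h₁ : IsJacobian k b v g)
    (h₂ : IsJacobian k v w h) : IsJacobian k b w (g * h) := by
  unfold IsJacobian at *
  rw [h₁, h₂, mul_smul]

theorem IsJacobian.unique {b v : Fin n → K} {g h : K} (hv : IsDiffBasis k v)
    (h₁ : IsJacobian k b v g) (h₂ : IsJacobian k b v h) : g = h :=
  smul_left_injective K hv.ιMulti_ne_zero (h₁.symm.trans h₂)

theorem IsJacobian.ne_zero {b v : Fin n → K} {g : K} (hb : IsDiffBasis k b)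
    (h : IsJacobian k b v g) : g ≠ 0 := by
  rintro rfl
  exact hb.ιMulti_ne_zero (by rw [h, zero_smul])

theorem isJacobian_refl (v : Fin n → K) : IsJacobian k v v 1 := (one_smul _ _).symm

theorem isJacobian_det {b v : Fin n → K} (hv : IsDiffBasis k v) (m : Matrix (Fin n) (Fin n) K)
    (hm : ∀ i, KaehlerDifferential.D k K (b i) = ∑ j, m i j • KaehlerDifferential.D k K (v j)) :
    IsJacobian k b v m.det := by
  obtain ⟨e, he⟩ := hv
  unfold IsJacobian
  simp only [← he] at hm ⊢
  rw [alternatingMap_eq_det_smul e]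
  congr 1
  rw [Module.Basis.det_apply, ← Matrix.det_transpose]
  congr 1
  ext i j
  rw [Matrix.transpose_apply, Module.Basis.toMatrix_apply, hm, map_sum, Finsupp.finsetSum_apply]
  simp [Finsupp.single_apply]

theorem IsDiffBasis.exists_matrix {v : Fin n → K} (hv : IsDiffBasis k v) (b : Fin n → K) :
    ∃ m : Matrix (Fin n) (Fin n) K,
      ∀ i, KaehlerDifferential.D k K (b i) = ∑ j, m i j • KaehlerDifferential.D k K (v j) := by
  obtain ⟨e, he⟩ := hv
  simp only [← he]
  exact ⟨fun i j => e.repr (KaehlerDifferential.D k K (b i)) j, fun i => (e.sum_repr _).symm⟩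

theorem IsCoordinates.isJacobian_mem {R : Subring K} {v w : Fin n → K} {u : K}
    (hw : IsCoordinates k R w) (hv : ∀ i, v i ∈ R) (h : IsJacobian k v w u) : u ∈ R := by
  choose c hc hcv using fun i => hw.2.2 (v i) (hv i)
  rw [h.unique hw.2.1 (isJacobian_det hw.2.1 c hcv)]
  have : Matrix.det (R := K) c = (Matrix.det (Matrix.of fun i j => (⟨c i j, hc i j⟩ : R)) : R) := by
    rw [← Subring.subtype_apply, RingHom.map_det]
    rfl
  rw [this]
  exact Subtype.prop _

/-- The inverse is the Jacobian of the opposite change of coordinates, so Jacobians between two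
systems of coordinates of R are units. -/
theorem IsCoordinates.isJacobian_inv_mem {R : Subring K} {v w : Fin n → K} {u : K}
    (hw : IsCoordinates k R w) (hv : IsCoordinates k R v) (h : IsJacobian k v w u) :
    u⁻¹ ∈ R := by
  obtain ⟨g, hg⟩ := hv.2.1.exists_isJacobian w
  have : u * g = 1 := (h.trans hg).unique hv.2.1 (isJacobian_refl v)
  rw [inv_eq_of_mul_eq_one_right this]
  exact hv.isJacobian_mem hw.1 hg

section Transport

theorem D_algebraMap_eq_sum {A L : Type} [CommRing A] [Algebra k A] [Field L] [Algebra k L]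
    [Algebra A L] [IsScalarTower k A L] {v : Fin n → A} {x : A} {c : Fin n → A}
    (h : KaehlerDifferential.D k A x = ∑ j, c j • KaehlerDifferential.D k A (v j)) :
    KaehlerDifferential.D k L (algebraMap A L x) =
      ∑ j, algebraMap A L (c j) • KaehlerDifferential.D k L (algebraMap A L (v j)) := by
  simpa [KaehlerDifferential.map_D] using congrArg (KaehlerDifferential.map k k A L) h

theorem isDiffBasis_of_formallyEtale {A L : Type} [CommRing A] [Algebra k A] [Field L]
    [Algebra k L] [Algebra A L] [IsScalarTower k A L] [Algebra.FormallyEtale A L] {v : Fin n → A}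
    (e : Module.Basis (Fin n) A Ω[A⁄k]) (he : ∀ i, e i = KaehlerDifferential.D k A (v i)) :
    IsDiffBasis k (fun i => algebraMap A L (v i)) := by
  refine ⟨(e.baseChange L).map (KaehlerDifferential.tensorKaehlerEquivOfFormallyEtale k A L),
    fun i => ?_⟩
  rw [Module.Basis.map_apply, Module.Basis.baseChange_apply, he,
    ← KaehlerDifferential.tensorKaehlerEquivOfFormallyEtale_symm_D_algebraMap,
    LinearEquiv.apply_symm_apply]

variable {L : Type} [Field L] [Algebra k L] [Algebra K L] [IsScalarTower k K L]

theorem IsDiffBasis.map (hs : Function.Surjective (algebraMap K L)) {v : Fin n → K}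
    (hv : IsDiffBasis k v) :
    IsDiffBasis k (fun i => algebraMap K L (v i)) := by
  have : Algebra.FormallyEtale K L := .of_equiv
    (AlgEquiv.ofBijective (Algebra.ofId K L) ⟨(algebraMap K L).injective, hs⟩)
  obtain ⟨e, he⟩ := hv
  exact isDiffBasis_of_formallyEtale e he

theorem IsJacobian.map (hs : Function.Surjective (algebraMap K L)) {b v : Fin n → K} {g : K}
    (hv : IsDiffBasis k v) (h : IsJacobian k b v g) :
    IsJacobian k (fun i => algebraMap K L (b i)) (fun i => algebraMap K L (v i))
      (algebraMap K L g) := by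
  obtain ⟨m, hm⟩ := hv.exists_matrix b
  rw [h.unique hv (isJacobian_det hv m hm), RingHom.map_det]
  exact isJacobian_det (hv.map hs) _ fun i => D_algebraMap_eq_sum (hm i)

end Transport

/-- Quotient rule: a s = p gives da = s⁻¹ (dp - a ds). -/
theorem IsCoordinates.of_localization {R R' : Subring K} {v : Fin n → K}
    (hv : IsCoordinates k R v) (hR : R ≤ R')
    (h : ∀ a ∈ R', ∃ p ∈ R, ∃ s ∈ R, s⁻¹ ∈ R' ∧ s ≠ 0 ∧ a * s = p) : IsCoordinates k R' v := by
  refine ⟨fun i => hR (hv.1 i), hv.2.1, fun a ha => ?_⟩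
  obtain ⟨_, hp, s, hs, hs', hs0, rfl⟩ := h a ha
  obtain ⟨c, hc, hcp⟩ := hv.2.2 _ hp
  obtain ⟨d, hd, hds⟩ := hv.2.2 s hs
  refine ⟨fun i => s⁻¹ * (c i - a * d i), fun i => mul_mem hs' (sub_mem (hR (hc i))
    (mul_mem ha (hR (hd i)))), ?_⟩
  rw [Derivation.leibniz, hds] at hcp
  simp only [mul_smul, sub_smul, ← Finset.smul_sum, Finset.sum_sub_distrib]
  rw [← hcp, add_sub_cancel_left, inv_smul_smul₀ hs0]

/-- The fraction field is formally étale over A, so a basis of Ω over A remains one over K. -/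
theorem isCoordinates_of_basis {A : Type} [CommRing A] [Algebra k A] [Algebra A K]
    [IsFractionRing A K] [IsScalarTower k A K] (v : Fin n → A)
    (e : Module.Basis (Fin n) A Ω[A⁄k]) (he : ∀ i, e i = KaehlerDifferential.D k A (v i)) :
    IsCoordinates k (algebraMap A K).range (fun i => algebraMap A K (v i)) := by
  have : Algebra.FormallyEtale A K := Algebra.FormallyEtale.of_isLocalization (nonZeroDivisors A)
  refine ⟨fun i => ⟨v i, rfl⟩, isDiffBasis_of_formallyEtale e he, ?_⟩
  rintro _ ⟨a, rfl⟩
  refine ⟨fun i => algebraMap A K (e.repr (KaehlerDifferential.D k A a) i), fun i => ⟨_, rfl⟩,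
    D_algebraMap_eq_sum ?_⟩
  simp only [← he, e.sum_repr]

theorem IsCoordinates.map {L : Type} [Field L] [Algebra k L] [Algebra K L] [IsScalarTower k K L]
    (hs : Function.Surjective (algebraMap K L)) {R : Subring K} {v : Fin n → K}
    (hv : IsCoordinates k R v) :
    IsCoordinates k (R.map (algebraMap K L)) (fun i => algebraMap K L (v i)) := by
  refine ⟨fun i => ⟨_, hv.1 i, rfl⟩, hv.2.1.map hs, ?_⟩
  rintro _ ⟨a, ha, rfl⟩
  obtain ⟨c, hc, hcv⟩ := hv.2.2 a ha
  exact ⟨fun i => algebraMap K L (c i), fun i => ⟨_, hc i, rfl⟩, D_algebraMap_eq_sum hcv⟩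

/-- The coordinates `v i / v i₀`, `i ∈ S`, on the blow-up of the ideal `(v i)_{i ∈ S}`. -/
def blowUpCoordinates (v : Fin n → K) (S : Finset (Fin n)) (i₀ : Fin n) (i : Fin n) : K :=
  if i ∈ S ∧ i ≠ i₀ then v i / v i₀ else v i

theorem D_eq_blowUpCoordinates (v : Fin n → K) (S : Finset (Fin n)) (i₀ : Fin n) (h0 : v i₀ ≠ 0)
    (i : Fin n) : KaehlerDifferential.D k K (v i) =
      (if i ∈ S ∧ i ≠ i₀ then v i₀ else 1) •
        KaehlerDifferential.D k K (blowUpCoordinates v S i₀ i) +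
      (if i ∈ S ∧ i ≠ i₀ then v i / v i₀ else 0) •
        KaehlerDifferential.D k K (blowUpCoordinates v S i₀ i₀) := by
  have h1 : blowUpCoordinates v S i₀ i₀ = v i₀ := by simp [blowUpCoordinates]
  rw [h1]
  unfold blowUpCoordinates
  split_ifs with h
  · conv_lhs => rw [← div_mul_cancel₀ (v i) h0]
    rw [Derivation.leibniz, add_comm]
  · simp

/-- For i ∈ S other than i₀, with w the new coordinates, dv i = v i₀ dw i + w i dw i₀. Subtracting
multiples of row i₀ leaves a diagonal matrix with |S| - 1 entries v i₀ and the rest 1. This is the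
local form of K_X = f^*K_Y + (c-1)E. -/
theorem isJacobian_blowUpCoordinates {v : Fin n → K} {S : Finset (Fin n)} {i₀ : Fin n}
    (hi₀ : i₀ ∈ S) (h0 : v i₀ ≠ 0) (hv : IsDiffBasis k v) :
    IsDiffBasis k (blowUpCoordinates v S i₀) ∧
      IsJacobian k v (blowUpCoordinates v S i₀) (v i₀ ^ (S.card - 1)) := by
  set w := blowUpCoordinates v S i₀ with hw
  have hb : IsDiffBasis k w := by
    obtain ⟨e, he⟩ := hv
    have hspan : ⊤ ≤ Submodule.span K (Set.range fun i => KaehlerDifferential.D k K (w i)) := by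
      rw [← e.span_eq, Submodule.span_le]
      rintro _ ⟨i, rfl⟩
      rw [he, D_eq_blowUpCoordinates v S i₀ h0 i]
      exact add_mem (Submodule.smul_mem _ _ (Submodule.subset_span ⟨i, rfl⟩))
        (Submodule.smul_mem _ _ (Submodule.subset_span ⟨i₀, rfl⟩))
    exact ⟨basisOfTopLeSpanOfCardEqFinrank _ hspan
      (by rw [Module.finrank_eq_card_basis e]), fun i => by simp⟩
  refine ⟨hb, ?_⟩
  have h1 := isJacobian_det (b := v) hb (fun i j => (Matrix.diagonal fun i =>
    if i ∈ S ∧ i ≠ i₀ then v i₀ else 1) i j + (if i ∈ S ∧ i ≠ i₀ then v i / v i₀ else 0) *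
      (Matrix.diagonal fun i => if i ∈ S ∧ i ≠ i₀ then v i₀ else 1) i₀ j) (fun i => by
    rw [D_eq_blowUpCoordinates v S i₀ h0 i]
    simp only [add_smul, Finset.sum_add_distrib, Matrix.diagonal_apply, ite_smul, zero_smul,
      Finset.sum_ite_eq, Finset.mem_univ, if_true, mul_ite, mul_zero]
    simp [hw])
  rw [Matrix.det_eq_of_forall_row_eq_smul_add_const
    (fun i => if i ∈ S ∧ i ≠ i₀ then v i / v i₀ else 0) i₀ (by simp) (fun i j => rfl),
    Matrix.det_diagonal, Finset.prod_ite, Finset.prod_const_one, mul_one, Finset.prod_const] at h1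
  convert h1 using 3
  rw [← Finset.card_erase_of_mem hi₀]
  congr 1
  ext i
  simp [and_comm]

theorem D_mem_span_iff {R : Subring K} {w : Fin n → K} {a : K} :
    KaehlerDifferential.D k K a ∈
      Submodule.span R (Set.range fun i => KaehlerDifferential.D k K (w i)) ↔
    ∃ c : Fin n → K, (∀ i, c i ∈ R) ∧
      KaehlerDifferential.D k K a = ∑ i, c i • KaehlerDifferential.D k K (w i) := by
  rw [Submodule.mem_span_range_iff_exists_fun]
  constructor
  · rintro ⟨c, hc⟩
    exact ⟨fun i => c i, fun i => (c i).2, hc.symm⟩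
  · rintro ⟨c, hc, h⟩
    exact ⟨fun i => ⟨c i, hc i⟩, h.symm⟩

/-- The elements of R' whose differentials lie in the R'-span of the dw i form a subring containing
R and the quotients v i / v i₀; the quotient rule extends this to the fractions that make up R'. -/
theorem isCoordinates_blowUpCoordinates {R R' : Subring K} {v : Fin n → K} {S : Finset (Fin n)}
    {i₀ : Fin n} (hi₀ : i₀ ∈ S) (h0 : v i₀ ≠ 0) (hv : IsCoordinates k R v) (hR : R ≤ R')
    (hS : ∀ i ∈ S, v i / v i₀ ∈ R')
    (h : ∀ a ∈ R', ∃ p ∈ Subring.closure (R ∪ {x | ∃ i ∈ S, x = v i / v i₀}),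
      ∃ s ∈ Subring.closure (R ∪ {x | ∃ i ∈ S, x = v i / v i₀}), s⁻¹ ∈ R' ∧ s ≠ 0 ∧ a * s = p) :
    IsCoordinates k R' (blowUpCoordinates v S i₀) := by
  have hb := (isJacobian_blowUpCoordinates hi₀ h0 hv.2.1).1
  set w := blowUpCoordinates v S i₀ with hw
  have hw' (i : Fin n) : w i ∈ R' := by
    rw [hw]
    unfold blowUpCoordinates
    split_ifs with hi
    · exact hS i hi.1
    · exact hR (hv.1 i)
  let Ω' := Submodule.span R' (Set.range fun i => KaehlerDifferential.D k K (w i))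
  have hsmul {a : K} (ha : a ∈ R') {x} (hx : x ∈ Ω') : a • x ∈ Ω' := Ω'.smul_mem ⟨a, ha⟩ hx
  let T : Subring K :=
    { carrier := {a | a ∈ R' ∧ KaehlerDifferential.D k K a ∈ Ω'}
      mul_mem' := fun ha hb => ⟨mul_mem ha.1 hb.1, by
        rw [Derivation.leibniz]
        exact add_mem (hsmul ha.1 hb.2) (hsmul hb.1 ha.2)⟩
      one_mem' := ⟨one_mem _, by simp⟩
      add_mem' := fun ha hb => ⟨add_mem ha.1 hb.1, by rw [map_add]; exact add_mem ha.2 hb.2⟩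
      zero_mem' := ⟨zero_mem _, by simp⟩
      neg_mem' := fun ha => ⟨neg_mem ha.1, by rw [map_neg]; exact neg_mem ha.2⟩ }
  have hDw (i : Fin n) : KaehlerDifferential.D k K (w i) ∈ Ω' := Submodule.subset_span ⟨i, rfl⟩
  have hDv (i : Fin n) : KaehlerDifferential.D k K (v i) ∈ Ω' := by
    rw [D_eq_blowUpCoordinates v S i₀ h0 i]
    refine add_mem (hsmul ?_ (hDw i)) (hsmul ?_ (hDw i₀)) <;> split_ifs with hi
    exacts [hR (hv.1 _), one_mem _, hS i hi.1, zero_mem _]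
  have hT : Subring.closure (R ∪ {x | ∃ i ∈ S, x = v i / v i₀}) ≤ T := by
    rw [Subring.closure_le]
    rintro x (hx | ⟨i, hi, rfl⟩)
    · refine ⟨hR hx, ?_⟩
      obtain ⟨c, hc, hcv⟩ := hv.2.2 x hx
      rw [hcv]
      exact sum_mem fun i _ => hsmul (hR (hc i)) (hDv i)
    · refine ⟨hS i hi, ?_⟩
      by_cases hi' : i = i₀
      · rw [hi', div_self h0, Derivation.map_one_eq_zero]
        exact zero_mem _
      · have : w i = v i / v i₀ := if_pos ⟨hi, hi'⟩
        rw [← this]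
        exact hDw i
  refine ⟨hw', hb, fun a ha => D_mem_span_iff.mp ?_⟩
  obtain ⟨_, hp, s, hs, hs', hs0, rfl⟩ := h a ha
  have h1 := (hT hp).2
  rw [Derivation.leibniz] at h1
  have h2 := sub_mem h1 (hsmul ha (hT hs).2)
  rw [add_sub_cancel_left] at h2
  simpa [inv_smul_smul₀ hs0] using hsmul hs' h2

end Jacobian

/-! ### Local rings of a smooth variety -/

section
variable (n : ℕ) (k S A : Type) [Field k] [CharZero k] [CommRing S] [IsDomain S] [CommRing A] [IsLocalRing A]
  [Algebra k S] [Algebra S A] [Algebra k A] [IsScalarTower k S A]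
  [Algebra.IsStandardSmoothOfRelativeDimension n k S] (P : Ideal S) [P.IsPrime] [IsLocalization.AtPrime A P]
include n k S P
set_option linter.unusedSectionVars false

theorem formallySmooth_of_isLocalization_atPrime : Algebra.FormallySmooth k A := by
  have := Algebra.FormallySmooth.of_isLocalization (Rₘ := A) P.primeCompl
  have := Algebra.IsStandardSmoothOfRelativeDimension.isStandardSmooth (R := k) (S := S) n
  exact Algebra.FormallySmooth.comp k S A

theorem isIntegrallyClosed_of_isLocalization_atPrime : IsIntegrallyClosed A := by
  have := isIntegrallyClosed_of_isStandardSmooth n (k := k) (S := S)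
  exact isIntegrallyClosed_of_isLocalization A P.primeCompl (Ideal.primeCompl_le_nonZeroDivisors P)

theorem essFiniteType_of_isLocalization_atPrime : Algebra.EssFiniteType k A := by
  have := Algebra.IsStandardSmoothOfRelativeDimension.isStandardSmooth (R := k) (S := S) n
  have := Algebra.EssFiniteType.of_isLocalization A P.primeCompl
  exact Algebra.EssFiniteType.comp k S A

theorem kaehler_of_isLocalization_atPrime : Module.Free A Ω[A⁄k] ∧ Module.Finite A Ω[A⁄k] ∧ Module.finrank A Ω[A⁄k] = n := by
  have := Algebra.IsStandardSmoothOfRelativeDimension.isStandardSmooth (R := k) (S := S) n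
  have hfr : Module.Free S Ω[S⁄k] := Algebra.IsStandardSmooth.free_kaehlerDifferential
  have hfi : Module.Finite S Ω[S⁄k] := inferInstance
  have hr : Module.finrank S Ω[S⁄k] = n := by
    have := Algebra.IsStandardSmoothOfRelativeDimension.rank_kaehlerDifferential (R := k) (S := S) n
    exact Module.finrank_eq_of_rank_eq this
  have := Algebra.FormallyEtale.of_isLocalization (Rₘ := A) P.primeCompl
  let e := KaehlerDifferential.tensorKaehlerEquivOfFormallyEtale k S A
  refine ⟨Module.Free.of_equiv e, Module.Finite.equiv e, ?_⟩
  rw [← e.finrank_eq, Module.finrank_baseChange, hr]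

end

/-- In characteristic zero every finitely generated field extension is separable. This meets the
hypothesis on A/𝔪 in `exists_adapted_coordinates`. -/
theorem formallySmooth_residueField {k A : Type} [Field k] [CharZero k] [CommRing A] [IsLocalRing A]
   [Algebra k A] [Algebra.EssFiniteType k A] : Algebra.FormallySmooth k (A ⧸ IsLocalRing.maximalIdeal A) := by
  let := Ideal.Quotient.field (IsLocalRing.maximalIdeal A)
  have : Algebra.EssFiniteType A (A ⧸ IsLocalRing.maximalIdeal A) := inferInstance
  have : Algebra.EssFiniteType k (A ⧸ IsLocalRing.maximalIdeal A) := Algebra.EssFiniteType.comp k A _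
  exact Algebra.FormallySmooth.of_perfectField

/-- The local ring at `x` of a scheme over `Spec ℂ` as a `ℂ`-algebra. -/
@[reducible] def stalkAlgebra (X : Scheme.{0}) (s : X ⟶ Spec (.of ℂ)) (x : X) : Algebra ℂ (X.presheaf.stalk x) :=
  ((Scheme.ΓSpecIso (.of ℂ)).inv ≫ s.appTop ≫
    X.presheaf.germ ⊤ x trivial).hom.toAlgebra

section
variable {n : ℕ} (X : SmoothVariety n)

instance (x : X.carrier) : Algebra ℂ (X.carrier.presheaf.stalk x) := stalkAlgebra X.carrier X.str x

instance (x : X.carrier) : IsScalarTower ℂ (X.carrier.presheaf.stalk x) X.carrier.functionField := by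
  refine .of_algebraMap_eq fun c => ?_
  have : Nonempty (⊤ : X.carrier.Opens) := ⟨⟨genericPoint X.carrier, trivial⟩⟩
  exact (X.carrier.algebraMap_germ_eq_germToFunctionField (U := ⊤) (x := x) trivial _).symm

theorem exists_standardSmooth_chart (x : X.carrier) :
    ∃ (V : X.carrier.Opens) (_ : IsAffineOpen V) (_ : x ∈ V),
      ((Scheme.ΓSpecIso (.of ℂ)).inv ≫ X.str.appLE ⊤ V le_top).hom.IsStandardSmoothOfRelativeDimension n := by
  obtain ⟨U, hU, V, hV, hx, e, h⟩ := X.smooth.exists_isStandardSmoothOfRelativeDimension x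
  -- Spec ℂ has a single point, so a nonempty open of the base is everything.
  obtain rfl : U = ⊤ := by
    have : Subsingleton (Spec (.of ℂ)) := inferInstanceAs (Subsingleton (PrimeSpectrum ℂ))
    ext z
    have := e hx
    simpa [Subsingleton.elim z (X.str x)] using this
  refine ⟨V, hV, hx, ?_⟩
  rw [CommRingCat.hom_comp]
  exact (RingHom.isStandardSmoothOfRelativeDimension_respectsIso).2 _ (Scheme.ΓSpecIso (.of ℂ)).symm.commRingCatIsoToRingEquiv h

theorem stalk_properties (x : X.carrier) :
    Algebra.FormallySmooth ℂ (X.carrier.presheaf.stalk x) ∧ IsIntegrallyClosed (X.carrier.presheaf.stalk x) ∧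
    Algebra.EssFiniteType ℂ (X.carrier.presheaf.stalk x) ∧ Module.Free (X.carrier.presheaf.stalk x) Ω[X.carrier.presheaf.stalk x⁄ℂ] ∧
    Module.Finite (X.carrier.presheaf.stalk x) Ω[X.carrier.presheaf.stalk x⁄ℂ] ∧
    Module.finrank (X.carrier.presheaf.stalk x) Ω[X.carrier.presheaf.stalk x⁄ℂ] = n := by
  obtain ⟨V, hV, hx, h⟩ := exists_standardSmooth_chart X x
  algebraize [((Scheme.ΓSpecIso (.of ℂ)).inv ≫ X.str.appLE ⊤ V le_top).hom, (X.carrier.presheaf.germ V x hx).hom]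
  have : Algebra.IsStandardSmoothOfRelativeDimension n ℂ Γ(X.carrier, V) := h
  have : Nonempty V := ⟨⟨x, hx⟩⟩
  have : IsDomain Γ(X.carrier, V) := inferInstance
  have : IsScalarTower ℂ Γ(X.carrier, V) (X.carrier.presheaf.stalk x) := by
    refine .of_algebraMap_eq fun c => ?_
    change _ = (((Scheme.ΓSpecIso (.of ℂ)).inv ≫ X.str.appLE ⊤ V le_top) ≫ (X.carrier.presheaf.germ V x hx)).hom c
    rw [← Scheme.Hom.appLE_map (f := X.str) (U := ⊤) (V := ⊤) le_top (homOfLE le_top).op, Category.assoc, Category.assoc,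
      X.carrier.presheaf.germ_res, show X.str.appLE ⊤ ⊤ le_top = X.str.appTop from X.str.appLE_eq_app]
    rfl
  have : IsLocalization.AtPrime (X.carrier.presheaf.stalk x) (hV.primeIdealOf ⟨x, hx⟩).asIdeal := hV.isLocalization_stalk ⟨x, hx⟩
  have h := kaehler_of_isLocalization_atPrime n ℂ Γ(X.carrier, V) (X.carrier.presheaf.stalk x) (hV.primeIdealOf ⟨x, hx⟩).asIdeal
  exact ⟨formallySmooth_of_isLocalization_atPrime n ℂ Γ(X.carrier, V) (X.carrier.presheaf.stalk x) (hV.primeIdealOf ⟨x, hx⟩).asIdeal,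
    isIntegrallyClosed_of_isLocalization_atPrime n ℂ Γ(X.carrier, V) (X.carrier.presheaf.stalk x) (hV.primeIdealOf ⟨x, hx⟩).asIdeal,
    essFiniteType_of_isLocalization_atPrime n ℂ Γ(X.carrier, V) (X.carrier.presheaf.stalk x) (hV.primeIdealOf ⟨x, hx⟩).asIdeal, h⟩

instance (x : X.carrier) : Algebra.FormallySmooth ℂ (X.carrier.presheaf.stalk x) := (stalk_properties X x).1
instance (x : X.carrier) : IsIntegrallyClosed (X.carrier.presheaf.stalk x) := (stalk_properties X x).2.1
instance (x : X.carrier) : Algebra.EssFiniteType ℂ (X.carrier.presheaf.stalk x) := (stalk_properties X x).2.2.1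
instance (x : X.carrier) : Module.Free (X.carrier.presheaf.stalk x) Ω[X.carrier.presheaf.stalk x⁄ℂ] := (stalk_properties X x).2.2.2.1
instance (x : X.carrier) : Module.Finite (X.carrier.presheaf.stalk x) Ω[X.carrier.presheaf.stalk x⁄ℂ] := (stalk_properties X x).2.2.2.2.1

instance (x : X.carrier) : IsNoetherianRing (X.carrier.presheaf.stalk x) := inferInstance
instance (x : X.carrier) : IsDomain (X.carrier.presheaf.stalk x) := inferInstance
instance (x : X.carrier) : IsFractionRing (X.carrier.presheaf.stalk x) X.carrier.functionField := inferInstance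

end

/-! ### Local rings as subrings of the function field -/
section LocalRing
variable {X : Scheme.{0}} [IsIntegral X]

theorem localRing_mono {w x : X} (h : w ⤳ x) : localRing X x ≤ localRing X w := by
  rintro _ ⟨a, rfl⟩
  refine ⟨X.presheaf.stalkSpecializes h a, ?_⟩
  change (X.presheaf.stalkSpecializes h ≫ X.presheaf.stalkSpecializes _).hom a = _
  rw [X.presheaf.stalkSpecializes_comp]
  rfl

theorem germToFunctionField_mem_localRing {U : X.Opens} [Nonempty U] {x : X} (hx : x ∈ U) (f : Γ(X, U)) :
    X.germToFunctionField U f ∈ localRing X x :=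
  ⟨_, X.algebraMap_germ_eq_germToFunctionField hx f⟩

theorem exists_mul_eq_germToFunctionField {U : X.Opens} (hU : IsAffineOpen U) [Nonempty U] {x : X} (hx : x ∈ U)
    {a : X.functionField} (ha : a ∈ localRing X x) :
    ∃ p s : Γ(X, U), s ∉ (hU.primeIdealOf ⟨x, hx⟩).asIdeal ∧
      a * X.germToFunctionField U s = X.germToFunctionField U p := by
  obtain ⟨b, rfl⟩ := ha
  algebraize [(X.presheaf.germ U x hx).hom]
  have : IsLocalization.AtPrime (X.presheaf.stalk x) (hU.primeIdealOf ⟨x, hx⟩).asIdeal := hU.isLocalization_stalk ⟨x, hx⟩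
  obtain ⟨⟨p, s⟩, h⟩ := IsLocalization.surj (hU.primeIdealOf ⟨x, hx⟩).asIdeal.primeCompl b
  refine ⟨p, s, s.2, ?_⟩
  rw [← X.algebraMap_germ_eq_germToFunctionField hx, ← X.algebraMap_germ_eq_germToFunctionField hx, ← map_mul]
  exact congrArg _ h

theorem inv_germToFunctionField_mem_localRing {U : X.Opens} (hU : IsAffineOpen U) [Nonempty U] {x : X} (hx : x ∈ U)
    {s : Γ(X, U)} (hs : s ∉ (hU.primeIdealOf ⟨x, hx⟩).asIdeal) :
    (X.germToFunctionField U s)⁻¹ ∈ localRing X x := by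
  algebraize [(X.presheaf.germ U x hx).hom]
  have : IsLocalization.AtPrime (X.presheaf.stalk x) (hU.primeIdealOf ⟨x, hx⟩).asIdeal := hU.isLocalization_stalk ⟨x, hx⟩
  have hu : IsUnit (X.presheaf.germ U x hx s) := IsLocalization.map_units (X.presheaf.stalk x)
    (⟨s, hs⟩ : (hU.primeIdealOf ⟨x, hx⟩).asIdeal.primeCompl)
  obtain ⟨u, hu⟩ := hu
  refine ⟨(u⁻¹ : (X.presheaf.stalk x)ˣ).val, ?_⟩
  rw [← X.algebraMap_germ_eq_germToFunctionField hx, ← hu]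
  simp

omit [AlgebraicGeometry.IsIntegral X] in
theorem exists_affineOpen_mem (x : X) : ∃ U : X.Opens, IsAffineOpen U ∧ x ∈ U := by
  obtain ⟨_, ⟨U, hU, rfl⟩, hx, -⟩ := X.isBasis_affineOpens.exists_subset_of_mem_open (Set.mem_univ x) isOpen_univ
  exact ⟨U, hU, hx⟩

/-- The local ring at a generization is a localization of the local ring. -/
theorem exists_mul_eq_of_specializes {w x : X} (h : w ⤳ x) {a : X.functionField} (ha : a ∈ localRing X w) :
    ∃ p ∈ localRing X x, ∃ s ∈ localRing X x, s⁻¹ ∈ localRing X w ∧ s ≠ 0 ∧ a * s = p := by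
  obtain ⟨U, hU, hx⟩ := exists_affineOpen_mem x
  have hw : w ∈ U := h.mem_open U.2 hx
  have : Nonempty U := ⟨⟨x, hx⟩⟩
  obtain ⟨p, s, hs, h⟩ := exists_mul_eq_germToFunctionField hU hw ha
  refine ⟨_, germToFunctionField_mem_localRing hx p, _, germToFunctionField_mem_localRing hx s,
    inv_germToFunctionField_mem_localRing hU hw hs, ?_, h⟩
  intro h0
  rw [map_eq_zero_iff _ (X.germToFunctionField_injective U)] at h0
  exact hs (h0 ▸ zero_mem _)

/-- In an affine chart P contracts to a prime, which is the point w. The last clause expresses that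
the local ring at w is the localization at P; it is the form in which Hartogs' principle on the
stalk is fed. -/
theorem exists_point_of_prime_stalk (x : X) (P : Ideal (X.presheaf.stalk x)) [hP : P.IsPrime] :
    ∃ w : X, w ⤳ x ∧ (coheight w : ℕ∞) = P.height ∧ ∀ h ∈ localRing X w, ∃ d ∉ P, ∃ a,
      algebraMap (X.presheaf.stalk x) X.functionField d * h = algebraMap (X.presheaf.stalk x) X.functionField a := by
  obtain ⟨U, hU, hx⟩ := exists_affineOpen_mem x
  have : Nonempty U := ⟨⟨x, hx⟩⟩
  algebraize [(X.presheaf.germ U x hx).hom]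
  have : IsLocalization.AtPrime (X.presheaf.stalk x) (hU.primeIdealOf ⟨x, hx⟩).asIdeal := hU.isLocalization_stalk ⟨x, hx⟩
  let Q : PrimeSpectrum Γ(X, U) := ⟨P.comap (X.presheaf.germ U x hx).hom, inferInstance⟩
  let w := hU.fromSpec Q
  have hw : w ∈ U := by rw [← SetLike.mem_coe, ← hU.range_fromSpec]; exact ⟨Q, rfl⟩
  have hQ : hU.primeIdealOf ⟨w, hw⟩ = Q := by
    apply hU.isOpenImmersion_fromSpec.base_open.injective
    exact hU.fromSpec_primeIdealOf ⟨w, hw⟩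
  refine ⟨w, ?_, ?_, ?_⟩
  · have h1 : Q ⤳ hU.primeIdealOf ⟨x, hx⟩ := by
      rw [← PrimeSpectrum.le_iff_specializes]
      intro a ha
      by_contra h
      exact hP.ne_top (P.eq_top_of_isUnit_mem (show X.presheaf.germ U x hx a ∈ P from ha)
        (IsLocalization.map_units (X.presheaf.stalk x) (⟨a, h⟩ : (hU.primeIdealOf ⟨x, hx⟩).asIdeal.primeCompl)))
    have := h1.map hU.fromSpec.continuous
    rwa [hU.fromSpec_primeIdealOf] at this
  · have h1 := coheight_eq_of_isOpenImmersion (x := Q) hU.fromSpec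
    have h2 := idealHeight_eq_coheight Γ(X, U) Q
    refine Eq.trans h1 (Eq.trans h2.symm ?_)
    exact IsLocalization.height_under (hU.primeIdealOf ⟨x, hx⟩).asIdeal.primeCompl P
  · intro h hh
    obtain ⟨p, s, hs, he⟩ := exists_mul_eq_germToFunctionField hU hw hh
    rw [hQ] at hs
    refine ⟨X.presheaf.germ U x hx s, hs, X.presheaf.germ U x hx p, ?_⟩
    rw [X.algebraMap_germ_eq_germToFunctionField hx, X.algebraMap_germ_eq_germToFunctionField hx, mul_comm, he]

theorem mem_localRing_of_codim_one [IsLocallyNoetherian X] (x : X) [IsIntegrallyClosed (X.presheaf.stalk x)] (h : X.functionField)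
    (hh : ∀ w : X, coheight w = 1 → w ⤳ x → h ∈ localRing X w) : h ∈ localRing X x := by
  refine mem_range_algebraMap_of_height_one h fun P hP h1 => ?_
  obtain ⟨w, hwx, hw, hloc⟩ := exists_point_of_prime_stalk x P
  exact hloc h (hh w (by rw [hw, h1]) hwx)

end LocalRing

/-! ### Orders of vanishing along prime divisors -/

section Ord
variable {X : Scheme.{0}} [IsIntegral X] [IsLocallyNoetherian X]

theorem isDiscreteValuationRing_stalk {w : X} (hw : coheight w = 1) [IsIntegrallyClosed (X.presheaf.stalk w)] :
    IsDiscreteValuationRing (X.presheaf.stalk w) := by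
  have h1 := ringKrullDim_stalk_eq_coheight w
  rw [hw] at h1
  have hf : ¬ IsField (X.presheaf.stalk w) := by
    intro hf
    rw [ringKrullDim_eq_zero_of_isField hf] at h1
    norm_num at h1
  have := krullDimLE_of_coheight_le hw.le
  have := (IsDiscreteValuationRing.TFAE (X.presheaf.stalk w) hf).out 0 2
  refine this.2 ?_
  have : Ring.DimensionLEOne (X.presheaf.stalk w) :=
    ⟨fun h0 hP => Ring.krullDimLE_one_iff_of_noZeroDivisors.1 ‹_› _ h0 hP⟩
  exact {}

theorem ord_nonneg_of_mem {w : X} {h : X.functionField} (hh : h ∈ localRing X w) : 0 ≤ Scheme.ord h w := by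
  by_cases h0 : h = 0
  · simp [h0]
  by_cases! hw : coheight w ≠ 1
  · simp [hw]
  have := krullDimLE_of_coheight_le hw.le
  rw [Scheme.le_ord_iff hw h0]
  obtain ⟨a, rfl⟩ := hh
  exact Ring.ordFrac_ge_one_of_ne_zero (fun h => h0 (by rw [h, map_zero]))

theorem ord_one (w : X) : Scheme.ord (1 : X.functionField) w = 0 := by
  have := Scheme.ord_mul (x := w) (one_ne_zero (α := X.functionField)) one_ne_zero
  rw [mul_one] at this
  omega

theorem ord_inv (h : X.functionField) (w : X) : Scheme.ord h⁻¹ w = - Scheme.ord h w := by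
  by_cases h0 : h = 0
  · simp [h0]
  have := Scheme.ord_mul (x := w) h0 (inv_ne_zero h0)
  rw [mul_inv_cancel₀ h0, ord_one] at this
  omega

theorem ord_pow {h : X.functionField} (h0 : h ≠ 0) (w : X) (m : ℕ) : Scheme.ord (h ^ m) w = m * Scheme.ord h w := by
  induction m with
  | zero => simp [ord_one]
  | succ m ih => rw [pow_succ, Scheme.ord_mul (pow_ne_zero _ h0) h0, ih]; push_cast; ring

theorem ord_eq_zero_of_mem {w : X} {h : X.functionField} (hh : h ∈ localRing X w) (hh' : h⁻¹ ∈ localRing X w) :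
    Scheme.ord h w = 0 := by
  have h1 := ord_nonneg_of_mem hh
  have h2 := ord_nonneg_of_mem hh'
  rw [ord_inv] at h2
  omega

theorem mem_localRing_iff_ord_nonneg {w : X} (hw : coheight w = 1) [IsIntegrallyClosed (X.presheaf.stalk w)]
    {h : X.functionField} (h0 : h ≠ 0) : h ∈ localRing X w ↔ 0 ≤ Scheme.ord h w := by
  refine ⟨ord_nonneg_of_mem, fun hh => ?_⟩
  have := isDiscreteValuationRing_stalk hw
  have := krullDimLE_of_coheight_le hw.le
  rcases ValuationRing.isInteger_or_isInteger (X.presheaf.stalk w) h with h1 | ⟨a, ha⟩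
  · exact h1
  · have h1 : Scheme.ord h⁻¹ w = 0 := by
      have h1 := ord_nonneg_of_mem (w := w) (h := h⁻¹) ⟨a, ha⟩
      rw [ord_inv] at h1 ⊢
      omega
    rw [Scheme.ord_eq_iff hw (inv_ne_zero h0), ← ha] at h1
    have hu : IsUnit a := (Ring.isUnit_iff_ordFrac_one_of_isDiscreteValuationRing (K := X.functionField)).2 h1
    obtain ⟨u, rfl⟩ := hu
    refine ⟨(u⁻¹ : (X.presheaf.stalk w)ˣ).val, ?_⟩
    rw [map_units_inv, ha, inv_inv]

theorem ord_pos_of_mem_maximalIdeal {w : X} (hw : coheight w = 1) [IsIntegrallyClosed (X.presheaf.stalk w)]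
    {a : X.presheaf.stalk w} (h0 : a ≠ 0) (ha : a ∈ IsLocalRing.maximalIdeal (X.presheaf.stalk w)) :
    1 ≤ Scheme.ord (algebraMap _ X.functionField a) w := by
  by_contra! h
  have h0' : algebraMap _ X.functionField a ≠ 0 := by simpa using h0
  have : (algebraMap _ X.functionField a)⁻¹ ∈ localRing X w := by
    rw [mem_localRing_iff_ord_nonneg hw (inv_ne_zero h0'), ord_inv]; omega
  obtain ⟨b, hb⟩ := this
  refine ha (IsUnit.of_mul_eq_one b ?_)
  apply IsFractionRing.injective (X.presheaf.stalk w) X.functionField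
  rw [map_mul, hb, mul_inv_cancel₀ h0', map_one]

theorem exists_uniformizer {w : X} (hw : coheight w = 1) [IsIntegrallyClosed (X.presheaf.stalk w)] :
    ∃ t : X.presheaf.stalk w, t ∈ IsLocalRing.maximalIdeal (X.presheaf.stalk w) ∧ t ≠ 0 ∧
      Scheme.ord (algebraMap _ X.functionField t) w = 1 := by
  have := isDiscreteValuationRing_stalk hw
  have := krullDimLE_of_coheight_le hw.le
  obtain ⟨t, ht⟩ := IsDiscreteValuationRing.exists_irreducible (X.presheaf.stalk w)
  refine ⟨t, ht.1, ht.ne_zero, ?_⟩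
  rw [Scheme.ord_eq_iff hw (by simpa using ht.ne_zero)]
  exact Ring.ordFrac_irreducible (hϖ := ht)

/-- A rational function without poles along the prime divisors through `x` is regular at `x`. -/
theorem mem_localRing_of_ord_nonneg {x : X} (hX : ∀ x : X, IsIntegrallyClosed (X.presheaf.stalk x)) {h : X.functionField}
    (h0 : h ≠ 0) (hh : ∀ w : X, coheight w = 1 → w ⤳ x → 0 ≤ Scheme.ord h w) : h ∈ localRing X x :=
  mem_localRing_of_codim_one x h fun w hw hwx => (mem_localRing_iff_ord_nonneg hw h0).2 (hh w hw hwx)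

end Ord

/-! ### Regular top forms and canonical divisors -/

section
variable {n : ℕ} (X : SmoothVariety n)

theorem exists_isCoordinates (x : X.carrier) :
    ∃ v : Fin n → X.carrier.functionField, IsCoordinates ℂ (localRing X.carrier x) v := by
  have := formallySmooth_residueField (k := ℂ) (A := X.carrier.presheaf.stalk x)
  obtain ⟨v, b, S, hb, -⟩ := exists_adapted_coordinates n (k := ℂ) (A := X.carrier.presheaf.stalk x) (stalk_properties X x).2.2.2.2.2
    (IsLocalRing.maximalIdeal _) le_rfl
  exact ⟨_, isCoordinates_of_basis (K := X.carrier.functionField) v b hb⟩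

theorem exists_unit_of_span_singleton_eq {K M : Type*} [Field K] [AddCommGroup M] [Module K M] (R : Subring K) {θ ω : M}
    (hθ : θ ≠ 0) (h : Submodule.span R {θ} = Submodule.span R {ω}) :
    ∃ r ∈ R, r⁻¹ ∈ R ∧ r ≠ 0 ∧ ω = r • θ := by
  obtain ⟨r, hr⟩ := Submodule.mem_span_singleton.1 (h ▸ Submodule.mem_span_singleton_self ω)
  obtain ⟨s, hs⟩ := Submodule.mem_span_singleton.1 (h.symm ▸ Submodule.mem_span_singleton_self θ)
  have hsr : (s : K) * r = 1 := by
    apply smul_left_injective _ hθ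
    change ((s : K) * r) • θ = (1 : K) • θ
    rw [mul_smul, one_smul]
    change s • r • θ = θ
    rw [hr, hs]
  exact ⟨r, r.2, by rw [← eq_inv_of_mul_eq_one_left hsr]; exact s.2, right_ne_zero_of_mul_eq_one hsr, hr.symm⟩

theorem regularFormsAt_eq_span {x : X.carrier} {v : Fin n → X.carrier.functionField} (hv : IsCoordinates ℂ (localRing X.carrier x) v) :
    regularFormsAt X.carrier X.str n x = Submodule.span (localRing X.carrier x)
      {exteriorPower.ιMulti X.carrier.functionField n fun i => KaehlerDifferential.D ℂ X.carrier.functionField (v i)} := by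
  apply le_antisymm
  · refine Submodule.span_le.2 ?_
    rintro _ ⟨a, rfl⟩
    obtain ⟨g, hg⟩ := hv.2.1.exists_isJacobian fun i => (a i : X.carrier.functionField)
    rw [SetLike.mem_coe, Submodule.mem_span_singleton]
    exact ⟨⟨g, hv.isJacobian_mem (fun i => (a i).2) hg⟩, hg.symm⟩
  · refine Submodule.span_le.2 ?_
    rintro _ rfl
    exact Submodule.subset_span ⟨fun i => ⟨v i, hv.1 i⟩, rfl⟩

/-- Write ω = k db₁ ∧ ⋯ ∧ dbₙ globally. Two generators of the regular n-forms at z differ by a unit,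
so ω₀ may be replaced by the form of any coordinates at z, and then ω = k j dv₁ ∧ ⋯ ∧ dvₙ. Only j
depends on z. -/
theorem IsCanonicalDivisor.exists_eq_ord_add_ord {K : AlgebraicCycle X.carrier ℤ} (hK : IsCanonicalDivisor n X.str K)
    {b : Fin n → X.carrier.functionField} (hb : IsDiffBasis ℂ b) :
    ∃ k : X.carrier.functionField, k ≠ 0 ∧ ∀ z : X.carrier, coheight z = 1 → ∀ v, IsCoordinates ℂ (localRing X.carrier z) v →
      ∀ j, IsJacobian ℂ b v j → K z = Scheme.ord k z + Scheme.ord j z := by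
  obtain ⟨ω, hω, -, hK⟩ := hK
  obtain ⟨k, hk⟩ := hb.exists_smul_eq ω
  have hk0 : k ≠ 0 := by
    rintro rfl
    exact hω (by rw [hk, zero_smul])
  refine ⟨k, hk0, fun z hz v hv j hj => ?_⟩
  obtain ⟨g, ω₀, hspan, hg, hKz⟩ := hK z hz
  rw [regularFormsAt_eq_span X hv] at hspan
  set θ := exteriorPower.ιMulti X.carrier.functionField n fun i => KaehlerDifferential.D ℂ X.carrier.functionField (v i)
  have hθ : θ ≠ 0 := hv.2.1.ιMulti_ne_zero
  have hj0 := hj.ne_zero hb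
  obtain ⟨r, hr, hr', hr0, hω₀⟩ := exists_unit_of_span_singleton_eq (M := ⋀[X.carrier.functionField]^n Ω[X.carrier.functionField⁄ℂ]) _ hθ hspan
  have hgr : g * r = k * j := by
    apply smul_left_injective _ hθ
    change (g * r) • θ = (k * j) • θ
    rw [mul_smul, mul_smul, ← hω₀]
    refine hg.symm.trans (hk.trans ?_)
    rw [hj]
  have hg0 : g ≠ 0 := by
    rintro rfl
    rw [zero_mul] at hgr
    exact mul_ne_zero hk0 hj0 hgr.symm
  rw [hKz, ← Scheme.ord_mul hk0 hj0, ← hgr, Scheme.ord_mul hg0 hr0, ord_eq_zero_of_mem hr hr', add_zero]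

end

/-! ### Inverse image ideals on affine opens -/

theorem ideal_comap_top_of_isAffine {X Y : Scheme.{0}} [IsAffine X] [IsAffine Y] (J : Y.IdealSheafData) (f : X ⟶ Y) :
    (J.comap f).ideal ⟨⊤, isAffineOpen_top X⟩ = (J.ideal ⟨⊤, isAffineOpen_top Y⟩).map f.appTop.hom := by
  apply le_antisymm
  · let K : X.IdealSheafData := .ofIdealTop ((J.ideal ⟨⊤, isAffineOpen_top Y⟩).map f.appTop.hom)
    have hK : K.ideal ⟨⊤, isAffineOpen_top X⟩ = (J.ideal ⟨⊤, isAffineOpen_top Y⟩).map f.appTop.hom :=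
      Scheme.IdealSheafData.equivOfIsAffine.apply_symm_apply _
    have : J.comap f ≤ K := by
      rw [← Scheme.IdealSheafData.le_map_iff_comap_le]
      apply Scheme.IdealSheafData.le_of_isAffine
      rw [Scheme.IdealSheafData.ideal_map_of_isAffineHom]
      refine Ideal.map_le_iff_le_comap.1 ?_
      exact hK.ge
    exact (this ⟨⊤, isAffineOpen_top X⟩).trans hK.le
  · have := Scheme.IdealSheafData.le_map_comap J f
    have := this ⟨⊤, isAffineOpen_top Y⟩
    rw [Scheme.IdealSheafData.ideal_map_of_isAffineHom] at this
    exact Ideal.map_le_iff_le_comap.2 this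

theorem ideal_comap {X Y : Scheme.{0}} (I : Y.IdealSheafData) (f : X ⟶ Y) (U : Y.affineOpens) (V : X.affineOpens)
    (e : V.1 ≤ f ⁻¹ᵁ U.1) : (I.comap f).ideal V = (I.ideal U).map (f.appLE U.1 V.1 e).hom := by
  -- The image of ⊤ under the inclusion of U equals U only propositionally; this transports the
  -- claim along that equality.
  have aux : ∀ (U' : Y.affineOpens) (V' : X.affineOpens) (e' : V'.1 ≤ f ⁻¹ᵁ U'.1), U' = U → V' = V →
      (I.comap f).ideal V' = (I.ideal U').map (f.appLE U'.1 V'.1 e').hom →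
      (I.comap f).ideal V = (I.ideal U).map (f.appLE U.1 V.1 e).hom := by
    rintro _ _ e' rfl rfl h; exact h
  have hU : U.1.ι ''ᵁ ⊤ = U.1 := U.1.ι_image_top
  have hV : V.1.ι ''ᵁ ⊤ = V.1 := V.1.ι_image_top
  refine aux ⟨U.1.ι ''ᵁ ⊤, hU.symm ▸ U.2⟩ ⟨V.1.ι ''ᵁ ⊤, hV.symm ▸ V.2⟩ (by simpa using e) (Subtype.ext hU) (Subtype.ext hV) ?_
  have : IsAffine U.1 := U.2
  have : IsAffine V.1 := V.2
  have h := ideal_comap_top_of_isAffine (I.comap U.1.ι) (f.resLE U.1 V.1 e)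
  rw [← Scheme.IdealSheafData.comap_comp, Scheme.Hom.resLE_comp_ι, Scheme.IdealSheafData.comap_comp,
    Scheme.IdealSheafData.ideal_comap_of_isOpenImmersion (I.comap f) V.1.ι,
    Scheme.IdealSheafData.ideal_comap_of_isOpenImmersion I U.1.ι] at h
  simp only [Scheme.Opens.ι_appIso] at h
  have h2 := (Scheme.Hom.appLE_eq_app (f.resLE U.1 V.1 e) (U := ⊤)).symm.trans (Scheme.Hom.resLE_appLE f e ⊤ ⊤ le_top)
  rw [show (f.resLE U.1 V.1 e).appTop = _ from h2] at h
  exact h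

/-- An invertible ideal is principal on arbitrarily small affine open neighbourhoods. -/
theorem IsInvertibleIdeal.exists_le {T : Scheme.{0}} [IsIntegral T] {J : T.IdealSheafData} (hJ : IsInvertibleIdeal J) (x : T)
    (W : T.Opens) (hW : x ∈ W) : ∃ V : T.affineOpens, x ∈ V.1 ∧ V.1 ≤ W ∧ ∃ a : Γ(T, V.1), a ≠ 0 ∧ J.ideal V = Ideal.span {a} := by
  obtain ⟨U, hU, a, ha, h⟩ := hJ x
  obtain ⟨_, ⟨V, hV, rfl⟩, hx, hVU⟩ := T.isBasis_affineOpens.exists_subset_of_mem_open (show x ∈ U.1 ⊓ W from ⟨hU, hW⟩) (U.1 ⊓ W).2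
  have hVU' : (⟨V, hV⟩ : T.affineOpens) ≤ U := fun y hy => (hVU hy).1
  have : Nonempty U.1 := ⟨⟨x, hU⟩⟩
  have : Nonempty V := ⟨⟨x, hx⟩⟩
  refine ⟨⟨V, hV⟩, hx, fun y hy => (hVU hy).2, T.presheaf.map (homOfLE hVU').op a, ?_, ?_⟩
  · intro h0
    have h1 : T.germToFunctionField U.1 a = 0 := by
      rw [Scheme.germToFunctionField, ← TopCat.Presheaf.germ_res_apply T.presheaf (homOfLE hVU') _
        (((genericPoint_spec T).mem_open_set_iff V.isOpen).mpr ⟨x, Set.mem_univ x, hx⟩)]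
      exact (congrArg _ h0).trans (map_zero _)
    rw [map_eq_zero_iff _ (T.germToFunctionField_injective U.1)] at h1
    exact nonZeroDivisors.ne_zero ha h1
  · rw [← J.map_ideal hVU', h, Ideal.map_span, Set.image_singleton]

/-! ### Local rings of a blow-up -/

/-- The ideal of the local ring at `y` generated by the sections of `I` over an affine open neighborhood `U`. -/
def stalkIdeal {Y : Scheme.{0}} (I : Y.IdealSheafData) (U : Y.affineOpens) (y : Y) (hy : y ∈ U.1) : Ideal (Y.presheaf.stalk y) :=
  (I.ideal U).map (Y.presheaf.germ U.1 y hy).hom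

theorem fromSpecStalk_preimage {Y : Scheme.{0}} (U : Y.Opens) (y : Y) (hy : y ∈ U) : ⊤ ≤ Y.fromSpecStalk y ⁻¹ᵁ U := by
  intro z _
  have : Y.fromSpecStalk y z ⤳ y := by
    have : Y.fromSpecStalk y z ∈ Set.range (Y.fromSpecStalk y) := ⟨z, rfl⟩
    rwa [Scheme.range_fromSpecStalk] at this
  exact Specializes.mem_open (s := U) this U.2 hy

theorem ideal_comap_Spec {Y : Scheme.{0}} (I : Y.IdealSheafData) (U : Y.affineOpens) (y : Y) (hy : y ∈ U.1) {B : CommRingCat.{0}}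
    (ψ : Y.presheaf.stalk y ⟶ B) :
    (I.comap (Spec.map ψ ≫ Y.fromSpecStalk y)).ideal ⟨⊤, isAffineOpen_top _⟩ =
      ((stalkIdeal I U y hy).map ψ.hom).map (Scheme.ΓSpecIso B).inv.hom := by
  rw [Scheme.IdealSheafData.comap_comp, ideal_comap_top_of_isAffine,
    ideal_comap I (Y.fromSpecStalk y) U ⟨⊤, isAffineOpen_top _⟩ (fromSpecStalk_preimage U.1 y hy),
    stalkIdeal, Ideal.map_map, Ideal.map_map, Ideal.map_map]
  congr 1
  rw [← CommRingCat.hom_comp, ← CommRingCat.hom_comp, ← CommRingCat.hom_comp]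
  congr 1
  rw [Scheme.ΓSpecIso_inv_naturality, ← Category.assoc]
  congr 1
  refine (Scheme.Hom.appLE_map (Y.fromSpecStalk y) le_rfl (homOfLE (fromSpecStalk_preimage U.1 y hy)).op).symm.trans ?_
  rw [Scheme.Hom.appLE_eq_app, Scheme.fromSpecStalk_app hy, Category.assoc, Category.assoc, ← Functor.map_comp]
  exact congrArg (Y.presheaf.germ U.1 y hy ≫ ·) ((congrArg ((Scheme.ΓSpecIso (Y.presheaf.stalk y)).inv ≫ ·)
    (CategoryTheory.Functor.map_id _ _)).trans (Category.comp_id _))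

theorem isInvertibleIdeal_Spec {B : CommRingCat.{0}} [IsDomain B] (J : (Spec B).IdealSheafData) (a : B) (ha : a ≠ 0)
    (h : J.ideal ⟨⊤, isAffineOpen_top _⟩ = (Ideal.span {a}).map (Scheme.ΓSpecIso B).inv.hom) : IsInvertibleIdeal J := by
  intro x
  refine ⟨⟨⊤, isAffineOpen_top _⟩, trivial, (Scheme.ΓSpecIso B).inv a, ?_, ?_⟩
  · rw [mem_nonZeroDivisors_iff_ne_zero]
    intro h0
    apply ha
    have := congrArg (Scheme.ΓSpecIso B).hom.hom h0
    simpa using this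
  · rw [h, Ideal.map_span, Set.image_singleton]

/-- The center becomes invertible on Spec B, so Spec B → Y lifts to X. The lift induces a ring map
from the stalk at w to B which, followed by the inclusion of B, is the identity by uniqueness of
lifts; hence the inclusion is onto. The condition on units makes B local and dominated by the stalk.
-/
theorem IsBlowUp.subring_eq_top {X Y : Scheme.{0}} {I : Y.IdealSheafData} {f : X ⟶ Y} (hb : IsBlowUp I f) [IsIntegral X]
    (w : X) (U : Y.affineOpens) (hU : f w ∈ U.1) (B : Subring (X.presheaf.stalk w))
    (hB : ∀ b ∈ B, IsUnit b → ∃ c ∈ B, b * c = 1) (hR : ∀ a, f.stalkMap w a ∈ B) (x : X.presheaf.stalk w) (hx : x ∈ B) (hx0 : x ≠ 0)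
    (hI : (stalkIdeal I U (f w) hU).map ((f.stalkMap w).hom.codRestrict B hR) = Ideal.span {⟨x, hx⟩}) : B = ⊤ := by
  let ι : CommRingCat.of B ⟶ X.presheaf.stalk w := CommRingCat.ofHom B.subtype
  let ψ : Y.presheaf.stalk (f w) ⟶ CommRingCat.of B := CommRingCat.ofHom ((f.stalkMap w).hom.codRestrict B hR)
  have hψι : ψ ≫ ι = f.stalkMap w := rfl
  have hloc : IsLocalHom ι.hom := ⟨fun b hb => by
    obtain ⟨c, hc, h⟩ := hB b b.2 hb
    exact IsUnit.of_mul_eq_one ⟨c, hc⟩ (Subtype.ext h)⟩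
  have : IsLocalRing (CommRingCat.of B) := RingHom.domain_isLocalRing ι.hom
  have : IsDomain (CommRingCat.of B) := inferInstanceAs (IsDomain B)
  have hinv1 : IsInvertibleIdeal (I.comap (Spec.map ψ ≫ Y.fromSpecStalk (f w))) := by
    refine isInvertibleIdeal_Spec _ (⟨x, hx⟩ : B) (fun h => hx0 (congrArg Subtype.val h)) ?_
    rw [ideal_comap_Spec I U (f w) hU]
    exact congrArg _ hI
  have hinv2 : IsInvertibleIdeal (I.comap (Spec.map (ψ ≫ ι) ≫ Y.fromSpecStalk (f w))) := by
    refine isInvertibleIdeal_Spec _ x hx0 ?_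
    rw [ideal_comap_Spec I U (f w) hU, CommRingCat.hom_comp, ← Ideal.map_map]
    refine congrArg _ ((congrArg (Ideal.map ι.hom) hI).trans ?_)
    rw [Ideal.map_span, Set.image_singleton]
    rfl
  obtain ⟨h, hh, -⟩ := hb.2 _ _ hinv1
  -- Uniqueness of lifts, with the spectrum of the stalk at w as test scheme.
  have hk : Spec.map ι ≫ h = X.fromSpecStalk w := by
    refine (hb.2 _ _ hinv2).unique ?_ ?_
    · rw [Category.assoc, hh, Spec.map_comp, Category.assoc]
    · rw [hψι, Scheme.SpecMap_stalkMap_fromSpecStalk]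
  -- Since ι is local, closed point goes to closed point, so the lift sends the closed point of Spec
  -- B to w.
  have hpt : h (IsLocalRing.closedPoint (CommRingCat.of B)) = w := by
    have h1 := congrArg (fun k : Spec (X.presheaf.stalk w) ⟶ X => k (IsLocalRing.closedPoint (X.presheaf.stalk w))) hk
    simp only [Scheme.fromSpecStalk_closedPoint] at h1
    exact (congrArg h (Spec_closedPoint (f := ι))).symm.trans h1
  let χ : X.presheaf.stalk w ⟶ CommRingCat.of B :=
    X.presheaf.stalkSpecializes (specializes_of_eq hpt) ≫ Scheme.stalkClosedPointTo h
  have hχ : Spec.map χ ≫ X.fromSpecStalk w = h := by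
    rw [Spec.map_comp, Category.assoc, Scheme.SpecMap_stalkSpecializes_fromSpecStalk, Scheme.Spec_stalkClosedPointTo_fromSpecStalk]
  have hid : χ ≫ ι = 𝟙 _ := by
    apply Spec.map_injective
    rw [← cancel_mono (X.fromSpecStalk w), Spec.map_comp, Category.assoc, hχ, hk, Spec.map_id, Category.id_comp]
  rw [eq_top_iff]
  intro a _
  have := congrArg (fun k => k.hom a) hid
  change (χ.hom a : B).1 = a at this
  rw [← this]
  exact (χ.hom a : B).2

theorem germ_comp_stalkMap {X Y : Scheme.{0}} (f : X ⟶ Y) (U : Y.Opens) (V : X.Opens) (e : V ≤ f ⁻¹ᵁ U) (w : X) (hw : w ∈ V) :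
    Y.presheaf.germ U (f w) (e hw) ≫ f.stalkMap w = f.appLE U V e ≫ X.presheaf.germ V w hw := by
  have := Scheme.Hom.germ_stalkMap f U w (e hw)
  rw [this, ← X.presheaf.germ_res (homOfLE e) w hw, ← Category.assoc]
  congr 1

theorem exists_map_stalkIdeal_eq_span {X Y : Scheme.{0}} {I : Y.IdealSheafData} {f : X ⟶ Y} [IsIntegral X]
    (hinv : IsInvertibleIdeal (I.comap f)) (w : X) (U : Y.affineOpens) (hU : f w ∈ U.1) :
    ∃ a : X.presheaf.stalk w, a ≠ 0 ∧ (stalkIdeal I U (f w) hU).map (f.stalkMap w).hom = Ideal.span {a} := by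
  obtain ⟨V, hwV, hVU, a, ha, h⟩ := hinv.exists_le w (f ⁻¹ᵁ U.1) hU
  refine ⟨X.presheaf.germ V.1 w hwV a, fun h0 => ha ?_, ?_⟩
  · exact germ_injective_of_isIntegral X w hwV (h0.trans (map_zero _).symm)
  · rw [ideal_comap I f U V hVU] at h
    rw [stalkIdeal, Ideal.map_map, ← CommRingCat.hom_comp, germ_comp_stalkMap f U.1 V.1 hVU w hwV, CommRingCat.hom_comp,
      ← Ideal.map_map, h, Ideal.map_span, Set.image_singleton]

/-- If no u i generated (a), all of them would be nonunit multiples of a, giving (a) ⊆ 𝔪 (a) and a =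
0 by Nakayama. -/
theorem exists_span_singleton_eq {R ι : Type*} [CommRing R] [IsDomain R] [IsLocalRing R] (u : ι → R) (S : Finset ι) {a : R}
    (ha : a ≠ 0) (h : Ideal.span (u '' S) = Ideal.span {a}) : ∃ i ∈ S, Ideal.span {u i} = Ideal.span {a} := by
  by_contra! hS
  have h1 : ∀ i ∈ S, ∃ c, u i = c * a := fun i hi => by
    have : u i ∈ Ideal.span {a} := h ▸ Ideal.subset_span ⟨i, hi, rfl⟩
    obtain ⟨c, hc⟩ := Ideal.mem_span_singleton'.1 this
    exact ⟨c, hc.symm⟩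
  have h2 : Ideal.span {a} ≤ IsLocalRing.maximalIdeal R • Ideal.span {a} := by
    rw [← h, Ideal.span_le]
    rintro _ ⟨i, hi, rfl⟩
    obtain ⟨c, hc⟩ := h1 i hi
    rw [h, hc, smul_eq_mul]
    refine Ideal.mul_mem_mul ?_ (Ideal.mem_span_singleton_self a)
    intro hu
    apply hS i hi
    rw [hc]
    exact Ideal.span_singleton_mul_left_unit hu a
  have h3 := Submodule.eq_bot_of_le_smul_of_le_jacobson_bot (IsLocalRing.maximalIdeal R) _
    (Submodule.fg_span_singleton a) h2 (IsLocalRing.maximalIdeal_le_jacobson _)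
  exact ha (Ideal.span_singleton_eq_bot.1 h3)

/-- The local rings of the blow-up consist of fractions in the generators `v i / v i₀` of the
blow-up algebra over the local ring of the base. -/
theorem IsBlowUp.exists_fractions {X Y : Scheme.{0}} {I : Y.IdealSheafData} {f : X ⟶ Y} (hb : IsBlowUp I f) [IsIntegral X]
    (w : X) (U : Y.affineOpens) (hU : f w ∈ U.1) {ι : Type} (v : ι → Y.presheaf.stalk (f w)) (S : Finset ι)
    (hv : stalkIdeal I U (f w) hU = Ideal.span (v '' S)) :
    ∃ i₀ ∈ S, f.stalkMap w (v i₀) ≠ 0 ∧ ∃ q : ι → X.presheaf.stalk w, (∀ i ∈ S, f.stalkMap w (v i) = q i * f.stalkMap w (v i₀)) ∧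
      ∀ b : X.presheaf.stalk w, ∃ p ∈ Subring.closure (Set.range (f.stalkMap w) ∪ q '' S),
        ∃ s ∈ Subring.closure (Set.range (f.stalkMap w) ∪ q '' S), IsUnit s ∧ b * s = p := by
  obtain ⟨a, ha, h⟩ := exists_map_stalkIdeal_eq_span hb.1 w U hU
  have h' := h
  rw [hv, Ideal.map_span, ← Set.image_comp] at h'
  obtain ⟨i₀, hi₀, hspan⟩ := exists_span_singleton_eq _ S ha h'
  set x := f.stalkMap w (v i₀) with hx
  have hspan' : Ideal.span {x} = Ideal.span {a} := hspan
  have hx0 : x ≠ 0 := by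
    intro h0
    rw [h0] at hspan'
    exact ha (Ideal.span_singleton_eq_bot.1 (hspan'.symm.trans (by simp)))
  have hq : ∀ i, ∃ q, i ∈ S → f.stalkMap w (v i) = q * x := fun i => by
    by_cases hi : i ∈ S
    · have : f.stalkMap w (v i) ∈ Ideal.span {x} := by
        rw [hspan', ← h']; exact Ideal.subset_span ⟨i, hi, rfl⟩
      obtain ⟨c, hc⟩ := Ideal.mem_span_singleton'.1 this
      exact ⟨c, fun _ => hc.symm⟩
    · exact ⟨0, fun h => absurd h hi⟩
  choose q hq using hq
  refine ⟨i₀, hi₀, hx0, q, hq, ?_⟩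
  set C := Subring.closure (Set.range (f.stalkMap w) ∪ q '' S) with hC
  -- Only elements invertible in the stalk serve as denominators, so a unit of the stalk lying in B
  -- has its inverse in B, as `IsBlowUp.subring_eq_top` demands.
  let B : Subring (X.presheaf.stalk w) :=
    { carrier := {b | ∃ p ∈ C, ∃ s ∈ C, IsUnit s ∧ b * s = p}
      mul_mem' := by
        rintro b b' ⟨p, hp, s, hs, hu, h⟩ ⟨p', hp', s', hs', hu', h'⟩
        exact ⟨p * p', mul_mem hp hp', s * s', mul_mem hs hs', hu.mul hu', by rw [← h, ← h']; ring⟩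
      one_mem' := ⟨1, one_mem _, 1, one_mem _, isUnit_one, by simp⟩
      add_mem' := by
        rintro b b' ⟨p, hp, s, hs, hu, h⟩ ⟨p', hp', s', hs', hu', h'⟩
        exact ⟨p * s' + p' * s, add_mem (mul_mem hp hs') (mul_mem hp' hs), s * s', mul_mem hs hs', hu.mul hu', by rw [← h, ← h']; ring⟩
      zero_mem' := ⟨0, zero_mem _, 1, one_mem _, isUnit_one, by simp⟩
      neg_mem' := by
        rintro b ⟨p, hp, s, hs, hu, h⟩
        exact ⟨-p, neg_mem hp, s, hs, hu, by rw [← h]; ring⟩ }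
  have hCB : C ≤ B := fun c hc => ⟨c, hc, 1, one_mem _, isUnit_one, by simp⟩
  have hR : ∀ a, f.stalkMap w a ∈ B := fun a => hCB (Subring.subset_closure (Or.inl ⟨a, rfl⟩))
  have hB : B = ⊤ := by
    refine hb.subring_eq_top w U hU B ?_ hR x (hR _) hx0 ?_
    · rintro b ⟨p, hp, s, hs, hu, h⟩ hbu
      obtain ⟨c, hc⟩ := hbu.exists_right_inv
      refine ⟨c, ⟨s, hs, p, hp, h ▸ hbu.mul hu, ?_⟩, hc⟩
      rw [← h, ← mul_assoc, mul_comm c, hc, one_mul]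
    · rw [hv, Ideal.map_span]
      apply le_antisymm
      · rw [Ideal.span_le]
        rintro _ ⟨_, ⟨i, hi, rfl⟩, rfl⟩
        refine Ideal.mem_span_singleton'.2 ⟨⟨q i, hCB (Subring.subset_closure (Or.inr ⟨i, hi, rfl⟩))⟩, Subtype.ext (hq i hi).symm⟩
      · rw [Ideal.span_le]
        rintro _ rfl
        exact Ideal.subset_span ⟨_, ⟨i₀, hi₀, rfl⟩, rfl⟩
  intro b
  have : b ∈ B := hB ▸ Subring.mem_top b
  exact this

/-! ### The blow-up away from its center -/

section Complement
variable {X Y : Scheme.{0}} {I : Y.IdealSheafData} {f : X ⟶ Y}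

theorem isInvertibleIdeal_top {T : Scheme.{0}} : IsInvertibleIdeal (⊤ : T.IdealSheafData) := by
  intro x
  obtain ⟨U, hU, hx⟩ := exists_affineOpen_mem x
  exact ⟨⟨U, hU⟩, hx, 1, one_mem _, by simp⟩

theorem isInvertibleIdeal_comap_of_disjoint {T : Scheme.{0}} (g : T ⟶ Y) (hg : ∀ t : T, g t ∉ I.support) :
    IsInvertibleIdeal (I.comap g) := by
  have : I.comap g = ⊤ := by
    rw [← Scheme.IdealSheafData.support_eq_bot_iff, Scheme.IdealSheafData.support_comap]
    ext t
    simpa using hg t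
  rw [this]
  exact isInvertibleIdeal_top

/-- Over W the ideal is the unit ideal, so W is itself a test scheme. Its lift to X is inverse to f
over W, by uniqueness of lifts from f⁻¹(W). -/
theorem IsBlowUp.isIso_restrict (hb : IsBlowUp I f) (W : Y.Opens) (hW : ∀ y ∈ W, y ∉ I.support) : IsIso (f ∣_ W) := by
  obtain ⟨h, hh, -⟩ := hb.2 W W.ι (isInvertibleIdeal_comap_of_disjoint _ fun t => hW _ t.2)
  have hr : Set.range h ⊆ (f ⁻¹ᵁ W : X.Opens) := by
    rintro _ ⟨t, rfl⟩
    change f (h t) ∈ W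
    rw [← Scheme.Hom.comp_apply, hh]
    exact t.2
  let s : W.toScheme ⟶ (f ⁻¹ᵁ W).toScheme := IsOpenImmersion.lift (f ⁻¹ᵁ W).ι h (by simpa using hr)
  have hs : s ≫ (f ⁻¹ᵁ W).ι = h := IsOpenImmersion.lift_fac _ _ _
  refine ⟨s, ?_, ?_⟩
  · rw [← cancel_mono (f ⁻¹ᵁ W).ι, Category.assoc, hs, Category.id_comp]
    refine (hb.2 _ ((f ⁻¹ᵁ W).ι ≫ f) (isInvertibleIdeal_comap_of_disjoint _ fun t => hW _ t.2)).unique ?_ rfl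
    rw [Category.assoc, hh, morphismRestrict_ι]
  · rw [← cancel_mono W.ι, Category.assoc, morphismRestrict_ι, ← Category.assoc, hs, hh, Category.id_comp]

/-- The stalk maps of `f` are isomorphisms over an open set over which `f` is an isomorphism. -/
theorem isIso_stalkMap_of_isIso_restrict (W : Y.Opens) [IsIso (f ∣_ W)] (x : X) (hx : f x ∈ W) : IsIso (f.stalkMap x) := by
  let x' : (f ⁻¹ᵁ W).toScheme := ⟨x, hx⟩
  have h := morphismRestrict_ι f W
  have h1 : IsIso (((f ⁻¹ᵁ W).ι ≫ f).stalkMap x') := by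
    rw [← h]
    infer_instance
  rw [Scheme.Hom.stalkMap_comp] at h1
  exact @IsIso.of_isIso_comp_right _ _ _ _ _ (f.stalkMap ((f ⁻¹ᵁ W).ι x')) ((f ⁻¹ᵁ W).ι.stalkMap x') inferInstance h1

theorem coheight_eq_of_isIso_restrict (W : Y.Opens) [IsIso (f ∣_ W)] (x : X) (hx : f x ∈ W) : coheight (f x) = coheight x := by
  let x' : (f ⁻¹ᵁ W).toScheme := ⟨x, hx⟩
  have h1 := coheight_eq_of_isOpenImmersion (x := x') (f ⁻¹ᵁ W).ι
  have h2 := coheight_eq_of_isOpenImmersion (x := x') ((f ∣_ W) ≫ W.ι)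
  rw [morphismRestrict_ι] at h2
  exact h2.trans h1.symm

/-- The inverse of `f` over `W`, as a morphism to `X`. -/
theorem exists_lift_of_isIso_restrict (W : Y.Opens) [IsIso (f ∣_ W)] : ∃ h : W.toScheme ⟶ X, h ≫ f = W.ι ∧
    ∀ x (hx : f x ∈ W), h ⟨f x, hx⟩ = x := by
  refine ⟨inv (f ∣_ W) ≫ (f ⁻¹ᵁ W).ι, ?_, fun x hx => ?_⟩
  · rw [Category.assoc, ← morphismRestrict_ι, IsIso.inv_hom_id_assoc]
  · let x' : (f ⁻¹ᵁ W).toScheme := ⟨x, hx⟩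
    have : (f ∣_ W) x' = ⟨f x, hx⟩ := Subtype.ext (morphismRestrict_base_coe f W x')
    rw [← this, ← Scheme.Hom.comp_apply, IsIso.hom_inv_id_assoc]
    rfl

end Complement

/-! ### Local rings of the smooth center -/

theorem formallySmooth_quotient_map {k R A : Type} [Field k] [CommRing R] [CommRing A] [Algebra k R] [Algebra R A] [Algebra k A]
    [IsScalarTower k R A] (M : Submonoid R) [IsLocalization M A] (I : Ideal R) [Algebra.FormallySmooth k (R ⧸ I)] :
    Algebra.FormallySmooth k (A ⧸ I.map (algebraMap R A)) := by
  have := Algebra.FormallySmooth.of_isLocalization (Rₘ := A) M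
  have : Algebra.FormallySmooth (R ⧸ I) (A ⧸ I.map (algebraMap R A)) :=
    .of_equiv (Algebra.TensorProduct.quotIdealMapEquivQuotTensor A I).symm
  have : IsScalarTower k (R ⧸ I) (A ⧸ I.map (algebraMap R A)) := by
    refine .of_algebraMap_eq fun c => ?_
    rw [IsScalarTower.algebraMap_apply k R (R ⧸ I), IsScalarTower.algebraMap_apply k A (A ⧸ I.map (algebraMap R A)),
      IsScalarTower.algebraMap_apply k R A]
    rfl
  exact Algebra.FormallySmooth.comp k (R ⧸ I) _

theorem formallySmooth_quotient_of_surjective {k R S : Type} [CommRing k] [CommRing R] [CommRing S] [Algebra k R] [Algebra k S]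
    (g : R →ₐ[k] S) (hg : Function.Surjective g) {I : Ideal R} (hI : RingHom.ker g = I) [Algebra.FormallySmooth k S] :
    Algebra.FormallySmooth k (R ⧸ I) := by
  subst hI
  exact .of_equiv (Ideal.quotientKerAlgEquivOfSurjective hg).symm

section
variable {n : ℕ} (Y : SmoothVariety n)

theorem algebraMap_stalk_eq_germ (V : Y.carrier.Opens) (x : Y.carrier) (hx : x ∈ V) (c : ℂ) :
    Y.carrier.presheaf.germ V x hx (((Scheme.ΓSpecIso (.of ℂ)).inv ≫ Y.str.appLE ⊤ V le_top).hom c) =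
      algebraMap ℂ (Y.carrier.presheaf.stalk x) c := by
  change (((Scheme.ΓSpecIso (.of ℂ)).inv ≫ Y.str.appLE ⊤ V le_top) ≫ (Y.carrier.presheaf.germ V x hx)).hom c = _
  rw [← Scheme.Hom.appLE_map (f := Y.str) (U := ⊤) (V := ⊤) le_top (homOfLE le_top).op, Category.assoc, Category.assoc,
      Y.carrier.presheaf.germ_res, show Y.str.appLE ⊤ ⊤ le_top = Y.str.appTop from Y.str.appLE_eq_app]
  rfl

/-- On an affine chart the quotient by the ideal is the coordinate ring of the center, which is
smooth; formal smoothness survives localization. -/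
theorem formallySmooth_quotient_stalkIdeal (I : Y.carrier.IdealSheafData) (hI : Smooth (I.subschemeι ≫ Y.str))
    (U : Y.carrier.affineOpens) (y : Y.carrier) (hy : y ∈ U.1) :
    Algebra.FormallySmooth ℂ (Y.carrier.presheaf.stalk y ⧸ stalkIdeal I U y hy) := by
  let a : CommRingCat.of ℂ ⟶ Γ(Y.carrier, U.1) := (Scheme.ΓSpecIso (.of ℂ)).inv ≫ Y.str.appLE ⊤ U.1 le_top
  algebraize [a.hom, (Y.carrier.presheaf.germ U.1 y hy).hom]
  have : IsScalarTower ℂ Γ(Y.carrier, U.1) (Y.carrier.presheaf.stalk y) :=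
    .of_algebraMap_eq fun c => (algebraMap_stalk_eq_germ Y U.1 y hy c).symm
  have : IsLocalization.AtPrime (Y.carrier.presheaf.stalk y) (U.2.primeIdealOf ⟨y, hy⟩).asIdeal := U.2.isLocalization_stalk ⟨y, hy⟩
  have hs : Algebra.FormallySmooth ℂ (Γ(Y.carrier, U.1) ⧸ I.ideal U) := by
    have h1 := hI.smooth_appLE (isAffineOpen_top (Spec (.of ℂ))) (U.2.preimage I.subschemeι) le_top
    let g := I.subschemeι.app U.1
    have h2 : a ≫ g = (Scheme.ΓSpecIso (.of ℂ)).inv ≫ (I.subschemeι ≫ Y.str).appLE ⊤ (I.subschemeι ⁻¹ᵁ U.1) le_top := by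
      rw [← Scheme.Hom.appLE_comp_appLE _ _ _ U.1 _ le_top le_rfl, Scheme.Hom.appLE_eq_app, Category.assoc]
    have h3 : (a ≫ g).hom.Smooth := by
      rw [h2, CommRingCat.hom_comp]
      exact RingHom.Smooth.respectsIso.2 _ (Scheme.ΓSpecIso (.of ℂ)).symm.commRingCatIsoToRingEquiv h1
    algebraize [(a ≫ g).hom]
    have hsm : Algebra.Smooth ℂ Γ(I.subscheme, I.subschemeι ⁻¹ᵁ U.1) := h3
    let G : Γ(Y.carrier, U.1) →ₐ[ℂ] Γ(I.subscheme, I.subschemeι ⁻¹ᵁ U.1) := { g.hom with commutes' := fun c => rfl }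
    exact formallySmooth_quotient_of_surjective G (I.subschemeι_app_surjective U) (I.ker_subschemeι_app U)
  exact formallySmooth_quotient_map (R := Γ(Y.carrier, U.1)) (U.2.primeIdealOf ⟨y, hy⟩).asIdeal.primeCompl (I.ideal U)

end

/-! ### Function fields under birational morphisms -/

section FunctionFieldMap

/-- `φ` is the map of function fields induced by `F`. -/
def IsFunctionFieldMap {X Y : Scheme.{0}} [IsIntegral X] [IsIntegral Y] (F : X ⟶ Y) (φ : Y.functionField →+* X.functionField) : Prop :=
  ∀ (x : X) (a : Y.presheaf.stalk (F x)), algebraMap (X.presheaf.stalk x) X.functionField (F.stalkMap x a) = φ (algebraMap _ Y.functionField a)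

theorem exists_isFunctionFieldMap {X Y : Scheme.{0}} [IsIntegral X] [IsIntegral Y] (F : X ⟶ Y)
    (hη : F (genericPoint X) = genericPoint Y) (hF : IsIso (F.stalkMap (genericPoint X))) :
    ∃ φ : Y.functionField →+* X.functionField, IsFunctionFieldMap F φ ∧ Function.Surjective φ := by
  refine ⟨(Y.presheaf.stalkSpecializes (specializes_of_eq hη) ≫ F.stalkMap (genericPoint X)).hom, ?_, ?_⟩
  · intro x a
    have hx : genericPoint X ⤳ x := (genericPoint_spec X).specializes trivial
    have h1 := Scheme.Hom.stalkSpecializes_stalkMap F _ _ hx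
    change (F.stalkMap x ≫ X.presheaf.stalkSpecializes hx).hom a =
      (Y.presheaf.stalkSpecializes _ ≫ Y.presheaf.stalkSpecializes (specializes_of_eq hη) ≫ F.stalkMap (genericPoint X)).hom a
    rw [← h1, ← Category.assoc, Y.presheaf.stalkSpecializes_comp]
  · have h2 : IsIso (Y.presheaf.stalkSpecializes (specializes_of_eq hη)) := by
      refine ⟨Y.presheaf.stalkSpecializes (specializes_of_eq hη.symm), ?_, ?_⟩ <;> rw [Y.presheaf.stalkSpecializes_comp] <;> simp
    have : IsIso (Y.presheaf.stalkSpecializes (specializes_of_eq hη) ≫ F.stalkMap (genericPoint X)) := inferInstance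
    exact (ConcreteCategory.bijective_of_isIso _).2

variable {n : ℕ} {X Y : SmoothVariety n} {F : X.carrier ⟶ Y.carrier} {φ : Y.carrier.functionField →+* X.carrier.functionField}

theorem stalkMap_algebraMap (hF : F ≫ Y.str = X.str) (x : X.carrier) (c : ℂ) :
    F.stalkMap x (algebraMap ℂ _ c) = algebraMap ℂ _ c := by
  rw [← algebraMap_stalk_eq_germ Y ⊤ (F x) trivial c, ← algebraMap_stalk_eq_germ X ⊤ x trivial c]
  change (((Scheme.ΓSpecIso (.of ℂ)).inv ≫ Y.str.appLE ⊤ ⊤ le_top) ≫ Y.carrier.presheaf.germ ⊤ (F x) trivial ≫ F.stalkMap x).hom c =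
    (((Scheme.ΓSpecIso (.of ℂ)).inv ≫ X.str.appLE ⊤ ⊤ le_top) ≫ X.carrier.presheaf.germ ⊤ x trivial).hom c
  have h1 := germ_comp_stalkMap F ⊤ ⊤ le_top x trivial
  have h2 := Scheme.Hom.appLE_comp_appLE F Y.str ⊤ ⊤ ⊤ le_top le_top
  simp only [hF] at h2
  rw [h1, ← Category.assoc, Category.assoc _ (Y.str.appLE ⊤ ⊤ le_top), h2]

theorem IsFunctionFieldMap.map_algebraMap (hφ : IsFunctionFieldMap F φ) (hF : F ≫ Y.str = X.str) (c : ℂ) :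
    φ (algebraMap ℂ _ c) = algebraMap ℂ _ c := by
  rw [IsScalarTower.algebraMap_apply ℂ (Y.carrier.presheaf.stalk (F (genericPoint X.carrier))), ← hφ, stalkMap_algebraMap hF,
    ← IsScalarTower.algebraMap_apply]

theorem IsFunctionFieldMap.map_mem (hφ : IsFunctionFieldMap F φ) {x : X.carrier} {a} (ha : a ∈ localRing Y.carrier (F x)) :
    φ a ∈ localRing X.carrier x := by
  obtain ⟨b, rfl⟩ := ha
  exact ⟨_, hφ x b⟩

theorem IsFunctionFieldMap.map_localRing (hφ : IsFunctionFieldMap F φ) {x : X.carrier} (hx : IsIso (F.stalkMap x)) :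
    (localRing Y.carrier (F x)).map φ = localRing X.carrier x := by
  apply le_antisymm
  · rintro _ ⟨a, ha, rfl⟩
    exact hφ.map_mem ha
  · rintro _ ⟨b, rfl⟩
    obtain ⟨a, rfl⟩ := (ConcreteCategory.bijective_of_isIso (F.stalkMap x)).2 b
    exact ⟨_, ⟨a, rfl⟩, (hφ x a).symm⟩

theorem IsFunctionFieldMap.map_mem_iff (hφ : IsFunctionFieldMap F φ) {x : X.carrier} (hx : IsIso (F.stalkMap x)) {a} :
    φ a ∈ localRing X.carrier x ↔ a ∈ localRing Y.carrier (F x) := by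
  rw [← hφ.map_localRing hx]
  refine ⟨?_, fun h => ⟨a, h, rfl⟩⟩
  rintro ⟨b, hb, h⟩
  exact φ.injective h ▸ hb

theorem ord_zpow {X : Scheme.{0}} [IsIntegral X] [IsLocallyNoetherian X] {h : X.functionField} (h0 : h ≠ 0) (w : X) (m : ℤ) :
    Scheme.ord (h ^ m) w = m * Scheme.ord h w := by
  obtain ⟨m, rfl | rfl⟩ := m.eq_nat_or_neg
  · rw [zpow_natCast, ord_pow h0]
  · rw [zpow_neg, zpow_natCast, ord_inv, ord_pow h0]; ring

/-- The isomorphism of stalks preserves the sign of the order. Hence the order of φ h at w is a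
fixed multiple of that of h at F w, and the multiple is 1 because a uniformizer at w lies in the
image of φ. -/
theorem IsFunctionFieldMap.ord_map (hφ : IsFunctionFieldMap F φ) (hs : Function.Surjective φ) {w : X.carrier} (hw : IsIso (F.stalkMap w))
    (h1 : coheight w = 1) (h2 : coheight (F w) = 1) (h : Y.carrier.functionField) (h0 : h ≠ 0) :
    Scheme.ord (φ h) w = Scheme.ord h (F w) := by
  have key : ∀ h : Y.carrier.functionField, h ≠ 0 → (0 ≤ Scheme.ord (φ h) w ↔ 0 ≤ Scheme.ord h (F w)) := fun h h0 => by
    rw [← mem_localRing_iff_ord_nonneg h1 (by simpa using h0), ← mem_localRing_iff_ord_nonneg h2 h0, hφ.map_mem_iff hw]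
  have key' : ∀ h : Y.carrier.functionField, h ≠ 0 → Scheme.ord h (F w) = 0 → Scheme.ord (φ h) w = 0 := fun h h0 hh => by
    have a1 := (key h h0).2 hh.ge
    have a2 := (key h⁻¹ (inv_ne_zero h0)).2 (by rw [ord_inv, hh, neg_zero])
    rw [map_inv₀, ord_inv] at a2
    omega
  obtain ⟨t, -, ht0, ht⟩ := exists_uniformizer h2
  obtain ⟨s, -, hs0, hs1⟩ := exists_uniformizer h1
  have ht0' : algebraMap _ Y.carrier.functionField t ≠ 0 := by simpa using ht0
  generalize algebraMap _ Y.carrier.functionField t = t at *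
  obtain ⟨s', hs'⟩ := hs (algebraMap _ X.carrier.functionField s)
  have hs0' : s' ≠ 0 := by
    rintro rfl
    rw [map_zero] at hs'
    exact hs0 (by simpa using hs'.symm)
  rw [← hs'] at hs1
  have key2 : ∀ h : Y.carrier.functionField, h ≠ 0 → Scheme.ord (φ h) w = Scheme.ord h (F w) * Scheme.ord (φ t) w := fun h h0 => by
    have htm := zpow_ne_zero (Scheme.ord h (F w)) ht0'
    have := key' (h * (t ^ (Scheme.ord h (F w)))⁻¹) (mul_ne_zero h0 (inv_ne_zero htm)) (by
      rw [Scheme.ord_mul h0 (inv_ne_zero htm), ord_inv, ord_zpow ht0', ht]; ring)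
    rw [map_mul, map_inv₀, map_zpow₀, Scheme.ord_mul (by simpa using h0) (inv_ne_zero (zpow_ne_zero _ (by simpa using ht0'))), ord_inv, ord_zpow (by simpa using ht0')] at this
    linarith
  have h3 := key2 s' hs0'
  rw [hs1] at h3
  have h4 := (key t ht0').2 (by omega)
  have h5 : Scheme.ord (φ t) w = 1 := Int.eq_one_of_mul_eq_one_left h4 h3.symm
  rw [key2 h h0, h5, mul_one]

end FunctionFieldMap

/-- The dual basis of dv gives the partial derivatives, which preserve R because dR lies in the
R-span of dv. -/
theorem IsCoordinates.exists_derivation {n : ℕ} {k K : Type} [Field k] [Field K] [Algebra k K] {R : Subring K} {v : Fin n → K}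
    (hv : IsCoordinates k R v) : ∃ δ : Fin n → Derivation k K K, (∀ i j, δ i (v j) = if i = j then 1 else 0) ∧
      ∀ i, ∀ a ∈ R, δ i a ∈ R := by
  obtain ⟨-, ⟨e, he⟩, hR⟩ := hv
  refine ⟨fun i => (e.coord i).compDer (KaehlerDifferential.D k K), fun i j => ?_, fun i a ha => ?_⟩
  · change e.coord i (KaehlerDifferential.D k K (v j)) = _
    rw [← he, Module.Basis.coord_apply, e.repr_self, Finsupp.single_apply]
    simp [eq_comm]
  · obtain ⟨c, hc, h⟩ := hR a ha
    change e.coord i (KaehlerDifferential.D k K a) ∈ _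
    rw [h]
    simp only [← he, map_sum, map_smul, Module.Basis.coord_apply, e.repr_self, Finsupp.single_apply, smul_eq_mul]
    simpa using hc i

/-! ### Log orders, codimension and multiplicity -/

section
variable {n : ℕ} (X : SmoothVariety n)

/-- The order at `w` of the form `db₁ ∧ ⋯ ∧ dbₙ`, twisted by `D`. -/
def logOrd (D : X.carrier → ℤ) (b : Fin n → X.carrier.functionField) (w : X.carrier) : ℤ :=
  D w + Scheme.ord ((exists_isCoordinates X w).choose_spec.2.1.exists_isJacobian b).choose w

/-- Independence of the coordinates chosen in the definition: the Jacobian between two systems at w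
is a unit of the local ring. -/
theorem logOrd_eq (D : X.carrier → ℤ) {b : Fin n → X.carrier.functionField} (hb : IsDiffBasis ℂ b) {w : X.carrier}
    {v : Fin n → X.carrier.functionField} (hv : IsCoordinates ℂ (localRing X.carrier w) v) {j : X.carrier.functionField}
    (hj : IsJacobian ℂ b v j) : logOrd X D b w = D w + Scheme.ord j w := by
  unfold logOrd
  set u := (exists_isCoordinates X w).choose
  have hu : IsCoordinates ℂ (localRing X.carrier w) u := (exists_isCoordinates X w).choose_spec
  have hg := ((exists_isCoordinates X w).choose_spec.2.1.exists_isJacobian b).choose_spec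
  set g := ((exists_isCoordinates X w).choose_spec.2.1.exists_isJacobian b).choose
  obtain ⟨r, hr⟩ := hv.2.1.exists_isJacobian u
  have h1 := (hg.trans hr).unique hv.2.1 hj
  have h2 := ord_eq_zero_of_mem (hv.isJacobian_mem hu.1 hr) (hv.isJacobian_inv_mem hu hr)
  have h3 := hj.ne_zero hb
  rw [← h1] at h3
  rw [← h1, Scheme.ord_mul (left_ne_zero_of_mul h3) (right_ne_zero_of_mul h3), h2, add_zero]

theorem IsCoordinates.of_specializes {w x : X.carrier} (h : w ⤳ x) {v : Fin n → X.carrier.functionField}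
    (hv : IsCoordinates ℂ (localRing X.carrier x) v) : IsCoordinates ℂ (localRing X.carrier w) v :=
  hv.of_localization (localRing_mono h) fun _ ha => exists_mul_eq_of_specializes h ha

/-- Coordinates that vanish at `y` are at most as many as the codimension of `y`. -/
theorem card_le_coheight (y : X.carrier) (v : Fin n → X.carrier.presheaf.stalk y)
    (b : Module.Basis (Fin n) (X.carrier.presheaf.stalk y) Ω[X.carrier.presheaf.stalk y⁄ℂ])
    (hb : ∀ i, b i = KaehlerDifferential.D ℂ _ (v i)) (S : Finset (Fin n))
    (hS : ∀ i ∈ S, v i ∈ IsLocalRing.maximalIdeal (X.carrier.presheaf.stalk y)) : (S.card : ℕ∞) ≤ coheight y := by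
  let σ : Fin S.card → Fin n := fun i => (S.equivFin.symm i).1
  have hσ : Function.Injective σ := Subtype.val_injective.comp S.equivFin.symm.injective
  have := natCast_le_ringKrullDim_of_derivation (k := ℂ) S.card (fun i => v (σ i)) (fun i => hS _ (S.equivFin.symm i).2)
    (fun i => (b.coord (σ i)).compDer (KaehlerDifferential.D ℂ _)) (fun i j => by
      change b.coord (σ i) (KaehlerDifferential.D ℂ _ (v (σ j))) = _
      rw [← hb, Module.Basis.coord_apply, b.repr_self, Finsupp.single_apply]
      simp [eq_comm, hσ.eq_iff])
  rw [ringKrullDim_stalk_eq_coheight] at this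
  exact_mod_cast this

end

/-- If only exponents below m occurred, the supremum would be at most m - 1. The condition m ≠ 0
excludes the empty set of exponents, whose supremum is 0. -/
theorem exists_of_le_multiplicity {X : Scheme.{0}} [IsIntegral X] [IsLocallyNoetherian X] {D : AlgebraicCycle X ℤ} {z : X} {m : ℕ}
    (hm : (m : ℕ∞) ≤ multiplicity D z) (hm0 : m ≠ 0) : ∃ a : X.presheaf.stalk z,
      a ∈ IsLocalRing.maximalIdeal (X.presheaf.stalk z) ^ m ∧ IsLocalEquation D z (algebraMap (X.presheaf.stalk z) X.functionField a) := by
  by_contra! h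
  have h1 : multiplicity D z ≤ (m - 1 : ℕ) := by
    refine sSup_le ?_
    rintro _ ⟨j, a, rfl, ha, he⟩
    by_contra! hj
    have : m ≤ j := by
      have : m - 1 < j := by exact_mod_cast hj
      omega
    exact h a (Ideal.pow_le_pow_right this ha) he
  have h2 : m ≤ m - 1 := by exact_mod_cast hm.trans h1
  omega

/-! ### Coordinates along an exceptional divisor -/

section
variable {n : ℕ} {X Y : SmoothVariety n} {f : X.carrier ⟶ Y.carrier} {φ : Y.carrier.functionField →+* X.carrier.functionField}
  {I : Y.carrier.IdealSheafData}

theorem stalkIdeal_le_maximalIdeal {Y : Scheme.{0}} {I : Y.IdealSheafData} (U : Y.affineOpens) {y : Y} (hy : y ∈ U.1)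
    (hyI : y ∈ I.support) : stalkIdeal I U y hy ≤ IsLocalRing.maximalIdeal (Y.presheaf.stalk y) := by
  rw [stalkIdeal, Ideal.map_le_iff_le_comap]
  intro s hs hu
  rw [Scheme.IdealSheafData.mem_support_iff_of_mem hy] at hyI
  have := (Scheme.mem_zeroLocus_iff _ _ _).1 hyI s hs
  exact this ((Scheme.mem_basicOpen Y s y hy).2 hu)

/-- If a lies in the prime of y, then c a s ∈ I for some c, s outside that prime. A generization z
of y in the support has a prime containing I but neither c nor s, hence containing a; so z = y. -/
theorem isComponentGenericPoint_of_stalkIdeal_eq {Y : Scheme.{0}} {I : Y.IdealSheafData} (U : Y.affineOpens) {y : Y} (hy : y ∈ U.1)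
    (hyI : y ∈ I.support) (h : stalkIdeal I U y hy = IsLocalRing.maximalIdeal (Y.presheaf.stalk y)) :
    IsComponentGenericPoint (I.support : Set Y) y := by
  refine ⟨hyI, fun z hz hzy => ?_⟩
  have hzU : z ∈ U.1 := hzy.mem_open U.1.2 hy
  algebraize [(Y.presheaf.germ U.1 y hy).hom]
  have : IsLocalization.AtPrime (Y.presheaf.stalk y) (U.2.primeIdealOf ⟨y, hy⟩).asIdeal := U.2.isLocalization_stalk ⟨y, hy⟩
  refine (hzy.antisymm ?_).eq
  have hle : (U.2.primeIdealOf ⟨y, hy⟩).asIdeal ≤ (U.2.primeIdealOf ⟨z, hzU⟩).asIdeal := by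
    intro a ha
    have hzI : I.ideal U ≤ (U.2.primeIdealOf ⟨z, hzU⟩).asIdeal := by
      have h1 := (Scheme.IdealSheafData.mem_support_iff_of_mem hzU).1 hz
      replace h1 : (⟨z, hzU⟩ : U.1).1 ∈ Y.zeroLocus (U := U.1) (I.ideal U : Set Γ(Y, U.1)) := h1
      rw [← U.2.fromSpec_primeIdealOf ⟨z, hzU⟩] at h1
      have h2 : U.2.primeIdealOf ⟨z, hzU⟩ ∈ U.2.fromSpec ⁻¹' (Y.zeroLocus (U := U.1) (I.ideal U : Set Γ(Y, U.1))) := h1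
      rw [U.2.fromSpec_preimage_zeroLocus] at h2
      exact h2
    have h3 : algebraMap _ (Y.presheaf.stalk y) a ∈ IsLocalRing.maximalIdeal (Y.presheaf.stalk y) := by
      rw [← IsLocalization.AtPrime.map_eq_maximalIdeal (U.2.primeIdealOf ⟨y, hy⟩).asIdeal]
      exact Ideal.mem_map_of_mem _ ha
    rw [← h, stalkIdeal] at h3
    obtain ⟨⟨p, s⟩, hps⟩ := (IsLocalization.mem_map_algebraMap_iff (U.2.primeIdealOf ⟨y, hy⟩).asIdeal.primeCompl _).1 h3
    rw [← map_mul, IsLocalization.eq_iff_exists (U.2.primeIdealOf ⟨y, hy⟩).asIdeal.primeCompl] at hps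
    obtain ⟨c, hc⟩ := hps
    have hspec : U.2.primeIdealOf ⟨z, hzU⟩ ⤳ U.2.primeIdealOf ⟨y, hy⟩ := by
      refine (U.2.isOpenImmersion_fromSpec.base_open.isInducing.specializes_iff).1 ?_
      change U.2.fromSpec _ ⤳ U.2.fromSpec _
      rwa [U.2.fromSpec_primeIdealOf, U.2.fromSpec_primeIdealOf]
    rw [← PrimeSpectrum.le_iff_specializes] at hspec
    have h4 : (c : Γ(Y, U.1)) * (a * s) ∈ (U.2.primeIdealOf ⟨z, hzU⟩).asIdeal := by
      rw [hc]; exact Ideal.mul_mem_left _ _ (hzI p.2)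
    have h5 := (Ideal.IsPrime.mem_or_mem inferInstance h4).resolve_left fun h => c.2 (hspec h)
    exact (Ideal.IsPrime.mem_or_mem inferInstance h5).resolve_right fun h => s.2 (hspec h)
  have h6 : U.2.primeIdealOf ⟨y, hy⟩ ⤳ U.2.primeIdealOf ⟨z, hzU⟩ := (PrimeSpectrum.le_iff_specializes _ _).1 hle
  have h7 := h6.map U.2.fromSpec.continuous
  rwa [U.2.fromSpec_primeIdealOf, U.2.fromSpec_primeIdealOf] at h7

theorem mul_ne_one_of_ord_pos {X : Scheme.{0}} [IsIntegral X] [IsLocallyNoetherian X] {w : X} {t r : X.functionField}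
    (ht : 1 ≤ Scheme.ord t w) (hr : r ∈ localRing X w) : t * r ≠ 1 := by
  intro h
  have h1 := Scheme.ord_mul (x := w) (left_ne_zero_of_mul_eq_one h) (right_ne_zero_of_mul_eq_one h)
  rw [h, ord_one] at h1
  have := ord_nonneg_of_mem hr
  omega

/-- If v i = t² u with t a uniformizer, its partial derivative is divisible by t, yet it equals 1.
-/
theorem IsCoordinates.ord_eq_one {w : X.carrier} (hw : coheight w = 1) {v : Fin n → X.carrier.functionField}
    (hv : IsCoordinates ℂ (localRing X.carrier w) v) {i : Fin n} (hi : 1 ≤ Scheme.ord (v i) w) : Scheme.ord (v i) w = 1 := by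
  obtain ⟨δ, hδ, hδR⟩ := hv.exists_derivation
  obtain ⟨t', ht', ht0', ht⟩ := exists_uniformizer hw
  have htR : algebraMap _ X.carrier.functionField t' ∈ localRing X.carrier w := ⟨t', rfl⟩
  have ht0 : algebraMap _ X.carrier.functionField t' ≠ 0 := by simpa using ht0'
  generalize algebraMap _ X.carrier.functionField t' = t at *
  by_contra h
  have hv0 : v i ≠ 0 := by
    intro h0
    rw [h0] at hi
    simp at hi
  have htt : t * t ≠ 0 := mul_ne_zero ht0 ht0
  have hu : v i * (t * t)⁻¹ ∈ localRing X.carrier w := by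
    rw [mem_localRing_iff_ord_nonneg hw (mul_ne_zero hv0 (inv_ne_zero htt)), Scheme.ord_mul hv0 (inv_ne_zero htt), ord_inv,
      Scheme.ord_mul ht0 ht0]
    omega
  obtain ⟨u, hu, huv⟩ : ∃ u ∈ localRing X.carrier w, v i = t * t * u := ⟨_, hu, by field_simp⟩
  have h1 := hδ i i
  rw [huv, if_pos rfl, Derivation.leibniz, Derivation.leibniz] at h1
  simp only [smul_eq_mul] at h1
  refine mul_ne_one_of_ord_pos (t := t) (r := t * δ i u + u * (δ i t + δ i t)) ht.ge ?_ (by rw [← h1]; ring)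
  exact add_mem (mul_mem htR (hδR _ _ hu)) (mul_mem hu (add_mem (hδR _ _ htR) (hδR _ _ htR)))

/-- If v j = v i u, differentiating along v j gives 1 = v i ∂u, impossible when v i vanishes along
w. -/
theorem IsCoordinates.ord_lt_one {w : X.carrier} (hw : coheight w = 1) {v : Fin n → X.carrier.functionField}
    (hv : IsCoordinates ℂ (localRing X.carrier w) v) {i j : Fin n} (hij : i ≠ j) (hi : 1 ≤ Scheme.ord (v i) w) : Scheme.ord (v j) w < 1 := by
  obtain ⟨δ, hδ, hδR⟩ := hv.exists_derivation
  by_contra! hj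
  have hi1 := hv.ord_eq_one hw hi
  have hi0 : v i ≠ 0 := by
    intro h0
    rw [h0] at hi
    simp at hi
  have hj0 : v j ≠ 0 := by
    intro h0
    rw [h0] at hj
    simp at hj
  have hu : v j * (v i)⁻¹ ∈ localRing X.carrier w := by
    rw [mem_localRing_iff_ord_nonneg hw (mul_ne_zero hj0 (inv_ne_zero hi0)), Scheme.ord_mul hj0 (inv_ne_zero hi0), ord_inv]
    omega
  obtain ⟨u, hu, huv⟩ : ∃ u ∈ localRing X.carrier w, v j = v i * u := ⟨_, hu, by field_simp⟩
  have h1 := hδ j j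
  rw [huv, if_pos rfl, Derivation.leibniz, hδ, if_neg hij.symm, smul_zero, add_zero] at h1
  exact mul_ne_one_of_ord_pos hi (hδR _ _ hu) h1

/-- Coordinates at the generic point `w` of an exceptional divisor, compared with coordinates at
its image, and the order along it of the pullback of the center. -/
theorem IsBlowUp.exceptional_coordinates (hb : IsBlowUp I f) (hf : f ≫ Y.str = X.str) (hφ : IsFunctionFieldMap f φ) (hs : Function.Surjective φ)
    (hI : Smooth (I.subschemeι ≫ Y.str)) {w : X.carrier} (hw : coheight w = 1) (hwI : f w ∈ I.support) :
    IsComponentGenericPoint (I.support : Set Y.carrier) (f w) ∧ ∃ (c : ℕ) (v : Fin n → Y.carrier.functionField)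
      (v' : Fin n → X.carrier.functionField) (x : Y.carrier.presheaf.stalk (f w)), c ≠ 0 ∧ (c : ℕ∞) ≤ coheight (f w) ∧
      IsCoordinates ℂ (localRing Y.carrier (f w)) v ∧ IsCoordinates ℂ (localRing X.carrier w) v' ∧
      IsJacobian ℂ (fun i => φ (v i)) v' (φ (algebraMap _ _ x) ^ (c - 1)) ∧ Scheme.ord (φ (algebraMap _ _ x)) w = 1 ∧
      ∀ a ∈ IsLocalRing.maximalIdeal (Y.carrier.presheaf.stalk (f w)), f.stalkMap w x ∣ f.stalkMap w a := by
  obtain ⟨U, hU, hy⟩ := exists_affineOpen_mem (f w)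
  have := formallySmooth_residueField (k := ℂ) (A := Y.carrier.presheaf.stalk (f w))
  have := formallySmooth_quotient_stalkIdeal Y I hI ⟨U, hU⟩ (f w) hy
  obtain ⟨v, b, S, hbv, hIv, hmax⟩ := exists_adapted_coordinates n (k := ℂ) (A := Y.carrier.presheaf.stalk (f w)) (stalk_properties Y (f w)).2.2.2.2.2
    (stalkIdeal I ⟨U, hU⟩ (f w) hy) (stalkIdeal_le_maximalIdeal ⟨U, hU⟩ hy hwI)
  obtain ⟨i₀, hi₀, h0, q, hq, hloc⟩ := hb.exists_fractions w ⟨U, hU⟩ hy v S hIv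
  have hvS : ∀ i ∈ S, v i ∈ IsLocalRing.maximalIdeal (Y.carrier.presheaf.stalk (f w)) := fun i hi =>
    stalkIdeal_le_maximalIdeal ⟨U, hU⟩ hy hwI (hIv ▸ Ideal.subset_span ⟨i, hi, rfl⟩)
  let : Algebra Y.carrier.functionField X.carrier.functionField := φ.toAlgebra
  have : IsScalarTower ℂ Y.carrier.functionField X.carrier.functionField := .of_algebraMap_eq fun c => (hφ.map_algebraMap hf c).symm
  have hv : IsCoordinates ℂ (localRing Y.carrier (f w)) (fun i => algebraMap _ Y.carrier.functionField (v i)) := isCoordinates_of_basis v b hbv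
  have hv2 := hv.map (L := X.carrier.functionField) hs
  have h0' : φ (algebraMap _ Y.carrier.functionField (v i₀)) ≠ 0 := by rw [← hφ w]; simpa using h0
  have hqe : ∀ i ∈ S, φ (algebraMap _ Y.carrier.functionField (v i)) / φ (algebraMap _ Y.carrier.functionField (v i₀)) = algebraMap _ X.carrier.functionField (q i) := fun i hi => by
    rw [← hφ w, hq i hi, map_mul, hφ w]
    exact mul_div_cancel_right₀ _ h0'
  have hclos : ∀ p ∈ Subring.closure (Set.range (f.stalkMap w) ∪ q '' S), algebraMap _ X.carrier.functionField p ∈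
      Subring.closure (((localRing Y.carrier (f w)).map φ : Set X.carrier.functionField) ∪ {x | ∃ i ∈ S, x = φ (algebraMap _ Y.carrier.functionField (v i)) / φ (algebraMap _ Y.carrier.functionField (v i₀))}) := by
    intro p hp
    have : Subring.closure (Set.range (f.stalkMap w) ∪ q '' S) ≤ (Subring.closure (((localRing Y.carrier (f w)).map φ : Set X.carrier.functionField) ∪
        {x | ∃ i ∈ S, x = φ (algebraMap _ Y.carrier.functionField (v i)) / φ (algebraMap _ Y.carrier.functionField (v i₀))})).comap (algebraMap _ X.carrier.functionField) := by
      rw [Subring.closure_le]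
      rintro _ (⟨a, rfl⟩ | ⟨i, hi, rfl⟩)
      · exact Subring.subset_closure (Or.inl ⟨_, ⟨a, rfl⟩, (hφ w a).symm⟩)
      · exact Subring.subset_closure (Or.inr ⟨i, hi, (hqe i hi).symm⟩)
    exact this hp
  -- `hloc` presents the local ring at w as fractions in the v i / v i₀ over the image of the local
  -- ring at f w.
  have hcoord := isCoordinates_blowUpCoordinates (R' := localRing X.carrier w) hi₀ h0' hv2
    (by rintro _ ⟨a, ha, rfl⟩; exact hφ.map_mem ha) (fun i hi => ⟨q i, (hqe i hi).symm⟩) (by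
      rintro _ ⟨b, rfl⟩
      obtain ⟨p, hp, s, hs, ⟨u, rfl⟩, hps⟩ := hloc b
      refine ⟨_, hclos p hp, _, hclos _ hs, ⟨(u⁻¹ : (X.carrier.presheaf.stalk w)ˣ).val, ?_⟩, ?_, ?_⟩
      · simp
      · simp
      · rw [← map_mul, hps])
  have hjac := (isJacobian_blowUpCoordinates hi₀ h0' hv2.2.1).2
  set v' := blowUpCoordinates (fun i => φ (algebraMap _ Y.carrier.functionField (v i))) S i₀ with hv'
  have hpos : ∀ i, v i ∈ IsLocalRing.maximalIdeal (Y.carrier.presheaf.stalk (f w)) → φ (algebraMap _ Y.carrier.functionField (v i)) ≠ 0 →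
      1 ≤ Scheme.ord (φ (algebraMap _ Y.carrier.functionField (v i))) w := fun i hi h0 => by
    rw [← hφ w] at h0 ⊢
    refine ord_pos_of_mem_maximalIdeal hw (fun h => h0 (by rw [h, map_zero])) ?_
    exact fun hu => hi (isUnit_of_map_unit (f.stalkMap w).hom _ hu)
  have hvi₀ : v' i₀ = φ (algebraMap _ Y.carrier.functionField (v i₀)) := by simp [hv', blowUpCoordinates]
  have hord0 : 1 ≤ Scheme.ord (v' i₀) w := hvi₀ ▸ hpos i₀ (hvS _ hi₀) h0'
  -- Otherwise a coordinate v j outside S vanishes at f w. It remains a coordinate at w, beside v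
  -- i₀, and two coordinates cannot both vanish along a prime divisor.
  have hIm : stalkIdeal I ⟨U, hU⟩ (f w) hy = IsLocalRing.maximalIdeal (Y.carrier.presheaf.stalk (f w)) := by
    refine hmax.resolve_right ?_
    rintro ⟨j, hjS, hj⟩
    have hj' : v' j = φ (algebraMap _ Y.carrier.functionField (v j)) := by simp [hv', blowUpCoordinates, hjS]
    have hj0 : φ (algebraMap _ Y.carrier.functionField (v j)) ≠ 0 := by
      intro h
      obtain ⟨e, he⟩ := hv2.2.1
      have := e.ne_zero j
      rw [he] at this
      exact this ((congrArg _ h).trans (map_zero _))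
    have h1 : Scheme.ord (v' j) w < 1 := hcoord.ord_lt_one hw (i := i₀) (j := j) (fun h => hjS (h ▸ hi₀)) hord0
    have h2 := hpos j hj hj0
    rw [hj'] at h1
    omega
  -- Here c is the number of generators of the center and x = v i₀. Only c ≤ codim is required,
  -- since the multiplicity is bounded below by the codimension.
  refine ⟨isComponentGenericPoint_of_stalkIdeal_eq ⟨U, hU⟩ hy hwI hIm, S.card, _, v', v i₀, (Finset.card_pos.2 ⟨i₀, hi₀⟩).ne',
    card_le_coheight Y (f w) v b hbv S hvS, hv, hcoord, hjac, hvi₀ ▸ hcoord.ord_eq_one hw hord0, ?_⟩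
  have hle : IsLocalRing.maximalIdeal (Y.carrier.presheaf.stalk (f w)) ≤ (Ideal.span {f.stalkMap w (v i₀)}).comap (f.stalkMap w).hom := by
    rw [← hIm, hIv, Ideal.span_le]
    rintro _ ⟨i, hi, rfl⟩
    exact Ideal.mem_span_singleton.2 ⟨q i, (hq i hi).trans (mul_comm _ _)⟩
  exact fun a ha => Ideal.mem_span_singleton.1 (hle ha)

end

/-! ### Prime divisors and components through a point -/

section
variable {X : Scheme.{0}} [IsIntegral X]

theorem genericPoint_specializes (x : X) : genericPoint X ⤳ x := (genericPoint_spec X).specializes trivial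

/-- A prime divisor through `z` in the zero locus of a nonunit at `z`. -/
theorem exists_codim_one_of_mem_maximalIdeal [IsLocallyNoetherian X] {z : X} {a : X.presheaf.stalk z} (ha0 : a ≠ 0)
    (ha : a ∈ IsLocalRing.maximalIdeal (X.presheaf.stalk z)) : ∃ w : X, coheight w = 1 ∧ w ⤳ z ∧
      (algebraMap (X.presheaf.stalk z) X.functionField a)⁻¹ ∉ localRing X w := by
  have hne : Ideal.span {a} ≠ ⊤ := fun h => ha (Ideal.span_singleton_eq_top.1 h)
  obtain ⟨P, hP⟩ := Ideal.nonempty_minimalPrimes hne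
  have hPp : P.IsPrime := hP.1.1
  have haP : a ∈ P := hP.1.2 (Ideal.mem_span_singleton_self a)
  have h1 : P.height ≤ 1 := Ideal.height_le_one_of_isPrincipal_of_mem_minimalPrimes _ _ hP
  have h2 : P.height ≠ 0 := by
    intro h0
    have := (_root_.Ideal.height_eq_zero_iff_eq_bot).1 h0
    rw [this] at haP
    exact ha0 haP
  obtain ⟨w, hwz, hw, hloc⟩ := exists_point_of_prime_stalk z P
  refine ⟨w, ?_, hwz, fun h => ?_⟩
  · rw [hw]
    exact le_antisymm h1 (Order.one_le_iff_ne_zero.2 h2)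
  · obtain ⟨d, hd, c, hc⟩ := hloc _ h
    apply hd
    have h0 : algebraMap (X.presheaf.stalk z) X.functionField a ≠ 0 := by simpa using ha0
    have : d = c * a := by
      apply IsFractionRing.injective (X.presheaf.stalk z) X.functionField
      rw [map_mul, ← hc, mul_assoc, inv_mul_cancel₀ h0, mul_one]
    rw [this]
    exact P.mul_mem_left _ haP

-- A generization of y in Z of least codimension will do: a proper generization has strictly smaller
-- codimension, as codimensions are finite on a locally Noetherian scheme.
omit [AlgebraicGeometry.IsIntegral X] in
theorem exists_isComponentGenericPoint [IsLocallyNoetherian X] (Z : Set X) {y : X} (hy : y ∈ Z) :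
    ∃ z, IsComponentGenericPoint Z z ∧ z ⤳ y := by
  let s : Set ℕ∞ := (fun z : X => coheight z) '' {z | z ∈ Z ∧ z ⤳ y}
  obtain ⟨z, ⟨hz, hzy⟩, hmin⟩ : ∃ z, (z ∈ Z ∧ z ⤳ y) ∧ ∀ w, w ∈ Z ∧ w ⤳ y → coheight z ≤ coheight w := by
    have hs : s.Nonempty := ⟨_, y, ⟨hy, specializes_rfl⟩, rfl⟩
    obtain ⟨z, hz, h⟩ := WellFounded.min_mem (wellFounded_lt (α := ℕ∞)) s hs
    refine ⟨z, hz, fun w hw => ?_⟩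
    have := WellFounded.not_lt_min (wellFounded_lt (α := ℕ∞)) s (x := coheight w) ⟨w, hw, rfl⟩
    rw [← h] at this
    exact not_lt.1 this
  refine ⟨z, ⟨hz, fun w hw hwz => ?_⟩, hzy⟩
  by_contra hne
  have hlt : z < w := lt_iff_le_not_ge.2 ⟨hwz, fun h => hne (Specializes.antisymm hwz h).eq⟩
  have hfin : coheight w < ⊤ := by
    have := ringKrullDim_lt_top (R := X.presheaf.stalk w)
    rw [ringKrullDim_stalk_eq_coheight] at this
    exact WithBot.coe_lt_coe.1 this
  exact (Order.coheight_strictAnti hlt hfin).not_ge (hmin w ⟨hw, hwz.trans hzy⟩)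

end

/-! ### Points of a blow-up off the center -/

section
variable {X Y : Scheme.{0}} [IsIntegral X] [IsIntegral Y] {I : Y.IdealSheafData} {f : X ⟶ Y}

/-- Otherwise I = 0, and the zero ideal is not invertible on the integral scheme X. -/
theorem IsBlowUp.genericPoint_notMem (hb : IsBlowUp I f) : genericPoint Y ∉ I.support := by
  intro h
  have h1 : I.support = ⊤ := by
    rw [eq_top_iff]
    intro y _
    exact (genericPoint_specializes y).mem_closed I.support.isClosed h
  rw [Scheme.IdealSheafData.support_eq_top_iff] at h1
  obtain ⟨U, hU, a, ha, h⟩ := hb.1 (genericPoint X)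
  rw [h1, Scheme.IdealSheafData.comap_bot, Scheme.IdealSheafData.ideal_bot] at h
  have : Nonempty U.1 := ⟨⟨_, hU⟩⟩
  exact nonZeroDivisors.ne_zero ha (Ideal.span_singleton_eq_bot.1 h.symm)

omit [AlgebraicGeometry.IsIntegral X] [AlgebraicGeometry.IsIntegral Y] in
theorem IsBlowUp.isIso_restrict_compl (hb : IsBlowUp I f) : IsIso (f ∣_ (⟨(I.support : Set Y)ᶜ, I.support.isClosed.isOpen_compl⟩ : Y.Opens)) :=
  hb.isIso_restrict _ fun _ h => h

theorem IsBlowUp.isIso_stalkMap (hb : IsBlowUp I f) {x : X} (hx : f x ∉ I.support) : IsIso (f.stalkMap x) :=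
  have := hb.isIso_restrict_compl
  isIso_stalkMap_of_isIso_restrict ⟨(I.support : Set Y)ᶜ, I.support.isClosed.isOpen_compl⟩ x hx

theorem IsBlowUp.coheight_eq (hb : IsBlowUp I f) {x : X} (hx : f x ∉ I.support) : coheight (f x) = coheight x :=
  have := hb.isIso_restrict_compl
  coheight_eq_of_isIso_restrict ⟨(I.support : Set Y)ᶜ, I.support.isClosed.isOpen_compl⟩ x hx

theorem IsBlowUp.injective (hb : IsBlowUp I f) {x x' : X} (hx : f x ∉ I.support) (h : f x' = f x) : x' = x := by
  have := hb.isIso_restrict_compl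
  obtain ⟨g, -, hg⟩ := exists_lift_of_isIso_restrict (f := f) ⟨(I.support : Set Y)ᶜ, I.support.isClosed.isOpen_compl⟩
  rw [← hg x hx, ← hg x' (h ▸ hx)]
  have h2 : ∀ y (hy : y ∉ I.support), y = f x → g ⟨y, hy⟩ = g ⟨f x, hx⟩ := by rintro _ _ rfl; rfl
  exact h2 _ _ h

/-- Generizations lift along a blow-up away from its center. -/
theorem IsBlowUp.exists_specializes (hb : IsBlowUp I f) {x : X} (hx : f x ∉ I.support) {z : Y} (hz : z ⤳ f x) :
    ∃ x', f x' = z ∧ x' ⤳ x := by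
  have := hb.isIso_restrict_compl
  obtain ⟨g, hgf, hg⟩ := exists_lift_of_isIso_restrict (f := f) ⟨(I.support : Set Y)ᶜ, I.support.isClosed.isOpen_compl⟩
  have hz' : z ∉ I.support := fun h => hx (hz.mem_closed I.support.isClosed h)
  refine ⟨g ⟨z, hz'⟩, ?_, ?_⟩
  · exact congrArg (fun k => k ⟨z, hz'⟩) hgf
  · rw [← hg x hx]
    exact Specializes.map ((subtype_specializes_iff _ _).2 hz) g.continuous

theorem IsBlowUp.map_genericPoint (hb : IsBlowUp I f) : f (genericPoint X) = genericPoint Y := by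
  have := hb.isIso_restrict_compl
  obtain ⟨g, hgf, hg⟩ := exists_lift_of_isIso_restrict (f := f) ⟨(I.support : Set Y)ᶜ, I.support.isClosed.isOpen_compl⟩
  let x := g ⟨genericPoint Y, hb.genericPoint_notMem⟩
  have hx : f x = genericPoint Y := congrArg (fun k => k ⟨genericPoint Y, hb.genericPoint_notMem⟩) hgf
  have h1 : f (genericPoint X) ⤳ f x := (genericPoint_specializes x).map f.continuous
  rw [hx] at h1
  exact (h1.antisymm (genericPoint_specializes _)).eq

end

/-! ### Comparison of log canonical divisors -/

section
variable {n : ℕ} {X Y : SmoothVariety n} {f : X.carrier ⟶ Y.carrier} {φ : Y.carrier.functionField →+* X.carrier.functionField}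
  {I : Y.carrier.IdealSheafData}

theorem IsFunctionFieldMap.logOrd_eq (hφ : IsFunctionFieldMap f φ) (hs : Function.Surjective φ) (hf : f ≫ Y.str = X.str) {w : X.carrier}
    (hw : IsIso (f.stalkMap w)) (h1 : coheight w = 1) (h2 : coheight (f w) = 1) {DX : X.carrier → ℤ} {DY : Y.carrier → ℤ} (hD : DX w = DY (f w))
    {b : Fin n → Y.carrier.functionField} (hb : IsDiffBasis ℂ b) : logOrd X DX (fun i => φ (b i)) w = logOrd Y DY b (f w) := by
  obtain ⟨v, hv⟩ := exists_isCoordinates Y (f w)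
  obtain ⟨j, hj⟩ := hv.2.1.exists_isJacobian b
  let : Algebra Y.carrier.functionField X.carrier.functionField := φ.toAlgebra
  have : IsScalarTower ℂ Y.carrier.functionField X.carrier.functionField := .of_algebraMap_eq fun c => (hφ.map_algebraMap hf c).symm
  have hv' := hv.map (L := X.carrier.functionField) hs
  have hj' := hj.map (L := X.carrier.functionField) hs hv.2.1
  have hb' := hb.map (L := X.carrier.functionField) hs
  have e := hφ.map_localRing hw
  rw [show Subring.map (algebraMap Y.carrier.functionField X.carrier.functionField) _ = localRing X.carrier w from e] at hv'
  rw [LogHyperbolic.logOrd_eq Y DY hb hv hj]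
  refine (LogHyperbolic.logOrd_eq X DX hb' hv' hj').trans ?_
  rw [hD]
  exact congrArg _ (hφ.ord_map hs hw h1 h2 j (hj.ne_zero hb))

/-- `F` is birational, an isomorphism away from the boundary, and the pullback of the
logarithmic canonical divisor of the target is at least that of the source. -/
structure LogPullback (F : X.carrier ⟶ Y.carrier) (DX : X.carrier → ℤ) (DY : Y.carrier → ℤ) : Prop where
  comp_str : F ≫ Y.str = X.str
  preimage : F ⁻¹' divisorSupport DY = divisorSupport DX
  isIso_stalkMap : ∀ x ∉ divisorSupport DX, IsIso (F.stalkMap x)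
  injective : ∀ x ∉ divisorSupport DX, ∀ x', F x' = F x → x' = x
  exists_map : ∃ φ : Y.carrier.functionField →+* X.carrier.functionField, IsFunctionFieldMap F φ ∧ Function.Surjective φ ∧
    ∀ b : Fin n → Y.carrier.functionField, IsDiffBasis ℂ b → ∀ h : Y.carrier.functionField, h ≠ 0 → ∀ x : X.carrier,
      ((∀ w, coheight w = 1 → w ⤳ F x → logOrd Y DY b w ≤ Scheme.ord h w) →
        ∀ w, coheight w = 1 → w ⤳ x → logOrd X DX (fun i => φ (b i)) w ≤ Scheme.ord (φ h) w) ∧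
      (x ∉ divisorSupport DX → (∀ w, coheight w = 1 → w ⤳ F x → logOrd Y DY b w = Scheme.ord h w) →
        ∀ w, coheight w = 1 → w ⤳ x → logOrd X DX (fun i => φ (b i)) w = Scheme.ord (φ h) w)

theorem LogPullback.refl (D : X.carrier → ℤ) : LogPullback (𝟙 X.carrier) D D where
  comp_str := Category.id_comp _
  preimage := rfl
  isIso_stalkMap x _ := inferInstance
  injective x _ x' h := h
  exists_map := by
    refine ⟨RingHom.id _, fun x a => ?_, Function.surjective_id, fun b hb h h0 x => ⟨fun H => H, fun _ H => H⟩⟩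
    rw [Scheme.Hom.stalkMap_id]
    rfl

/-- The order conditions chain because b and h are arbitrary on the target: those for F are applied
to ψ ∘ b and ψ h, where ψ is the function field map of G. -/
theorem LogPullback.comp {Z : SmoothVariety n} {F : X.carrier ⟶ Y.carrier} {G : Y.carrier ⟶ Z.carrier} {DX : X.carrier → ℤ} {DY : Y.carrier → ℤ}
    {DZ : Z.carrier → ℤ} (hF : LogPullback F DX DY) (hG : LogPullback G DY DZ) : LogPullback (F ≫ G) DX DZ where
  comp_str := by rw [Category.assoc, hG.comp_str, hF.comp_str]
  preimage := by rw [← hF.preimage, ← hG.preimage]; rfl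
  isIso_stalkMap x hx := by
    have h1 := hF.isIso_stalkMap x hx
    have h2 := hG.isIso_stalkMap (F x) (by rw [← hF.preimage] at hx; exact hx)
    rw [Scheme.Hom.stalkMap_comp]
    exact IsIso.comp_isIso' h2 h1
  injective x hx x' h := by
    refine hF.injective x hx x' (hG.injective (F x) (by rw [← hF.preimage] at hx; exact hx) _ ?_)
    rwa [Scheme.Hom.comp_apply, Scheme.Hom.comp_apply] at h
  exists_map := by
    obtain ⟨φ, hφ, hsφ, H⟩ := hF.exists_map
    obtain ⟨ψ, hψ, hsψ, H'⟩ := hG.exists_map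
    refine ⟨φ.comp ψ, fun x a => ?_, hsφ.comp hsψ, fun b hb h h0 x => ?_⟩
    · rw [Scheme.Hom.stalkMap_comp]
      exact (hφ x _).trans (congrArg φ (hψ (F x) a))
    · let : Algebra Z.carrier.functionField Y.carrier.functionField := ψ.toAlgebra
      have : IsScalarTower ℂ Z.carrier.functionField Y.carrier.functionField := .of_algebraMap_eq fun c => (hψ.map_algebraMap hG.comp_str c).symm
      have hb' : IsDiffBasis ℂ (fun i => ψ (b i)) := hb.map (L := Y.carrier.functionField) hsψ
      have h0' : ψ h ≠ 0 := by simpa using h0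
      refine ⟨fun hyp => ((H _ hb' _ h0' x).1 ((H' _ hb _ h0 (F x)).1 hyp)), fun hx hyp =>
        ((H _ hb' _ h0' x).2 hx ((H' _ hb _ h0 (F x)).2 (by rw [← hF.preimage] at hx; exact hx) hyp))⟩

end

/-! ### A single blow-up -/

section
variable {n : ℕ} {X Y : SmoothVariety n} {f : X.carrier ⟶ Y.carrier} {φ : Y.carrier.functionField →+* X.carrier.functionField}
  {I : Y.carrier.IdealSheafData}

theorem coheight_ne_zero_of_mem_closed {Z : Set Y.carrier} (hZ : IsClosed Z) (hη : genericPoint Y.carrier ∉ Z) {z : Y.carrier} (hz : z ∈ Z) :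
    coheight z ≠ 0 := by
  intro h
  rw [coheight_eq_zero] at h
  have h1 : z ⤳ genericPoint Y.carrier := h (show z ≤ genericPoint Y.carrier from genericPoint_specializes z)
  exact hη (h1.mem_closed hZ hz)

/-- At the generic point of a component the codimension is at least 1, hence so is the multiplicity.
A local equation of D is therefore a nonunit there, and some prime divisor through the point has
nonzero coefficient. -/
theorem support_subset_divisorSupport {D : AlgebraicCycle Y.carrier ℤ} (hη : genericPoint Y.carrier ∉ I.support)
    (hmult : ∀ z, IsComponentGenericPoint (I.support : Set Y.carrier) z → coheight z ≤ multiplicity D z) :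
    (I.support : Set Y.carrier) ⊆ divisorSupport D := by
  intro y hy
  obtain ⟨z, hz, hzy⟩ := exists_isComponentGenericPoint (I.support : Set Y.carrier) hy
  have h1 : ((1 : ℕ) : ℕ∞) ≤ multiplicity D z :=
    le_trans (Order.one_le_iff_ne_zero.2 (coheight_ne_zero_of_mem_closed I.support.isClosed hη hz.1)) (hmult z hz)
  obtain ⟨a, ha, hae⟩ := exists_of_le_multiplicity h1 one_ne_zero
  rw [pow_one] at ha
  obtain ⟨w, hw, hwz, hwa⟩ := exists_codim_one_of_mem_maximalIdeal (fun h => hae.1 (by rw [h, map_zero])) ha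
  refine ⟨w, fun h0 => hwa ?_, hwz.trans hzy⟩
  rw [mem_localRing_iff_ord_nonneg hw (inv_ne_zero hae.1), ord_inv, hae.2 w hw hwz, h0, neg_zero]

/-- The pulled-back ideal is generated near x by a nonunit a, so a⁻¹ is not regular at some prime
divisor w through x. If f w were off the center, a section s of I would be a unit there; as s = c a,
the inverse of a would be regular at w. -/
theorem IsBlowUp.exists_exceptional (hb : IsBlowUp I f) (hφ : IsFunctionFieldMap f φ) {x : X.carrier} (hx : f x ∈ I.support) :
    ∃ w, coheight w = 1 ∧ w ⤳ x ∧ f w ∈ I.support := by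
  obtain ⟨U, hU, hxU⟩ := exists_affineOpen_mem (f x)
  have : Nonempty U := ⟨⟨_, hxU⟩⟩
  obtain ⟨a, ha0, ha⟩ := exists_map_stalkIdeal_eq_span hb.1 x ⟨U, hU⟩ hxU
  have ham : a ∈ IsLocalRing.maximalIdeal (X.carrier.presheaf.stalk x) := by
    have h1 : a ∈ (stalkIdeal I ⟨U, hU⟩ (f x) hxU).map (f.stalkMap x).hom := ha ▸ Ideal.mem_span_singleton_self a
    refine (Ideal.map_le_iff_le_comap.2 ((stalkIdeal_le_maximalIdeal ⟨U, hU⟩ hxU hx).trans ?_)) h1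
    intro s hs
    exact map_nonunit (f.stalkMap x).hom s hs
  obtain ⟨w, hw, hwx, hwa⟩ := exists_codim_one_of_mem_maximalIdeal ha0 ham
  refine ⟨w, hw, hwx, ?_⟩
  by_contra hwI
  apply hwa
  have hwU : f w ∈ U := (hwx.map f.continuous).mem_open U.2 hxU
  have h2 : ∃ s ∈ I.ideal ⟨U, hU⟩, f w ∈ Y.carrier.basicOpen s := by
    by_contra! h
    exact hwI ((Scheme.IdealSheafData.mem_support_iff_of_mem (U := ⟨U, hU⟩) hwU).2 ((Scheme.mem_zeroLocus_iff _ _ _).2 h))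
  obtain ⟨s, hs, hsw⟩ := h2
  have hs1 : f.stalkMap x (Y.carrier.presheaf.germ U (f x) hxU s) ∈ Ideal.span {a} :=
    ha ▸ Ideal.mem_map_of_mem _ (Ideal.mem_map_of_mem _ hs)
  obtain ⟨c, hc⟩ := Ideal.mem_span_singleton'.1 hs1
  have hu : IsUnit (f.stalkMap w (Y.carrier.presheaf.germ U (f w) hwU s)) := ((Scheme.mem_basicOpen _ _ _ hwU).1 hsw).map (f.stalkMap w).hom
  obtain ⟨r, hr⟩ := hu.exists_right_inv
  have e : algebraMap _ X.carrier.functionField (f.stalkMap w (Y.carrier.presheaf.germ U (f w) hwU s)) =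
      algebraMap _ X.carrier.functionField c * algebraMap _ X.carrier.functionField a := by
    rw [← map_mul, hc, hφ, hφ, Y.carrier.algebraMap_germ_eq_germToFunctionField hwU, Y.carrier.algebraMap_germ_eq_germToFunctionField hxU]
  have h3 := congrArg (algebraMap _ X.carrier.functionField) hr
  rw [map_mul, e, map_one] at h3
  rw [inv_eq_of_mul_eq_one_right (b := algebraMap _ X.carrier.functionField c * algebraMap _ X.carrier.functionField r) (by rw [← h3]; ring)]
  exact mul_mem (localRing_mono hwx ⟨c, rfl⟩) ⟨r, rfl⟩

/-- Points over the center lie on exceptional prime divisors, which have coefficient 1 in D_X; off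
the center, prime divisors correspond under f. -/
theorem IsBlowUp.preimage_divisorSupport (hb : IsBlowUp I f) (hφ : IsFunctionFieldMap f φ) {DX : X.carrier → ℤ} {DY : Y.carrier → ℤ}
    (hD : DX = strictTransform f I.support DY + exceptionalDivisor f I.support) (hI : (I.support : Set Y.carrier) ⊆ divisorSupport DY) :
    f ⁻¹' divisorSupport DY = divisorSupport DX := by
  apply Set.Subset.antisymm
  · rintro x ⟨z, hz0, hz⟩
    by_cases hx : f x ∈ I.support
    · obtain ⟨w, hw, hwx, hwI⟩ := hb.exists_exceptional hφ hx
      refine ⟨w, ?_, hwx⟩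
      have hwI' : f w ∈ (I.support : Set Y.carrier) := hwI
      simp [hD, strictTransform, exceptionalDivisor, hwI', hw]
    · obtain ⟨x', rfl, hx'⟩ := hb.exists_specializes hx hz
      refine ⟨x', ?_, hx'⟩
      have : f x' ∉ (I.support : Set Y.carrier) := fun h => hx (hz.mem_closed I.support.isClosed h)
      simpa [hD, strictTransform, exceptionalDivisor, this] using hz0
  · rintro x ⟨z, hz0, hz⟩
    by_cases hzI : f z ∈ (I.support : Set Y.carrier)
    · exact hI ((hz.map f.continuous).mem_closed I.support.isClosed hzI)
    · refine ⟨f z, ?_, hz.map f.continuous⟩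
      simpa [hD, strictTransform, exceptionalDivisor, hzI] using hz0

/-- Write h = k a g with a ∈ 𝔪^c a local equation of D_Y and g the Jacobian of b at f w. By Hartogs
k is regular at f w. Along E the pullback of a vanishes to order at least c, which pays for c - 1
from the Jacobian of the blow-up and 1 from E in D_X. -/
theorem IsBlowUp.logOrd_le_ord_of_exceptional (hb : IsBlowUp I f) (hf : f ≫ Y.str = X.str) (hφ : IsFunctionFieldMap f φ) (hs : Function.Surjective φ)
    (hI : Smooth (I.subschemeι ≫ Y.str)) {DX : X.carrier → ℤ} {DY : AlgebraicCycle Y.carrier ℤ}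
    (hD : DX = strictTransform f I.support DY + exceptionalDivisor f I.support)
    (hmult : ∀ z, IsComponentGenericPoint (I.support : Set Y.carrier) z → coheight z ≤ multiplicity DY z)
    {w : X.carrier} (hw : coheight w = 1) (hwI : f w ∈ I.support) {b : Fin n → Y.carrier.functionField} (hbb : IsDiffBasis ℂ b)
    {h : Y.carrier.functionField} (h0 : h ≠ 0) (hyp : ∀ w', coheight w' = 1 → w' ⤳ f w → logOrd Y DY b w' ≤ Scheme.ord h w') :
    logOrd X DX (fun i => φ (b i)) w ≤ Scheme.ord (φ h) w := by
  obtain ⟨hcomp, c, v, v', t, hc0, hcle, hv, hv', hjac, ht1, hdvd⟩ := hb.exceptional_coordinates hf hφ hs hI hw hwI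
  obtain ⟨a, ha, hae⟩ := exists_of_le_multiplicity (hcle.trans (hmult _ hcomp)) hc0
  obtain ⟨g, hg⟩ := hv.2.1.exists_isJacobian b
  have hg0 := hg.ne_zero hbb
  have hk0 : h / (algebraMap _ _ a * g) ≠ 0 := div_ne_zero h0 (mul_ne_zero hae.1 hg0)
  have hk : h / (algebraMap _ _ a * g) ∈ localRing Y.carrier (f w) := by
    refine mem_localRing_of_ord_nonneg (fun _ => inferInstance) hk0 fun w' hw' hw'w => ?_
    have h1 := hyp w' hw' hw'w
    rw [logOrd_eq Y DY hbb (IsCoordinates.of_specializes Y hw'w hv) hg] at h1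
    rw [div_eq_mul_inv, Scheme.ord_mul h0 (inv_ne_zero (mul_ne_zero hae.1 hg0)), ord_inv, Scheme.ord_mul hae.1 hg0, hae.2 w' hw' hw'w]
    linarith
  have e : φ h = φ (h / (algebraMap _ _ a * g)) * (φ (algebraMap _ _ a) * φ g) := by
    rw [← map_mul, ← map_mul, div_mul_cancel₀ _ (mul_ne_zero hae.1 hg0)]
  have h1 : 0 ≤ Scheme.ord (φ (h / (algebraMap _ _ a * g))) w := ord_nonneg_of_mem (hφ.map_mem hk)
  have hφ0 : ∀ {k}, k ≠ 0 → φ k ≠ 0 := fun h => by simpa using h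
  -- The maximal ideal at f w pulls back into (t), so its c-th power pulls back into (t^c), and t
  -- has order 1 at w.
  have h2 : (c : ℤ) ≤ Scheme.ord (φ (algebraMap _ _ a)) w := by
    have h3 : f.stalkMap w a ∈ Ideal.span {f.stalkMap w t ^ c} := by
      rw [← Ideal.span_singleton_pow]
      have h4 : (IsLocalRing.maximalIdeal (Y.carrier.presheaf.stalk (f w))).map (f.stalkMap w).hom ≤ Ideal.span {f.stalkMap w t} :=
        Ideal.map_le_iff_le_comap.2 fun s hs => Ideal.mem_span_singleton.2 (hdvd s hs)
      apply Ideal.pow_right_mono h4 c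
      rw [← Ideal.map_pow]
      exact Ideal.mem_map_of_mem _ ha
    obtain ⟨r, hr⟩ := Ideal.mem_span_singleton'.1 h3
    have h5 := congrArg (algebraMap _ X.carrier.functionField) hr
    rw [map_mul, map_pow, hφ, hφ] at h5
    have h6 : algebraMap _ X.carrier.functionField r * φ (algebraMap _ _ t) ^ c ≠ 0 := h5 ▸ hφ0 hae.1
    have h7 := right_ne_zero_of_mul h6
    rw [← h5, Scheme.ord_mul (left_ne_zero_of_mul h6) h7, ord_pow (fun h => h7 (by rw [h, zero_pow hc0])), ht1]
    have := ord_nonneg_of_mem (w := w) (h := algebraMap _ X.carrier.functionField r) ⟨r, rfl⟩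
    linarith
  let : Algebra Y.carrier.functionField X.carrier.functionField := φ.toAlgebra
  have : IsScalarTower ℂ Y.carrier.functionField X.carrier.functionField := .of_algebraMap_eq fun c => (hφ.map_algebraMap hf c).symm
  have hjb := (hg.map (L := X.carrier.functionField) hs hv.2.1).trans hjac
  have hbb' := hbb.map (L := X.carrier.functionField) hs
  have e2 := logOrd_eq X DX hbb' hv' hjb
  have ht0 : φ (algebraMap _ _ t) ≠ 0 := fun h => by rw [h] at ht1; simp at ht1
  refine e2.trans_le ?_
  have e3 : DX w = 1 := by
    have hwI' : f w ∈ (I.support : Set Y.carrier) := hwI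
    simp [hD, strictTransform, exceptionalDivisor, hwI', hw]
  have e4 : Scheme.ord (φ g * φ (algebraMap _ _ t) ^ (c - 1)) w = Scheme.ord (φ g) w + (c - 1 : ℕ) := by
    rw [Scheme.ord_mul (hφ0 hg0) (pow_ne_zero _ ht0), ord_pow ht0, ht1, mul_one]
  rw [e3, e, Scheme.ord_mul (hφ0 hk0) (mul_ne_zero (hφ0 hae.1) (hφ0 hg0)), Scheme.ord_mul (hφ0 hae.1) (hφ0 hg0)]
  -- The claim is now 1 + (c - 1) ≤ c up to nonnegative terms; `hc0` makes the natural subtraction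
  -- exact.
  refine (add_le_add_right e4.le 1).trans ?_
  omega

theorem IsBlowUp.logPullback (hb : IsBlowUp I f) (hf : f ≫ Y.str = X.str)
    (hI : Smooth (I.subschemeι ≫ Y.str)) {DX : X.carrier → ℤ} {DY : AlgebraicCycle Y.carrier ℤ}
    (hD : DX = strictTransform f I.support DY + exceptionalDivisor f I.support)
    (hmult : ∀ z, IsComponentGenericPoint (I.support : Set Y.carrier) z → coheight z ≤ multiplicity DY z) : LogPullback f DX DY := by
  have hη : f (genericPoint X.carrier) ∉ I.support := by rw [hb.map_genericPoint]; exact hb.genericPoint_notMem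
  obtain ⟨φ, hφ, hs⟩ := exists_isFunctionFieldMap f hb.map_genericPoint (hb.isIso_stalkMap hη)
  have hsupp := support_subset_divisorSupport hb.genericPoint_notMem hmult
  have hpre := hb.preimage_divisorSupport hφ hD hsupp
  have hx : ∀ x ∉ divisorSupport DX, f x ∉ I.support := fun x hx h => hx (hpre ▸ hsupp h)
  have key : ∀ w, coheight w = 1 → f w ∉ I.support → ∀ b : Fin n → Y.carrier.functionField, IsDiffBasis ℂ b →
      ∀ h : Y.carrier.functionField, h ≠ 0 → logOrd X DX (fun i => φ (b i)) w = logOrd Y DY b (f w) ∧ Scheme.ord (φ h) w = Scheme.ord h (f w) := by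
    intro w hw hwI b hbb h h0
    have hw2 : coheight (f w) = 1 := by rw [hb.coheight_eq hwI, hw]
    refine ⟨hφ.logOrd_eq hs hf (hb.isIso_stalkMap hwI) hw hw2 ?_ hbb, hφ.ord_map hs (hb.isIso_stalkMap hwI) hw hw2 h h0⟩
    have hwI' : f w ∉ (I.support : Set Y.carrier) := hwI
    simp [hD, strictTransform, exceptionalDivisor, hwI']
  refine ⟨hf, hpre, fun x h => hb.isIso_stalkMap (hx x h), fun x h x' h' => hb.injective (hx x h) h', φ, hφ, hs, fun b hbb h h0 x => ⟨?_, ?_⟩⟩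
  · intro hyp w hw hwx
    by_cases hwI : f w ∈ I.support
    · exact hb.logOrd_le_ord_of_exceptional hf hφ hs hI hD hmult hw hwI hbb h0 fun w' hw' hw'w => hyp w' hw' (hw'w.trans (hwx.map f.continuous))
    · obtain ⟨h1, h2⟩ := key w hw hwI b hbb h h0
      rw [h1, h2]
      exact hyp _ (by rw [hb.coheight_eq hwI, hw]) (hwx.map f.continuous)
  · intro hxD hyp w hw hwx
    have hwI : f w ∉ I.support := fun h => hx x hxD ((hwx.map f.continuous).mem_closed I.support.isClosed h)
    obtain ⟨h1, h2⟩ := key w hw hwI b hbb h h0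
    rw [h1, h2]
    exact hyp _ (by rw [hb.coheight_eq hwI, hw]) (hwx.map f.continuous)

end

theorem exists_logPullback {n : ℕ} (N : ℕ) (X : Fin (N + 1) → SmoothVariety n) (D : ∀ i, (X i).carrier → ℤ)
    (f : ∀ i : Fin N, (X i.castSucc).carrier ⟶ (X i.succ).carrier) (hf : ∀ i, LogPullback (f i) (D i.castSucc) (D i.succ)) :
    ∃ F : (X 0).carrier ⟶ (X (Fin.last N)).carrier, LogPullback F (D 0) (D (Fin.last N)) := by
  suffices ∀ i : Fin (N + 1), ∃ F : (X i).carrier ⟶ (X (Fin.last N)).carrier, LogPullback F (D i) (D (Fin.last N)) from this 0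
  intro i
  induction i using Fin.reverseInduction with
  | last => exact ⟨_, LogPullback.refl _⟩
  | cast i ih =>
    obtain ⟨F, hF⟩ := ih
    exact ⟨_, (hf i).comp hF⟩

/-! ### Dimension one, finite morphisms and images -/

section
variable {S T : Scheme.{0}} [IsIntegral S] [IsIntegral T]

theorem topologicalKrullDim_eq_krullDim (T : Scheme.{0}) : topologicalKrullDim T = krullDim T :=
  krullDim_eq_of_orderIso irreducibleSetEquivPoints

theorem topologicalKrullDim_eq_one_iff : topologicalKrullDim T = 1 ↔
    Nontrivial T ∧ ∀ p q : T, p ≠ genericPoint T → p ⤳ q → p = q := by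
  have h1 : krullDim T ≤ 1 ↔ ∀ x : T, x ≠ genericPoint T → IsMin x := by
    rw [krullDim_le_one_iff]
    refine forall_congr' fun x => ⟨fun h hx => h.resolve_right fun h' => hx ?_, fun h => ?_⟩
    · exact (Specializes.antisymm (show x ⤳ genericPoint T from h' (genericPoint_specializes x)) (genericPoint_specializes x)).eq
    · by_cases hx : x = genericPoint T
      · exact .inr fun y _ => hx ▸ genericPoint_specializes y
      · exact .inl (h hx)
  rw [topologicalKrullDim_eq_krullDim, le_antisymm_iff, h1, one_le_krullDim_iff, and_comm]
  refine and_congr ⟨?_, ?_⟩ ⟨?_, ?_⟩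
  · rintro ⟨x, y, h⟩
    exact ⟨x, y, fun e => (lt_irrefl _ (e ▸ h))⟩
  · rintro ⟨x, y, h⟩
    obtain ⟨z, hz⟩ : ∃ z : T, z ≠ genericPoint T := by
      by_contra! h'
      exact h ((h' x).trans (h' y).symm)
    refine ⟨z, genericPoint T, lt_iff_le_not_ge.2 ⟨genericPoint_specializes z, fun h' => hz ?_⟩⟩
    exact (Specializes.antisymm (show z ⤳ genericPoint T from h') (genericPoint_specializes z)).eq
  · intro h p q hp hpq
    exact (Specializes.antisymm hpq (h p hp (show q ≤ p from hpq))).eq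
  · intro h p hp q hqp
    rw [h p q hp hqp]

omit [AlgebraicGeometry.IsIntegral S] [AlgebraicGeometry.IsIntegral T] in
theorem eq_of_specializes_of_locallyQuasiFinite (f : S ⟶ T) [LocallyQuasiFinite f] {p q : S} (h : p ⤳ q) (e : f p = f q) : p = q := by
  have := (f.isDiscrete_preimage_singleton (f q)).to_subtype
  have h1 : (⟨p, e⟩ : f ⁻¹' {f q}) ⤳ ⟨q, rfl⟩ := (subtype_specializes_iff _ _).2 h
  exact congrArg Subtype.val h1.eq

/-- Fibers of f are discrete, so a proper specialization in S has a proper specialization as image.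
-/
theorem eq_of_specializes_of_finite (f : S ⟶ T) [LocallyQuasiFinite f] (hT : ∀ p q : T, p ≠ genericPoint T → p ⤳ q → p = q)
    (p q : S) (hp : p ≠ genericPoint S) (hpq : p ⤳ q) : p = q := by
  refine eq_of_specializes_of_locallyQuasiFinite f hpq (hT _ _ (fun h => hp ?_) (hpq.map f.continuous))
  have h1 : f (genericPoint S) ⤳ f p := (genericPoint_specializes p).map f.continuous
  have h2 : f p ⤳ f (genericPoint S) := h ▸ genericPoint_specializes _
  exact (eq_of_specializes_of_locallyQuasiFinite f (genericPoint_specializes p) (h1.antisymm h2).eq).symm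

theorem map_genericPoint_of_isDominant (f : S ⟶ T) [IsDominant f] : f (genericPoint S) = genericPoint T := by
  refine ((genericPoint_spec S).image f.continuous |>.eq ?_)
  rw [Set.image_univ, f.denseRange.closure_range]
  exact genericPoint_spec T

omit [AlgebraicGeometry.IsIntegral S] [AlgebraicGeometry.IsIntegral T] in
theorem surjective_of_finite_of_isDominant (f : S ⟶ T) [IsFinite f] [IsDominant f] : Function.Surjective f := by
  rw [← Set.range_eq_univ, ← f.isClosedMap.isClosed_range.closure_eq]
  exact f.denseRange.closure_range

theorem topologicalKrullDim_eq_one_iff_of_finite (f : S ⟶ T) [IsFinite f] [IsDominant f] :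
    topologicalKrullDim S = 1 ↔ topologicalKrullDim T = 1 := by
  have hs := surjective_of_finite_of_isDominant f
  have hη := map_genericPoint_of_isDominant f
  rw [topologicalKrullDim_eq_one_iff, topologicalKrullDim_eq_one_iff]
  refine and_congr ⟨fun h => ?_, fun h => hs.nontrivial⟩ ⟨fun h q q' hq hqq' => ?_, eq_of_specializes_of_finite f⟩
  · obtain ⟨p, hp⟩ := exists_ne (genericPoint S)
    exact ⟨f p, f (genericPoint S), fun h => hp (eq_of_specializes_of_locallyQuasiFinite f (genericPoint_specializes p) h.symm).symm⟩
  · obtain ⟨p, rfl⟩ := hs q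
    have h1 : f '' closure {p} = closure {f p} := by
      rw [← f.isClosedMap.closure_image_eq_of_continuous f.continuous, Set.image_singleton]
    have h2 : q' ∈ f '' closure {p} := h1 ▸ specializes_iff_mem_closure.1 hqq'
    obtain ⟨p', hp', rfl⟩ := h2
    rw [h p p' (fun e => hq (by rw [e, hη])) (specializes_iff_mem_closure.2 hp')]

/-- P has finitely many irreducible pieces, each with a generic point other than that of S; such a
point has no proper specialization, so each piece is a single point. -/
theorem finite_of_isClosed_of_genericPoint_notMem [TopologicalSpace.NoetherianSpace S]
    (hS : ∀ p q : S, p ≠ genericPoint S → p ⤳ q → p = q) {P : Set S}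
    (hP : IsClosed P) (hη : genericPoint S ∉ P) : P.Finite := by
  obtain ⟨F, hF, hFc, hFi, rfl⟩ := TopologicalSpace.NoetherianSpace.exists_finite_set_isClosed_irreducible hP
  refine hF.sUnion fun t ht => ?_
  obtain ⟨p, hp⟩ := QuasiSober.sober (hFi t ht) (hFc t ht)
  refine (Set.finite_singleton p).subset fun q hq => ?_
  have hpP : p ∈ t := hp.mem
  exact (hS p q (fun e => hη ⟨t, ht, e ▸ hpP⟩) (hp.specializes hq)).symm

theorem isClosed_divisorSupport {X : Scheme.{0}} (D : AlgebraicCycle X ℤ) : IsClosed (divisorSupport D) := by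
  have h : LocallyFiniteSupport D := fun z => D.supportLocallyFiniteWithinDomain z trivial
  have := h.locallyFinite_support.closure.isClosed_iUnion fun _ => isClosed_closure
  convert this using 1
  ext x
  simp only [divisorSupport, Set.mem_iUnion, Subtype.exists, Function.mem_support, exists_prop, ← specializes_iff_mem_closure]
  rfl

/-- Stated for presheaves because it is applied to a pushforward, which is not the structure sheaf
of a scheme. -/
theorem isReduced_stalk_presheaf {X : TopCat.{0}} (P : X.Presheaf CommRingCat.{0}) [∀ U, _root_.IsReduced (P.obj (Opposite.op U))] (x : X) :
    _root_.IsReduced (P.stalk x) := by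
  refine ⟨fun g ⟨n, e⟩ => ?_⟩
  obtain ⟨U, hxU, s, rfl⟩ := P.exists_germ_eq g
  rw [← map_pow, ← map_zero (P.germ _ x hxU).hom] at e
  obtain ⟨V, hxV, iU, iV, e'⟩ := P.germ_eq x hxU hxU _ 0 e
  rw [map_pow, map_zero] at e'
  replace e' := (IsNilpotent.mk _ _ e').eq_zero
  rw [← P.germ_res iU x hxV, CommRingCat.comp_apply, e', map_zero]

-- S is dense in its scheme-theoretic image, so the image is irreducible; its stalks embed in those
-- of the pushforward of the structure sheaf of S, so it is reduced.
omit [AlgebraicGeometry.IsIntegral T] in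
theorem isIntegral_image (f : S ⟶ T) [QuasiCompact f] : IsIntegral f.image := by
  have h1 : IrreducibleSpace f.image := by
    have := ((IrreducibleSpace.isIrreducible_univ S).image f.toImage f.toImage.continuous.continuousOn).closure
    rw [Set.image_univ, f.toImage.denseRange.closure_range] at this
    exact irreducibleSpace_def _ |>.2 this
  have h2 : IsReduced f.image := by
    have : ∀ x : f.image, _root_.IsReduced (f.image.presheaf.stalk x) := fun x => by
      have : ∀ U, _root_.IsReduced ((f.toImage.base _* S.presheaf).obj (Opposite.op U)) := fun U =>
        inferInstanceAs (_root_.IsReduced Γ(S, f.toImage ⁻¹ᵁ U))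
      have : _root_.IsReduced ((TopCat.Presheaf.stalkFunctor CommRingCat x).obj ((TopCat.Presheaf.pushforward CommRingCat f.toImage.base).obj S.presheaf)) :=
        isReduced_stalk_presheaf (f.toImage.base _* S.presheaf) x
      exact isReduced_of_injective ((TopCat.Presheaf.stalkFunctor _ x).map f.toImage.c).hom (f.stalkFunctor_toImage_injective x)
    exact isReduced_of_isReduced_stalk _
  exact isIntegral_of_irreducibleSpace_of_isReduced _

end

/-! ### Comparison of degrees -/

section
variable {X : Scheme.{0}} [IsIntegral X]

theorem algebraMap_stalkSpecializes {w x : X} (h : w ⤳ x) (a : X.presheaf.stalk x) :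
    algebraMap (X.presheaf.stalk w) X.functionField (X.presheaf.stalkSpecializes h a) = algebraMap (X.presheaf.stalk x) X.functionField a := by
  change (X.presheaf.stalkSpecializes h ≫ X.presheaf.stalkSpecializes _).hom a = _
  rw [X.presheaf.stalkSpecializes_comp]
  rfl

variable [IsLocallyNoetherian X]

theorem IsLocalEquation.of_specializes {D : AlgebraicCycle X ℤ} {w x : X} (h : w ⤳ x) {e : X.functionField} (he : IsLocalEquation D x e) :
    IsLocalEquation D w e :=
  ⟨he.1, fun z hz hzw => he.2 z hz (hzw.trans h)⟩

omit [IsLocallyNoetherian X] in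
theorem exists_unit_of_mem_localRing {x : X} {r : X.functionField} (h0 : r ≠ 0) (h : r ∈ localRing X x) (h' : r⁻¹ ∈ localRing X x) :
    ∃ v : (X.presheaf.stalk x)ˣ, algebraMap (X.presheaf.stalk x) X.functionField v = r := by
  obtain ⟨a, rfl⟩ := h
  obtain ⟨a', ha'⟩ := h'
  have : a * a' = 1 := by
    apply IsFractionRing.injective (X.presheaf.stalk x) X.functionField
    rw [map_mul, ha', mul_inv_cancel₀ h0, map_one]
  exact ⟨Units.mkOfMulEqOne _ _ this, rfl⟩

theorem IsLocalEquation.exists_unit (hX : ∀ x : X, IsIntegrallyClosed (X.presheaf.stalk x)) {D : AlgebraicCycle X ℤ} {x : X} {e e' : X.functionField}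
    (he : IsLocalEquation D x e) (he' : IsLocalEquation D x e') :
    ∃ v : (X.presheaf.stalk x)ˣ, e * algebraMap (X.presheaf.stalk x) X.functionField v = e' := by
  have h1 : ∀ {e e' : X.functionField}, IsLocalEquation D x e → IsLocalEquation D x e' → e' * e⁻¹ ∈ localRing X x := fun {e e'} he he' => by
    refine mem_localRing_of_ord_nonneg hX (mul_ne_zero he'.1 (inv_ne_zero he.1)) fun w hw hwx => ?_
    rw [Scheme.ord_mul he'.1 (inv_ne_zero he.1), ord_inv, he.2 w hw hwx, he'.2 w hw hwx, add_neg_cancel]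
  obtain ⟨v, hv⟩ := exists_unit_of_mem_localRing (mul_ne_zero he'.1 (inv_ne_zero he.1)) (h1 he he') (by simpa using h1 he' he)
  exact ⟨v, by rw [hv, mul_comm, inv_mul_cancel_right₀ he.1]⟩

end

section
variable {n : ℕ} {X Y : SmoothVariety n} {F : X.carrier ⟶ Y.carrier}

/-- `d` is the degree of the pullback of `A` along `t`; for the normalization of a curve this is
`IsDegree`. -/
def IsDegreeAlong (A : AlgebraicCycle Y.carrier ℤ) {C : Scheme.{0}} [IsIntegral C] [IsLocallyNoetherian C] (t : C ⟶ Y.carrier) (d : ℤ) : Prop :=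
  ∃ (g : Y.carrier.functionField) (u : C → (Y.carrier.presheaf.stalk (t (genericPoint C)))ˣ),
    IsLocalEquation A (t (genericPoint C)) g ∧
    (∀ p : C, IsLocalEquation A (t p) (g * algebraMap _ _ (u p).val)) ∧
    (Function.support fun p : C => Scheme.ord ((t.stalkMap (genericPoint C)).hom (u p).val) p).Finite ∧
    d = ∑ᶠ p : C, Scheme.ord ((t.stalkMap (genericPoint C)).hom (u p).val) p

theorem isDegree_iff (A : AlgebraicCycle X.carrier ℤ) (c : NormalizedCurve X.carrier) (d : ℤ) :
    IsDegree A c d ↔ IsDegreeAlong A c.toVariety d := Iff.rfl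

/-- The choice of K enters only through a global function k, so K + D may be replaced by the log
order of a reference form. -/
theorem IsCanonicalDivisor.exists_add_eq {K : AlgebraicCycle X.carrier ℤ} (hK : IsCanonicalDivisor n X.str K) (D : AlgebraicCycle X.carrier ℤ)
    {b : Fin n → X.carrier.functionField} (hb : IsDiffBasis ℂ b) : ∃ k : X.carrier.functionField, k ≠ 0 ∧
      ∀ w, coheight w = 1 → (K + D) w = Scheme.ord k w + logOrd X D b w := by
  obtain ⟨k, hk0, hk⟩ := IsCanonicalDivisor.exists_eq_ord_add_ord X hK hb
  refine ⟨k, hk0, fun w hw => ?_⟩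
  obtain ⟨v, hv⟩ := exists_isCoordinates X w
  obtain ⟨j, hj⟩ := hv.2.1.exists_isJacobian b
  rw [Function.locallyFinsuppWithin.coe_add, Pi.add_apply, hk w hw v hv j hj, logOrd_eq X D hb hv hj]
  ring

/-- The pullback of a local equation of the logarithmic canonical divisor of the target is, up to a
fixed rational function `k`, divisible by one of the source. -/
theorem LogPullback.exists_log_canonical {DX : AlgebraicCycle X.carrier ℤ} {DY : AlgebraicCycle Y.carrier ℤ} (hF : LogPullback F DX DY)
    {KX : AlgebraicCycle X.carrier ℤ} (hKX : IsCanonicalDivisor n X.str KX) {KY : AlgebraicCycle Y.carrier ℤ} (hKY : IsCanonicalDivisor n Y.str KY) :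
    ∃ φ : Y.carrier.functionField →+* X.carrier.functionField, IsFunctionFieldMap F φ ∧ ∃ k ≠ 0, ∀ x h, IsLocalEquation (KY + DY) (F x) h →
      (x ∉ divisorSupport DX → IsLocalEquation (KX + DX) x (φ h * k)) ∧
      ∀ e, IsLocalEquation (KX + DX) x e → φ h * k * e⁻¹ ∈ localRing X.carrier x := by
  obtain ⟨φ, hφ, hs, H⟩ := hF.exists_map
  obtain ⟨b, hb⟩ := exists_isCoordinates Y (genericPoint Y.carrier)
  let : Algebra Y.carrier.functionField X.carrier.functionField := φ.toAlgebra
  have : IsScalarTower ℂ Y.carrier.functionField X.carrier.functionField := .of_algebraMap_eq fun c => (hφ.map_algebraMap hF.comp_str c).symm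
  have hb' : IsDiffBasis ℂ (fun i => φ (b i)) := hb.2.1.map (L := X.carrier.functionField) hs
  obtain ⟨kX, hkX0, hkX⟩ := hKX.exists_add_eq DX hb'
  obtain ⟨kY, hkY0, hkY⟩ := hKY.exists_add_eq DY hb.2.1
  have hφ0 : ∀ {k}, k ≠ 0 → φ k ≠ 0 := fun h => by simpa using h
  -- k compensates for KX and KY being divisors of unrelated forms: both are compared with the same
  -- reference form b, on Y and pulled back to X.
  refine ⟨φ, hφ, φ kY⁻¹ * kX, mul_ne_zero (hφ0 (inv_ne_zero hkY0)) hkX0, fun x h hh => ?_⟩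
  have h0 : h * kY⁻¹ ≠ 0 := mul_ne_zero hh.1 (inv_ne_zero hkY0)
  have hyp : ∀ w, coheight w = 1 → w ⤳ F x → logOrd Y DY b w = Scheme.ord (h * kY⁻¹) w := fun w hw hwx => by
    rw [Scheme.ord_mul hh.1 (inv_ne_zero hkY0), ord_inv, hh.2 w hw hwx, hkY w hw]
    ring
  obtain ⟨H1, H2⟩ := H b hb.2.1 _ h0 x
  rw [← mul_assoc, ← map_mul]
  refine ⟨fun hx => ⟨mul_ne_zero (hφ0 h0) hkX0, fun w hw hwx => ?_⟩, fun e he => ?_⟩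
  · rw [Scheme.ord_mul (hφ0 h0) hkX0, ← H2 hx hyp w hw hwx, hkX w hw, add_comm]
  · have h1 := mul_ne_zero (hφ0 h0) hkX0
    refine mem_localRing_of_ord_nonneg (fun _ => inferInstance) (mul_ne_zero h1 (inv_ne_zero he.1)) fun w hw hwx => ?_
    have := H1 (fun w hw hwx => (hyp w hw hwx).le) w hw hwx
    rw [Scheme.ord_mul h1 (inv_ne_zero he.1), Scheme.ord_mul (hφ0 h0) hkX0, ord_inv, he.2 w hw hwx, hkX w hw]
    linarith

/-- Since the generic point of C lies off D_X, the trivialization g of K_Y + D_Y pulls back to one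
of K_X + D_X. At each p the unit for K_Y + D_Y restricts to the unit for K_X + D_X times some
nonzero σ regular at p, a unit when t p ∉ D_X; orders are compared point by point and summed. -/
theorem LogPullback.exists_isDegreeAlong_le {DX : AlgebraicCycle X.carrier ℤ} {DY : AlgebraicCycle Y.carrier ℤ} (hF : LogPullback F DX DY)
    {KX : AlgebraicCycle X.carrier ℤ} (hKX : IsCanonicalDivisor n X.str KX) {KY : AlgebraicCycle Y.carrier ℤ} (hKY : IsCanonicalDivisor n Y.str KY)
    (hA : IsDivisor (KX + DX)) {C : Scheme.{0}} [IsIntegral C] [IsLocallyNoetherian C] (t : C ⟶ X.carrier)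
    (hη : t (genericPoint C) ∉ divisorSupport DX) (hfin : (t ⁻¹' divisorSupport DX).Finite) {d : ℤ} (hd : IsDegreeAlong (KY + DY) (t ≫ F) d) :
    ∃ d' ≤ d, IsDegreeAlong (KX + DX) t d' := by
  obtain ⟨g, u, hg, hu, hfs, rfl⟩ := hd
  obtain ⟨φ, hφ, k, hk0, H⟩ := hF.exists_log_canonical hKX hKY
  have hu' : ∀ p, IsLocalEquation (KY + DY) (F (t p)) (g * algebraMap _ _ (u p).val) := hu
  have hg' : IsLocalEquation (KX + DX) (t (genericPoint C)) (φ g * k) := (H _ _ hg).1 hη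
  choose e he using fun p => hA.2 (t p)
  have hsp : ∀ p, t (genericPoint C) ⤳ t p := fun p => (genericPoint_specializes p).map t.continuous
  choose v hv using fun p => hg'.exists_unit (fun _ => inferInstance) ((he p).of_specializes (hsp p))
  have key : ∀ p, ∃ σ : C.presheaf.stalk p, σ ≠ 0 ∧ (t ≫ F).stalkMap (genericPoint C) (u p).val =
      (t.stalkMap (genericPoint C)) (v p).val * algebraMap (C.presheaf.stalk p) C.functionField σ ∧ (t p ∉ divisorSupport DX → IsUnit σ) := by
    intro p
    obtain ⟨ρ, hρ⟩ := (H _ _ (hu' p)).2 _ (he p)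
    -- ρ is the quotient of the pulled-back local equation by the local equation e p; the common
    -- factor φ g * k cancels, leaving only units at the generic point and ρ.
    have e1 : F.stalkMap (t (genericPoint C)) (u p).val = (v p).val * X.carrier.presheaf.stalkSpecializes (hsp p) ρ := by
      apply IsFractionRing.injective (X.carrier.presheaf.stalk (t (genericPoint C))) X.carrier.functionField
      rw [map_mul, algebraMap_stalkSpecializes, hρ, map_mul]
      refine (hφ _ _).trans ?_
      have h1 := (he p).1
      rw [← hv p] at h1 ⊢
      have h2 := left_ne_zero_of_mul (left_ne_zero_of_mul h1)
      have h3 := right_ne_zero_of_mul h1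
      have h4 := right_ne_zero_of_mul (left_ne_zero_of_mul h1)
      set α := algebraMap _ X.carrier.functionField (v p).val
      change φ (algebraMap _ _ (u p).val) = _
      have h5 : α * (φ g * φ (algebraMap _ _ (u p).val) * k * (φ g * k * α)⁻¹) = φ (algebraMap _ _ (u p).val) := by
        field_simp
      exact h5.symm
    have e2 : (t ≫ F).stalkMap (genericPoint C) (u p).val = t.stalkMap (genericPoint C) (F.stalkMap (t (genericPoint C)) (u p).val) := by
      rw [Scheme.Hom.stalkMap_comp]; rfl
    have e3 : (t ≫ F).stalkMap (genericPoint C) (u p).val =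
      (t.stalkMap (genericPoint C)) (v p).val * algebraMap (C.presheaf.stalk p) C.functionField (t.stalkMap p ρ) := by
      rw [e2, e1, map_mul, t.stalkSpecializes_stalkMap_apply _ _ (genericPoint_specializes p)]
      rfl
    refine ⟨t.stalkMap p ρ, fun h0 => ?_, e3, fun hp => ?_⟩
    · rw [h0, map_zero, mul_zero] at e3
      have : IsUnit ((t ≫ F).stalkMap (genericPoint C) (u p).val) := (u p).isUnit.map ((t ≫ F).stalkMap (genericPoint C)).hom
      rw [e3] at this
      exact not_isUnit_zero this
    · obtain ⟨w, hw⟩ := (he p).exists_unit (fun _ => inferInstance) ((H _ _ (hu' p)).1 hp)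
      have : ρ = w := by
        apply IsFractionRing.injective (X.carrier.presheaf.stalk (t p)) X.carrier.functionField
        rw [hρ, ← hw, mul_comm (e p), mul_assoc, mul_inv_cancel₀ (he p).1, mul_one]
      rw [this]
      exact w.isUnit.map (t.stalkMap p).hom
  have hord : ∀ p, Scheme.ord ((t.stalkMap (genericPoint C)).hom (v p).val) p ≤ Scheme.ord (((t ≫ F).stalkMap (genericPoint C)).hom (u p).val) p ∧
      (t p ∉ divisorSupport DX → Scheme.ord ((t.stalkMap (genericPoint C)).hom (v p).val) p =
        Scheme.ord (((t ≫ F).stalkMap (genericPoint C)).hom (u p).val) p) := by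
    intro p
    obtain ⟨σ, hσ0, hσ, hσu⟩ := key p
    have h1 : (show C.functionField from (t.stalkMap (genericPoint C)).hom (v p).val) ≠ 0 :=
      ((v p).isUnit.map (t.stalkMap (genericPoint C)).hom).ne_zero
    have h2 : algebraMap (C.presheaf.stalk p) C.functionField σ ≠ 0 := by simpa using hσ0
    have h3 := Scheme.ord_mul (x := p) h1 h2
    have h4 := congrArg (fun a : C.functionField => Scheme.ord a p) hσ
    have h5 := h4.trans h3
    refine ⟨?_, fun hp => ?_⟩
    · have := ord_nonneg_of_mem (w := p) (h := algebraMap (C.presheaf.stalk p) C.functionField σ) ⟨σ, rfl⟩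
      refine le_trans ?_ h5.ge
      exact le_add_of_nonneg_right this
    · have h6 : Scheme.ord (algebraMap (C.presheaf.stalk p) C.functionField σ) p = 0 := by
        obtain ⟨s, rfl⟩ := hσu hp
        refine ord_eq_zero_of_mem ⟨_, rfl⟩ ⟨(s⁻¹).val, ?_⟩
        apply eq_inv_of_mul_eq_one_left
        rw [← map_mul, Units.inv_mul, map_one]
      rw [h6, add_zero] at h5
      exact h5.symm
  -- The orders differ from the given ones only over D_X, which C meets in finitely many points.
  -- Finiteness is essential, as a `finsum` of infinite support is 0 by convention.
  have hfs' : (Function.support fun p : C => Scheme.ord ((t.stalkMap (genericPoint C)).hom (v p).val) p).Finite := by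
    refine (hfs.union hfin).subset fun p hp => ?_
    by_cases hpD : t p ∈ divisorSupport DX
    · exact .inr hpD
    · refine .inl ?_
      rwa [Function.mem_support, (hord p).2 hpD] at hp
  exact ⟨_, finsum_le_finsum' hfs' hfs fun p => (hord p).1, φ g * k, v, hg', fun p => by rw [hv p]; exact he p, hfs', rfl⟩

end

/-! ### Images of curves and transfer of hyperbolicity -/

theorem eq_genericPoint_of_isField {T : Scheme.{0}} [IsIntegral T] {x : T} (h : IsField (T.presheaf.stalk x)) : x = genericPoint T := by
  have h1 := ringKrullDim_eq_zero_of_isField h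
  rw [ringKrullDim_stalk_eq_coheight] at h1
  have h2 : coheight x = 0 := by exact_mod_cast h1
  rw [coheight_eq_zero] at h2
  exact (Specializes.antisymm (show x ⤳ genericPoint T from h2 (show x ≤ genericPoint T from genericPoint_specializes x)) (genericPoint_specializes x)).eq

theorem isField_stalk_of_eq_genericPoint {T : Scheme.{0}} [IsIntegral T] {x : T} (h : x = genericPoint T) : IsField (T.presheaf.stalk x) := by
  subst h
  exact Field.toIsField T.functionField

section
variable {n : ℕ} {X Y : SmoothVariety n} (c : NormalizedCurve X.carrier) {F : X.carrier ⟶ Y.carrier}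

/-- The stalk at the image point is isomorphic to the function field of the normalization, and only
the generic point of an integral scheme has a field as stalk. -/
theorem NormalizedCurve.map_genericPoint : c.ν (genericPoint c.Cn) = genericPoint c.C := by
  have := c.birational
  refine eq_genericPoint_of_isField ?_
  exact MulEquiv.isField (Field.toIsField c.Cn.functionField) (asIso (c.ν.stalkMap (genericPoint c.Cn))).commRingCatIsoToRingEquiv.toMulEquiv

instance : IsDominant c.ν := by
  refine ⟨fun x => ?_⟩
  have h : genericPoint c.C ⤳ x := genericPoint_specializes x
  rw [← c.map_genericPoint] at h
  exact closure_mono (by rintro _ rfl; exact ⟨_, rfl⟩) h.mem_closure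

instance : LocallyQuasiFinite c.toVariety := by
  unfold NormalizedCurve.toVariety
  infer_instance

instance : IsProper c.toVariety := by
  unfold NormalizedCurve.toVariety
  infer_instance

theorem NormalizedCurve.topologicalKrullDim_normalization : topologicalKrullDim c.Cn = 1 :=
  (topologicalKrullDim_eq_one_iff_of_finite c.ν).2 c.dim_one

instance : TopologicalSpace.NoetherianSpace c.Cn := by
  have : IsProper c.str := by
    unfold NormalizedCurve.str
    infer_instance
  have : CompactSpace c.Cn := (quasiCompact_iff_compactSpace c.str).1 inferInstance
  have : IsNoetherian c.Cn := {}
  infer_instance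

theorem NormalizedCurve.finite_preimage_divisorSupport {D : AlgebraicCycle X.carrier ℤ}
    (h : c.toVariety (genericPoint c.Cn) ∉ divisorSupport D) : (c.toVariety ⁻¹' divisorSupport D).Finite :=
  finite_of_isClosed_of_genericPoint_notMem (topologicalKrullDim_eq_one_iff.1 c.topologicalKrullDim_normalization).2
    ((isClosed_divisorSupport D).preimage c.toVariety.continuous) h

theorem NormalizedCurve.genericPoint_notMem_divisorSupport {D : X.carrier → ℤ} (h : ¬ Set.range c.ι ⊆ divisorSupport D) :
    c.toVariety (genericPoint c.Cn) ∉ divisorSupport D := by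
  rintro ⟨z, hz0, hz⟩
  apply h
  rintro _ ⟨x, rfl⟩
  refine ⟨z, hz0, hz.trans ?_⟩
  change c.ι (c.ν (genericPoint c.Cn)) ⤳ _
  rw [c.map_genericPoint]
  exact (genericPoint_specializes x).map c.ι.continuous

theorem NormalizedCurve.stalkMap_surjective : Function.Surjective (c.toVariety.stalkMap (genericPoint c.Cn)) := by
  have := c.birational
  unfold NormalizedCurve.toVariety
  rw [Scheme.Hom.stalkMap_comp]
  exact (ConcreteCategory.bijective_of_isIso (c.ν.stalkMap (genericPoint c.Cn))).2.comp (c.ι.stalkMap_surjective _)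

/-- The stalk map of the image at the generic point goes between fields, hence is injective;
surjectivity is inherited from f. -/
theorem isIso_stalkMap_toImage {S T : Scheme.{0}} [IsIntegral S] [IsIntegral T] (f : S ⟶ T) [QuasiCompact f]
    (hf : Function.Surjective (f.stalkMap (genericPoint S))) : IsIso (f.toImage.stalkMap (genericPoint S)) := by
  have := isIntegral_image f
  have h1 := isField_stalk_of_eq_genericPoint (map_genericPoint_of_isDominant f.toImage)
  have h2 : Function.Surjective (f.toImage.stalkMap (genericPoint S)) := by
    have h3 : Function.Surjective ((f.toImage ≫ f.imageι).stalkMap (genericPoint S)) := by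
      rw [f.toImage_imageι]
      exact hf
    rw [Scheme.Hom.stalkMap_comp] at h3
    exact Function.Surjective.of_comp (g := f.imageι.stalkMap _) h3
  refine (ConcreteCategory.isIso_iff_bijective _).2 ⟨?_, h2⟩
  let := h1.toField
  exact (f.toImage.stalkMap (genericPoint S)).hom.injective

/-- The image of a curve under a morphism that is birational on it, with the same normalization. -/
def NormalizedCurve.image (hF : F ≫ Y.str = X.str) [LocallyQuasiFinite (c.toVariety ≫ F)] (h : IsIso (F.stalkMap (c.toVariety (genericPoint c.Cn)))) :
    NormalizedCurve Y.carrier :=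
  have : IsProper (F ≫ Y.str) := hF ▸ X.proper
  have : IsProper F := .of_comp F Y.str
  have : IsProper (c.toVariety ≫ F).toImage :=
    have : IsProper ((c.toVariety ≫ F).toImage ≫ (c.toVariety ≫ F).imageι) := by
      rw [Scheme.Hom.toImage_imageι]
      infer_instance
    .of_comp _ (c.toVariety ≫ F).imageι
  have : LocallyQuasiFinite (c.toVariety ≫ F).toImage :=
    have : LocallyQuasiFinite ((c.toVariety ≫ F).toImage ≫ (c.toVariety ≫ F).imageι) := by
      rw [Scheme.Hom.toImage_imageι]
      infer_instance
    .of_comp _ (c.toVariety ≫ F).imageι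
  -- Proper and quasi-finite implies finite, so the old normalization is also one of the image.
  have : IsFinite (c.toVariety ≫ F).toImage := .of_isProper_of_locallyQuasiFinite _
  have : IsIntegral (c.toVariety ≫ F).image := isIntegral_image _
  { C := (c.toVariety ≫ F).image
    ι := (c.toVariety ≫ F).imageι
    closedImmersion := inferInstance
    integral := inferInstance
    dim_one := (topologicalKrullDim_eq_one_iff_of_finite (c.toVariety ≫ F).toImage).1 c.topologicalKrullDim_normalization
    Cn := c.Cn
    ν := (c.toVariety ≫ F).toImage
    integral_normalization := inferInstance
    normal := c.normal
    finite := inferInstance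
    birational := isIso_stalkMap_toImage _ (by
      rw [Scheme.Hom.stalkMap_comp]
      exact c.stalkMap_surjective.comp (ConcreteCategory.bijective_of_isIso (F.stalkMap (c.toVariety (genericPoint c.Cn)))).2) }

/-- The image curve has the same normalization over ℂ, so the same genus, and the same boundary
points because F⁻¹(Supp D_Y) = Supp D_X. Only the degree changes, in the favorable direction. -/
theorem LogPullback.isAlgHyperbolic {DX : AlgebraicCycle X.carrier ℤ} {DY : AlgebraicCycle Y.carrier ℤ} (hF : LogPullback F DX DY)
    {KX : AlgebraicCycle X.carrier ℤ} (hKX : IsCanonicalDivisor n X.str KX) {KY : AlgebraicCycle Y.carrier ℤ} (hKY : IsCanonicalDivisor n Y.str KY)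
    (hA : IsAmple (KX + DX)) {ε : ℝ} (h : IsAlgHyperbolic Y DY (KY + DY) ε) : IsAlgHyperbolic X DX (KX + DX) ε := by
  refine ⟨h.1, hA, fun c hc => ?_⟩
  have hη := c.genericPoint_notMem_divisorSupport hc
  have hfin := c.finite_preimage_divisorSupport hη
  -- A fiber containing a point off D_X lies in one fiber of Cn → X, by injectivity of F there; any
  -- other fiber lies in the finite set over D_X.
  have hlqf : LocallyQuasiFinite (c.toVariety ≫ F) := by
    have : IsProper (F ≫ Y.str) := hF.comp_str ▸ X.proper
    have : IsProper F := .of_comp F Y.str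
    refine .of_finite_preimage_singleton _ fun y => ?_
    by_cases hy : ∃ p, (c.toVariety ≫ F) p = y ∧ c.toVariety p ∉ divisorSupport DX
    · obtain ⟨p, rfl, hp⟩ := hy
      refine (c.toVariety.finite_preimage_singleton (c.toVariety p)).subset fun q hq => ?_
      exact hF.injective _ hp _ hq
    · push Not at hy
      exact hfin.subset fun p hp => hy p hp
  let c' := c.image hF.comp_str (hF.isIso_stalkMap _ hη)
  have ht : c'.toVariety = c.toVariety ≫ F := Scheme.Hom.toImage_imageι _
  have hstr : c'.str = c.str := by
    refine (congrArg (fun k : c.Cn ⟶ Y.carrier => k ≫ Y.str) ht).trans ?_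
    exact (Category.assoc _ _ _).trans (congrArg (fun k => c.toVariety ≫ k) hF.comp_str)
  have hc' : ¬ Set.range c'.ι ⊆ divisorSupport DY := by
    intro h'
    apply hη
    rw [← hF.preimage]
    have : (c.toVariety ≫ F) (genericPoint c.Cn) ∈ divisorSupport DY := by
      rw [← ht]
      exact h' ⟨_, rfl⟩
    exact this
  obtain ⟨d, hd, hineq⟩ := h.2.2 c' hc'
  rw [isDegree_iff] at hd
  have hd' : IsDegreeAlong (KY + DY) (c.toVariety ≫ F) d := by
    rw [← ht]
    exact hd
  obtain ⟨d', hle, hdeg⟩ := hF.exists_isDegreeAlong_le hKX hKY hA.1 c.toVariety hη hfin hd'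
  refine ⟨d', hdeg, ?_⟩
  have hg : c'.geometricGenus = c.geometricGenus := by
    change genus c.Cn c'.str = genus c.Cn c.str
    rw [hstr]
  have hi : c'.boundaryCount DY = c.boundaryCount DX := by
    change (c'.toVariety ⁻¹' _ : Set c.Cn).ncard = (c.toVariety ⁻¹' _ : Set c.Cn).ncard
    rw [ht, ← hF.preimage]
    rfl
  rw [hg, hi] at hineq
  have : ε * (d' : ℝ) ≤ ε * d := mul_le_mul_of_nonneg_left (by exact_mod_cast hle) h.1.le
  linarith

end

end

end LogHyperbolic

theorem mainTheorem2 (n N : ℕ)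
    (X : Fin (N + 1) → LogHyperbolic.SmoothVariety n)
    (f : ∀ i : Fin N, (X i.castSucc).carrier ⟶ (X i.succ).carrier)
    (hf : ∀ i : Fin N, f i ≫ (X i.succ).str = (X i.castSucc).str)
    (Z : ∀ i : Fin N, (X i.succ).carrier.IdealSheafData)
    (hZ : ∀ i : Fin N, Smooth ((Z i).subschemeι ≫ (X i.succ).str))
    (hblowUp : ∀ i : Fin N, LogHyperbolic.IsBlowUp (Z i) (f i))
    (D : ∀ i : Fin (N + 1), AlgebraicCycle (X i).carrier ℤ)
    (hDY : LogHyperbolic.IsDivisor (D (Fin.last N))) (hDY_effective : 0 ≤ D (Fin.last N))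
    (hD : ∀ i : Fin N, ⇑(D i.castSucc) =
      LogHyperbolic.strictTransform (f i) (Z i).support (D i.succ) +
        LogHyperbolic.exceptionalDivisor (f i) (Z i).support)
    (hmult : ∀ (i : Fin N) (z : (X i.succ).carrier),
      LogHyperbolic.IsComponentGenericPoint ((Z i).support : Set (X i.succ).carrier) z →
        coheight z ≤ LogHyperbolic.multiplicity (D i.succ) z)
    (KX : AlgebraicCycle (X 0).carrier ℤ)
    (hKX : LogHyperbolic.IsCanonicalDivisor n (X 0).str KX)
    (KY : AlgebraicCycle (X (Fin.last N)).carrier ℤ)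
    (hKY : LogHyperbolic.IsCanonicalDivisor n (X (Fin.last N)).str KY)
    (hampleX : LogHyperbolic.IsAmple (KX + D 0))
    (hampleY : LogHyperbolic.IsAmple (KY + D (Fin.last N)))
    (ε : ℝ)
    (hyp : LogHyperbolic.IsAlgHyperbolic (X (Fin.last N)) (D (Fin.last N))
      (KY + D (Fin.last N)) ε) :
    LogHyperbolic.IsAlgHyperbolic (X 0) (D 0) (KX + D 0) ε := by
  obtain ⟨F, hF⟩ := LogHyperbolic.exists_logPullback N X (fun i => D i) f
    fun i => (hblowUp i).logPullback (hf i) (hZ i) (hD i) (hmult i)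
  exact hF.isAlgHyperbolic hKX hKY hampleX hyp
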